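/- **Conventions.** A sequence $\mathbb M=(M_p)_{p\ge0}$ of positive reals with $M_0=1$ is *strongly regular* if $M_p^2\le M_{p-1}M_{p+1}$ for $p\ge1$; there is $A_1>0$ with $M_{p+q}\le A_1^{p+q}M_pM_q$ for all $p,q\ge0$; and there is $A_2>0$ with $\sum_{q\ge p}\frac{M_q}{(q+1)M_{q+1}}\le A_2\frac{M_p}{M_{p+1}}$ for all $p\ge0$. To a sequence of positive reals $\mathbb M$ one associates $M(t)=\sup_{p\ge0}\log(t^p/M_p)$ for $t>0$, $M(0)=0$, and $\omega(\mathbb M)=1/\rho(M)$, where $\rho(M)=\limsup_{t\to\infty}\max\{0,\log M(t)/\log t\}$. Let $\mathcal R$ be the Riemann surface of the logarithm, $S_d(\theta)=\{z\in\mathcal R:|\arg z-d|<\theta/2\}$, and $\hat S_d(\theta;r)=S_d(\theta)\cup D(0,r)$, where points of $S_d(\theta)$ of modulus less than $r$ are identified with the points of the disc $D(0,r)$ below them. For a complex Banach space $\mathbb E$, $\mathcal O^{\tilde{\mathbb M}}(\hat S_d(\theta;r),\mathbb E)$ is the set of holomorphic $f:\hat S_d(\theta;r)\to\mathbb E$ such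 that for all $0<\theta'<\theta$, $0<r'<r$ there are $c,k>0$ with $\|f(z)\|\le c\exp(\tilde M(|z|/k))$ on $\hat S_d(\theta';r')$. Let $\mathbb M$ be strongly regular with $\omega(\mathbb M)<2$. Functions $e,E$ are *kernel functions for $\mathbb M$-summability* if: 1. $e$ is holomorphic on $S_0(\omega(\mathbb M)\pi)$ and real on $(0,\infty)$; there is $t_0>0$ such that every $z_0\in S_0(\omega(\mathbb M)\pi)$ has a neighbourhood $U\subseteq S_0(\omega(\mathbb M)\pi)$ with $\int_0^{t_0}\sup_{z\in U}|e(t/z)|\frac{dt}{t}<\infty$; and for every $\epsilon>0$ there are $c,k>0$ with $|e(z)|\le c\exp(-M(|z|/k))$ on $S_0(\omega(\mathbb M)\pi-\epsilon)$. 2. $E$ is entire; there are $\tilde c,\tilde k>0$ with $|E(z)|\le\tilde c\exp(M(|z|/\tilde k))$ on $\mathbb C$; and there is $\beta>0$ such that for all $0<\tilde\theta<2\pi-\omega(\mathbb M)\pi$ and $M_E>0$ there is $\tilde c_2>0$ with $|E(z)|\le\tilde c_2|z|^{-\beta}$ for $z\in S_\pi(\tilde\theta)$, $|z|\ge M_E$.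 3. $m_e(z)=\int_0^\infty t^{z-1}e(t)\,dt$ is continuous on $\{\operatorname{Re}z\ge0\}$ and holomorphic on $\{\operatorname{Re}z>0\}$, $m_e(p)\ne0$ for $p\in\mathbb N_0$, and $E(z)=\sum_{p\ge0}z^p/m_e(p)$. If moreover $m_e(p)>0$ for all $p\in\mathbb N_0$, then $m_e=(m_e(p))_{p\ge0}$ is the *sequence of moments* associated with $e$. The moment derivative acts on formal power series over $\mathbb E$ by $\partial_{m_e,z}\bigl(\sum_p\frac{u_p}{m_e(p)}z^p\bigr)=\sum_p\frac{u_{p+1}}{m_e(p)}z^p$, and on functions holomorphic near $0$ through their Taylor series at $0$ (followed by analytic continuation). **Theorem.** Let $m_e$ be the sequence of moments associated with kernel functions $e,E$ for $\mathbb M$-summability, where $\mathbb M$ is strongly regular with $\omega(\mathbb M)<2$. Let $\tilde{\mathbb M}$ be strongly regular, $d\in\mathbb R$, $\theta,r>0$, and $\varphi\in\mathcal O^{\tilde{\mathbb M}}(\hat S_d(\theta;r),\mathbb E)$. Then there is $0<\tilde r<r$ such that, for every $n\in\mathbb N_0$, the function $\partial_{m_e,z}^n\varphi$ (defined near $0$)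 extends holomorphically to $\hat S_d(\theta;\tilde r)$, and for every $0<\theta_1<\theta$ the following hold. 1. For every $z\in\hat S_d(\theta_1;\tilde r)$ and every $0<r_1<r$ there are a piecewise $C^1$ closed path $\Gamma_z$, obtained from the positively oriented circle $\{|w|=r_1\}$ by a deformation through closed paths in $\hat S_d(\theta;r)\setminus\{0\}$, and a choice of directions $\tau=\tau(w)\in\left(-\arg w-\frac{\omega(m_e)\pi}2,-\arg w+\frac{\omega(m_e)\pi}2\right)$ for the points $w$ of $\Gamma_z$, such that for all $n\in\mathbb N_0$ $$\partial_{m_e,z}^n\varphi(z)=\frac1{2\pi i}\oint_{\Gamma_z}\varphi(w)\int_0^{\infty(\tau)}\xi^nE(z\xi)\frac{e(w\xi)}{w\xi}\,d\xi\,dw,$$ where the inner integrals along the ray $\arg\xi=\tau$ converge absolutely and the outer integrand is integrable along $\Gamma_z$. 2. There are $C_1,C_2,C_3>0$ such that for all $n\in\mathbb N_0$ and $z\in\hat S_d(\theta_1;\tilde r)$ $$\|\partial_{m_e,z}^n\varphi(z)\|_{\mathbb E}\le C_1C_2^n\,m_e(n)\exp\bigl(\tilde M(C_3|z|)\bigr).$$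 -/

import Mathlib

noncomputable section

open Set MeasureTheory

/-! ### Strongly regular sequences -/

/-- Strongly regular sequences: positive, normalized, logarithmically convex (`lc`), of moderate
growth (`mg`), and strongly non-quasianalytic (`snq`). -/
structure StronglyRegular (M : ℕ → ℝ) : Prop where
  pos : ∀ p, 0 < M p
  zero : M 0 = 1
  lc : ∀ p, 1 ≤ p → M p ^ 2 ≤ M (p - 1) * M (p + 1)
  mg : ∃ A : ℝ, 0 < A ∧ ∀ p q, M (p + q) ≤ A ^ (p + q) * M p * M q
  snq : ∃ A : ℝ, 0 < A ∧ ∀ p,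
    Summable (fun j : ℕ => M (p + j) / (((p + j : ℕ) + 1 : ℝ) * M (p + j + 1))) ∧
    ∑' j : ℕ, M (p + j) / (((p + j : ℕ) + 1 : ℝ) * M (p + j + 1)) ≤ A * (M p / M (p + 1))

/-- The function `t ↦ sup_p log (t ^ p / M_p)` on `[0, ∞)`, with value `0` at `0`. The supremum is
finite for every strongly regular sequence. -/
def assocFun (M : ℕ → ℝ) (t : ℝ) : ℝ :=
  if t = 0 then 0 else ⨆ p : ℕ, Real.log (t ^ p / M p)

/-- The order of the associated function (a positive real number for strongly regular `M`). -/
def growthOrder (M : ℕ → ℝ) : ℝ :=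
  Filter.limsup (fun t : ℝ => max 0 (Real.log (assocFun M t) / Real.log t)) Filter.atTop

/-- The index `ω(M)`, the inverse of the order of the associated function. -/
def omegaIndex (M : ℕ → ℝ) : ℝ := 1 / growthOrder M

/-! ### Kernel functions and moment sequences -/

/-- The infinite sector in the plane with vertex `0`, bisected by the positive real axis and with
opening `α`. It is only used for `α < 2π`, where it coincides with the sector of the Riemann surface
of the logarithm. -/
def planeSector (α : ℝ) : Set ℂ := {z | z ≠ 0 ∧ |z.arg| < α / 2}

/-- The moment function `z ↦ ∫₀^∞ t ^ (z - 1) e(t) dt`. -/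
def momentFun (e : ℂ → ℂ) (z : ℂ) : ℂ := mellin (fun t : ℝ => e (t : ℂ)) z

/-- `e, E` are kernel functions for `M`-summability (in the case `ω(M) < 2`). -/
structure IsKernelPair (M : ℕ → ℝ) (e E : ℂ → ℂ) : Prop where
  omega_lt_two : omegaIndex M < 2
  e_hol : DifferentiableOn ℂ e (planeSector (omegaIndex M * Real.pi))
  /-- `e(z)/z` is locally uniformly integrable at the origin. -/
  e_int : ∃ t₀ : ℝ, 0 < t₀ ∧ ∀ z₀ ∈ planeSector (omegaIndex M * Real.pi),
    ∃ U : Set ℂ, IsOpen U ∧ z₀ ∈ U ∧ U ⊆ planeSector (omegaIndex M * Real.pi) ∧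
      ∫⁻ t in Ioc 0 t₀, (⨆ z ∈ U, ‖e ((t : ℂ) / z)‖ₑ) / ENNReal.ofReal t < ⊤
  e_decay : ∀ ε : ℝ, 0 < ε → ∃ c k : ℝ, 0 < c ∧ 0 < k ∧
    ∀ z ∈ planeSector (omegaIndex M * Real.pi - ε), ‖e z‖ ≤ c * Real.exp (-assocFun M (‖z‖ / k))
  e_real : ∀ x : ℝ, 0 < x → (e (x : ℂ)).im = 0
  E_hol : Differentiable ℂ E
  E_growth : ∃ c k : ℝ, 0 < c ∧ 0 < k ∧ ∀ z : ℂ, ‖E z‖ ≤ c * Real.exp (assocFun M (‖z‖ / k))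
  /-- Polynomial decay of `E` in the sectors bisected by the negative real axis. -/
  E_decay : ∃ β : ℝ, 0 < β ∧ ∀ α : ℝ, 0 < α → α < 2 * Real.pi - omegaIndex M * Real.pi →
    ∀ ρ : ℝ, 0 < ρ → ∃ c : ℝ, 0 < c ∧
      ∀ z : ℂ, -z ∈ planeSector α → ρ ≤ ‖z‖ → ‖E z‖ ≤ c / ‖z‖ ^ β
  moment_cont : ContinuousOn (momentFun e) {z | 0 ≤ z.re}
  moment_hol : DifferentiableOn ℂ (momentFun e) {z | 0 < z.re}
  moment_ne_zero : ∀ p : ℕ, momentFun e (p : ℂ) ≠ 0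
  E_series : ∀ z : ℂ, HasSum (fun p : ℕ => z ^ p / momentFun e (p : ℂ)) (E z)

/-- `m` is the sequence of moments associated with `e`; such a sequence consists of positive
numbers. -/
def IsMomentSequence (e : ℂ → ℂ) (m : ℕ → ℝ) : Prop :=
  ∀ p : ℕ, 0 < m p ∧ (m p : ℂ) = momentFun e (p : ℂ)

/-! ### The domain `S_d(θ) ∪ D(0, r)`

The sector `S_d(θ)` lies on the Riemann surface of the logarithm and `θ` may exceed `2π`. -/

/-- A point is either a point `w` of the plane (used for the disc) or a point of the Riemann surface
of the logarithm, given by its logarithm `ζ`: modulus `exp (Re ζ)` and argument `Im ζ`. -/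
inductive HatPoint where
  | disc (w : ℂ) : HatPoint
  | sec (ζ : ℂ) : HatPoint

/-- The underlying complex number of a point. -/
def HatPoint.proj : HatPoint → ℂ
  | .disc w => w
  | .sec ζ => Complex.exp ζ

/-- The points of `S_d(θ) ∪ D(0, r)`. -/
def hatSector (d θ r : ℝ) : Set HatPoint
  | .disc w => ‖w‖ < r
  | .sec ζ => |ζ.im - d| < θ / 2

/-- Holomorphic functions on `S_d(θ) ∪ D(0, r)`: holomorphic on the disc, holomorphic on the sector
(in the logarithmic coordinate), with the same values at the two representations of a point of the
sector of modulus less than `r`. -/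
structure IsHolOnHat {F : Type*} [NormedAddCommGroup F] [NormedSpace ℂ F]
    (d θ r : ℝ) (f : HatPoint → F) : Prop where
  disc : DifferentiableOn ℂ (fun w => f (.disc w)) (Metric.ball 0 r)
  sec : DifferentiableOn ℂ (fun ζ => f (.sec ζ)) {ζ | |ζ.im - d| < θ / 2}
  agree : ∀ ζ : ℂ, |ζ.im - d| < θ / 2 → ‖Complex.exp ζ‖ < r → f (.sec ζ) = f (.disc (Complex.exp ζ))

/-- The space `O^M(S_d(θ) ∪ D(0, r), F)`. -/
def HasHatGrowth {F : Type*} [NormedAddCommGroup F] [NormedSpace ℂ F]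
    (M : ℕ → ℝ) (d θ r : ℝ) (f : HatPoint → F) : Prop :=
  IsHolOnHat d θ r f ∧ ∀ θ' r' : ℝ, 0 < θ' → θ' < θ → 0 < r' → r' < r →
    ∃ c k : ℝ, 0 < c ∧ 0 < k ∧
      ∀ z ∈ hatSector d θ' r', ‖f z‖ ≤ c * Real.exp (assocFun M (‖z.proj‖ / k))

/-! ### Moment differentiation -/

/-- Moment differentiation of the formal power series `∑ a_p z ^ p`: it maps
`∑ (u_p / m_p) z ^ p` to `∑ (u_{p+1} / m_p) z ^ p`. -/
def momentDeriv {F : Type*} [NormedAddCommGroup F] [NormedSpace ℂ F]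
    (m : ℕ → ℝ) (a : ℕ → F) : ℕ → F :=
  fun p => (m p : ℂ)⁻¹ • ((m (p + 1) : ℂ) • a (p + 1))

/-- Taylor coefficients at the origin. -/
def taylorCoeffs {F : Type*} [NormedAddCommGroup F] [NormedSpace ℂ F]
    (f : HatPoint → F) : ℕ → F :=
  fun p => ((p.factorial : ℂ))⁻¹ • iteratedDeriv p (fun w : ℂ => f (.disc w)) 0

/-- `g` is the `n`-th moment derivative of `f` on `S_d(θ) ∪ D(0, ρ)`: the (unique) holomorphic
function there whose Taylor series at the origin is the `n`-th formal moment derivative of that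
of `f`. -/
def IsMomentDeriv {F : Type*} [NormedAddCommGroup F] [NormedSpace ℂ F]
    (m : ℕ → ℝ) (d θ ρ : ℝ) (n : ℕ) (f g : HatPoint → F) : Prop :=
  IsHolOnHat d θ ρ g ∧ taylorCoeffs g = (momentDeriv m)^[n] (taylorCoeffs f)

/-! ### Closed paths in `S_d(θ) ∪ D(0, r)` without the origin

Paths are described by a continuous logarithm `ζ`. -/

/-- Logarithms of the points of `(S_d(θ) ∪ D(0, r)) \ {0}`. -/
def logDomain (d θ r : ℝ) : Set ℂ := {ζ | ‖Complex.exp ζ‖ < r ∨ |ζ.im - d| < θ / 2}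

/-- The point with logarithm `ζ ∈ logDomain d θ r`. -/
def logPoint (r : ℝ) (ζ : ℂ) : HatPoint :=
  open Classical in if ‖Complex.exp ζ‖ < r then .disc (Complex.exp ζ) else .sec ζ

/-- Piecewise continuously differentiable paths on `[0, 1]`. -/
def IsPiecewiseC1 (γ : ℝ → ℂ) : Prop :=
  ∃ (N : ℕ) (t : ℕ → ℝ), Monotone t ∧ t 0 = 0 ∧ t N = 1 ∧
    ∀ i < N, ContDiffOn ℝ 1 γ (Icc (t i) (t (i + 1)))

/-- The path `exp ∘ γ` is a piecewise `C¹` closed path which is a deformation, through closed paths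
in `(S_d(θ) ∪ D(0, r)) \ {0}`, of the positively oriented circle of radius `r₁` (starting at some
argument `a`). The two end points of each path of the deformation are the same point of the disc. -/
def IsCircleDeformation (d θ r r₁ : ℝ) (γ : ℝ → ℂ) : Prop :=
  IsPiecewiseC1 γ ∧ ∃ (a : ℝ) (H : ℝ × ℝ → ℂ),
    ContinuousOn H (Icc 0 1 ×ˢ Icc 0 1) ∧
    (∀ s ∈ Icc (0 : ℝ) 1, ∀ t ∈ Icc (0 : ℝ) 1, H (s, t) ∈ logDomain d θ r) ∧
    (∀ s ∈ Icc (0 : ℝ) 1, ‖Complex.exp (H (s, 0))‖ < r ∧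
      H (s, 1) = H (s, 0) + 2 * Real.pi * Complex.I) ∧
    (∀ t ∈ Icc (0 : ℝ) 1, H (0, t) = (Real.log r₁ : ℂ) + ((a + 2 * Real.pi * t : ℝ) : ℂ) * Complex.I) ∧
    (∀ t ∈ Icc (0 : ℝ) 1, H (1, t) = γ t)

/-! ### The integral representation -/

/-- The integrand of `∫₀^{∞(τ)} ξ ^ n E(zξ) e(wξ) / (wξ) dξ` in the parametrization
`ξ = s exp(iτ)`, `s > 0`. -/
def innerIntegrand (e E : ℂ → ℂ) (n : ℕ) (z w : ℂ) (τ s : ℝ) : ℂ :=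
  let ξ : ℂ := (s : ℂ) * Complex.exp (τ * Complex.I)
  ξ ^ n * E (z * ξ) * (e (w * ξ) / (w * ξ)) * Complex.exp (τ * Complex.I)

/-- The integral `∫₀^{∞(τ)} ξ ^ n E(zξ) e(wξ) / (wξ) dξ`. -/
def innerIntegral (e E : ℂ → ℂ) (n : ℕ) (z w : ℂ) (τ : ℝ) : ℂ :=
  ∫ s in Ioi (0 : ℝ), innerIntegrand e E n z w τ s

/-- The integrand of the path integral `∮ φ(w) (inner integral) dw` along `w = exp (γ t)`, with
`τ` a choice of direction for every point of the path. -/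
def outerIntegrand {F : Type*} [NormedAddCommGroup F] [NormedSpace ℂ F]
    (e E : ℂ → ℂ) (r : ℝ) (φ : HatPoint → F) (n : ℕ) (z : ℂ) (γ : ℝ → ℂ) (τ : ℝ → ℝ) (t : ℝ) : F :=
  (innerIntegral e E n z (Complex.exp (γ t)) (τ t) * (Complex.exp (γ t) * deriv γ t)) •
    φ (logPoint r (γ t))

end

/-! Put `κ n x = ∑ m (n + p) / m p * x ^ p`. Moment differentiation shifts and rescales Taylor
coefficients, so Cauchy's formula represents the `n`-th moment derivative near `0` as `(2πi)⁻¹ ∮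
φ(w) w^(-n-1) κ n (z/w) dw` over a circle. The theorem follows once the kernel is continued and the
circle is deformed so that `z` may run through the whole sector.

Kernel. Summing the series of `E` against the moments gives `κ n x = ∫ u^(n-1) e(u) E(x u) du` along
the positive axis for small `x`. Let `W = halfOpening M`. For `x = -exp y` with `|Im y| < π`, the
ray can be turned by an angle `β` with `|β| < W` and `|Im y + β| < π - W`; then `e` is integrable
along the ray and `E` is bounded on it. The choice `β = -(W/π) Im y` satisfies both constraints.
Hence `κ n` is holomorphic on a disc of radius `x₀` together with the plane cut along `[0, ∞)`, and
away from the cut outside the disc it is bounded by `C * B ^ n * m n` (`exists_continued_kernel`).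
The substitution `ξ = u / w` turns `w^(-n-1) κ n (z/w)` into the inner integral of the statement.
Its directions come from the opening `ω(M)π`, and `ω(M) ≤ ω(m)` because `M` and `m` are equivalent
up to geometric factors.

Contour. The only obstruction is `z/w` meeting `[x₀, ∞)`, which can happen only at the points `w`
whose argument is that of `z`. Near that direction the path leaves the circle `|w| = ρ`, inside the
sector, and goes out to `|w| ≥ |z| exp h₀`, where `|z/w| < x₀`. In logarithmic coordinates such
paths `x t + i (a + 2πt)` form a convex set (`IsAdmissible.add_mul_sub`), so a linear homotopy shows
that the integral is independent of the path. It is holomorphic in `log z` because the whole path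
can be translated along with `log z`.

Growth. On the path `|w|` is at least `ρ` and at most a constant multiple of `max ρ |z|`. The factor
`w^(-n)` and the kernel therefore contribute `C * B ^ n * m n`, and `φ` contributes `exp (M̃
(b|z|))`. The speed of the path is at most linear in `|z|`, and moderate growth absorbs this into a
dilation of the argument of `M̃`. -/

section Preparations

open Set MeasureTheory Filter Topology

/-- The quotients `M (p + 1) / M p`. -/
noncomputable def growthQuot (M : ℕ → ℝ) (p : ℕ) : ℝ := M (p + 1) / M p

/-! ### Growth of strongly regular sequences and of their associated functions -/

namespace StronglyRegular

variable {M : ℕ → ℝ}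

lemma growthQuot_pos (hM : StronglyRegular M) (p : ℕ) : 0 < growthQuot M p :=
  div_pos (hM.pos _) (hM.pos _)

lemma growthQuot_monotone (hM : StronglyRegular M) : Monotone (growthQuot M) := by
  refine monotone_nat_of_le_succ fun p => ?_
  have h := hM.lc (p + 1) (by omega)
  rw [show p + 1 - 1 = p by omega] at h
  rw [growthQuot, growthQuot, div_le_div_iff₀ (hM.pos _) (hM.pos _)]
  nlinarith

lemma succ_eq (hM : StronglyRegular M) (p : ℕ) : M (p + 1) = growthQuot M p * M p := by
  rw [growthQuot, div_mul_cancel₀ _ (hM.pos p).ne']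

lemma pow_mul_le_add (hM : StronglyRegular M) (p j : ℕ) :
    growthQuot M p ^ j * M p ≤ M (p + j) := by
  induction j with
  | zero => simp
  | succ j ih =>
    rw [← add_assoc, hM.succ_eq, pow_succ']
    rw [mul_assoc]
    exact mul_le_mul (hM.growthQuot_monotone (by omega)) ih
      (mul_nonneg (pow_nonneg (hM.growthQuot_pos p).le _) (hM.pos p).le) (hM.growthQuot_pos _).le

lemma add_le_pow_mul (hM : StronglyRegular M) (j i p : ℕ) (h : j + i ≤ p) :
    M (j + i) ≤ growthQuot M p ^ i * M j := by
  induction i with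
  | zero => simp
  | succ i ih =>
    rw [← add_assoc, hM.succ_eq, pow_succ', mul_assoc]
    exact mul_le_mul (hM.growthQuot_monotone (by omega)) (ih (by omega)) (hM.pos _).le
      (hM.growthQuot_pos _).le

/-- At `t = M (p + 1) / M p` the quantity `t ^ j / M j` is maximal for `j = p`. -/
lemma pow_div_le_pow_div (hM : StronglyRegular M) (p j : ℕ) :
    growthQuot M p ^ j / M j ≤ growthQuot M p ^ p / M p := by
  have hq := hM.growthQuot_pos p
  rw [div_le_div_iff₀ (hM.pos _) (hM.pos _)]
  rcases le_total p j with h | h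
  · obtain ⟨i, rfl⟩ := Nat.exists_eq_add_of_le h
    rw [pow_add, mul_assoc]
    exact mul_le_mul_of_nonneg_left (hM.pow_mul_le_add p i) (pow_nonneg hq.le _)
  · obtain ⟨i, hi⟩ := Nat.exists_eq_add_of_le h
    have := hM.add_le_pow_mul j i p hi.ge
    rw [← hi] at this
    calc growthQuot M p ^ j * M p ≤ growthQuot M p ^ j * (growthQuot M p ^ i * M j) :=
          mul_le_mul_of_nonneg_left this (pow_nonneg hq.le _)
      _ = growthQuot M p ^ (j + i) * M j := by rw [pow_add, mul_assoc]
      _ = growthQuot M p ^ p * M j := by rw [← hi]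

lemma one_pow_le (hM : StronglyRegular M) (p : ℕ) : M 1 ^ p ≤ M p := by
  have h := hM.pow_mul_le_add 0 p
  simpa [growthQuot, hM.zero] using h

/-- The quotients grow at least like a power. -/
lemma exists_rpow_le_growthQuot (hM : StronglyRegular M) :
    ∃ c δ : ℝ, 0 < c ∧ 0 < δ ∧ ∀ p : ℕ, c * ((p : ℝ) + 1) ^ δ ≤ growthQuot M p := by
  obtain ⟨A, hA, hs⟩ := hM.snq
  set q := growthQuot M with hq
  have hqpos : ∀ p, 0 < q p := hM.growthQuot_pos
  set a : ℕ → ℝ := fun i => 1 / (((i : ℕ) + 1 : ℝ) * q i) with ha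
  have hapos : ∀ i, 0 < a i := fun i => by
    have := hqpos i
    positivity
  have hterm : ∀ i, M i / (((i : ℕ) + 1 : ℝ) * M (i + 1)) = a i := fun i => by
    simp only [ha, hq, growthQuot]
    have h1 := (hM.pos i).ne'
    have h2 := (hM.pos (i + 1)).ne'
    field_simp
  have hsum : Summable a := by
    have := (hs 0).1
    simp only [zero_add] at this
    simpa only [hterm] using this
  have hsum' : ∀ p, Summable fun j => a (p + j) := fun p => by
    simpa only [add_comm p] using (summable_nat_add_iff p).2 hsum
  set R : ℕ → ℝ := fun p => ∑' j, a (p + j) with hR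
  have hRle : ∀ p, R p ≤ A * (1 / q p) := fun p => by
    have h := (hs p).2
    rw [show M p / M (p + 1) = 1 / q p by rw [hq, growthQuot, one_div_div]] at h
    refine le_trans (le_of_eq (tsum_congr fun j => ?_)) h
    rw [hterm]
  have hRsucc : ∀ p, R p = a p + R (p + 1) := fun p => by
    simp only [hR]
    rw [(hsum' p).tsum_eq_zero_add, add_zero]
    congr 1
    exact tsum_congr fun j => by rw [add_right_comm, add_assoc]
  have hR0 : ∀ p, 0 < R p := fun p =>
    (hsum' p).tsum_pos (fun j => (hapos _).le) 0 (hapos _)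
  have hδ : 0 < 1 / A := by positivity
  -- A discrete Gronwall argument: the product of the factors `1 - 1 / (A (i + 1)) ≤ exp (-1 / (A (i
  -- + 1)))` over `i < p` is at most `(p + 1) ^ (-1 / A)`.
  have hdec : ∀ p : ℕ, R p * ((p : ℝ) + 1) ^ (1 / A) ≤ R 0 := by
    intro p
    induction p with
    | zero => simp
    | succ p ih =>
      refine le_trans ?_ ih
      have hp : (0 : ℝ) < (p : ℝ) + 1 := by positivity
      have h1 : R (p + 1) ≤ R p * Real.exp (-(1 / (A * (p + 1)))) := by
        have : R p * (1 - 1 / (A * (p + 1))) ≤ R p * Real.exp (-(1 / (A * (p + 1)))) :=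
          mul_le_mul_of_nonneg_left (by linarith [Real.add_one_le_exp (-(1 / (A * ((p : ℝ) + 1))))])
            (hR0 p).le
        refine le_trans ?_ this
        have h2 : R p / (A * (p + 1)) ≤ a p := by
          have h3 := hRle p
          simp only [ha]
          have hqp := hqpos p
          rw [div_le_iff₀ (by positivity)]
          calc R p ≤ A * (1 / q p) := h3
            _ = _ := by field_simp
        have := hRsucc p
        rw [mul_sub, mul_one, mul_one_div]
        linarith
      have h4 : (((p + 1 : ℕ) : ℝ) + 1) ^ (1 / A)
          ≤ ((p : ℝ) + 1) ^ (1 / A) * Real.exp (1 / (A * (p + 1))) := by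
        have h5 : (((p + 1 : ℕ) : ℝ) + 1) ≤ ((p : ℝ) + 1) * Real.exp (1 / (p + 1)) := by
          have := mul_le_mul_of_nonneg_left (Real.add_one_le_exp (1 / ((p : ℝ) + 1))) hp.le
          refine le_trans (le_of_eq ?_) this
          push_cast
          field_simp
          ring
        calc _ ≤ (((p : ℝ) + 1) * Real.exp (1 / (p + 1))) ^ (1 / A) :=
              Real.rpow_le_rpow (by positivity) h5 hδ.le
          _ = _ := by
              rw [Real.mul_rpow hp.le (Real.exp_pos _).le, ← Real.exp_mul]
              congr 2
              field_simp
      calc R (p + 1) * (((p + 1 : ℕ) : ℝ) + 1) ^ (1 / A)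
          ≤ (R p * Real.exp (-(1 / (A * (p + 1)))))
            * (((p : ℝ) + 1) ^ (1 / A) * Real.exp (1 / (A * (p + 1)))) :=
            mul_le_mul h1 h4 (by positivity) (mul_nonneg (hR0 p).le (Real.exp_pos _).le)
        _ = R p * ((p : ℝ) + 1) ^ (1 / A)
            * (Real.exp (-(1 / (A * (p + 1)))) * Real.exp (1 / (A * (p + 1)))) := by ring
        _ = _ := by rw [← Real.exp_add, neg_add_cancel, Real.exp_zero, mul_one]
  have hlow : ∀ p, 1 / (2 * q (2 * p)) ≤ R p := by
    intro p
    have h1 := (hsum' p).sum_le_tsum (Finset.range (p + 1)) (fun j _ => (hapos _).le)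
    refine le_trans ?_ h1
    have h2 : ∀ j ∈ Finset.range (p + 1), 1 / ((2 * p + 1) * q (2 * p)) ≤ a (p + j) := by
      intro j hj
      have hj' : j ≤ p := by simpa [Nat.lt_succ_iff] using hj
      simp only [ha]
      have h3 : q (p + j) ≤ q (2 * p) := hM.growthQuot_monotone (by omega)
      have h4 : (((p + j : ℕ) : ℝ) + 1) ≤ 2 * p + 1 := by
        have : (j : ℝ) ≤ p := by exact_mod_cast hj'
        push_cast
        linarith
      have := hqpos (p + j)
      exact one_div_le_one_div_of_le (by positivity) (mul_le_mul h4 h3 this.le (by positivity))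
    have h5 := Finset.card_nsmul_le_sum _ _ _ h2
    refine le_trans ?_ h5
    rw [Finset.card_range, nsmul_eq_mul, mul_one_div]
    have := hqpos (2 * p)
    rw [div_le_div_iff₀ (by positivity) (by positivity)]
    push_cast
    nlinarith
  have hR00 := hR0 0
  have heven : ∀ p : ℕ, ((p : ℝ) + 1) ^ (1 / A) / (2 * R 0) ≤ q (2 * p) := by
    intro p
    have h1 := hdec p
    have h2 := hlow p
    have hq2 := hqpos (2 * p)
    have hx : 0 < ((p : ℝ) + 1) ^ (1 / A) := by positivity
    have h3 := (mul_le_mul_of_nonneg_right h2 hx.le).trans h1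
    rw [div_le_iff₀ (by positivity)]
    rw [one_div_mul_eq_div, div_le_iff₀ (by positivity)] at h3
    linarith
  refine ⟨(1 / 2) ^ (1 / A) / (2 * R 0), 1 / A, by positivity, hδ, fun p => ?_⟩
  calc _ = (((p : ℝ) + 1) / 2) ^ (1 / A) / (2 * R 0) := by
        rw [div_mul_eq_mul_div, ← Real.mul_rpow (by norm_num) (by positivity)]
        congr 2
        ring
    _ ≤ (((p / 2 : ℕ) : ℝ) + 1) ^ (1 / A) / (2 * R 0) := by
        have : ((p : ℝ) + 1) / 2 ≤ ((p / 2 : ℕ) : ℝ) + 1 := by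
          have h : p + 1 ≤ 2 * (p / 2 + 1) := by omega
          have h' : ((p : ℝ) + 1) ≤ 2 * (((p / 2 : ℕ) : ℝ) + 1) := by exact_mod_cast h
          linarith
        gcongr
    _ ≤ q (2 * (p / 2)) := heven _
    _ ≤ q p := hM.growthQuot_monotone (by omega)

/-- The associated function is finite, with polynomial growth. -/
lemma exists_log_le (hM : StronglyRegular M) : ∃ C K : ℝ, 0 < C ∧ 0 < K ∧
    ∀ t : ℝ, 0 < t → ∀ p : ℕ, Real.log (t ^ p / M p) ≤ C * (1 + t) ^ K := by
  obtain ⟨c, δ, hc, hδ, h⟩ := hM.exists_rpow_le_growthQuot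
  set b := growthQuot M 0
  have hb : 0 < b := hM.growthQuot_pos 0
  refine ⟨((1 / c) ^ (1 / δ) + 1) * (1 + 1 / b), 1 / δ + 1, by positivity, by positivity, ?_⟩
  intro t ht p
  -- `t ^ p / M p` is the product of the factors `t / growthQuot M i` over `i < p`. By the power
  -- growth of the quotients, only those with `i < N` can exceed `1`, and each of these is at most
  -- `1 + t / b`.
  set N := ⌈(t / c) ^ (1 / δ)⌉₊
  have hN : ∀ i, N ≤ i → t ≤ growthQuot M i := by
    intro i hi
    refine le_trans ?_ (h i)
    have h1 : (t / c) ^ (1 / δ) ≤ (i : ℝ) + 1 :=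
      (Nat.le_ceil _).trans ((Nat.cast_le.2 hi).trans (by linarith))
    have h2 : t / c ≤ ((i : ℝ) + 1) ^ δ := by
      calc t / c = ((t / c) ^ (1 / δ)) ^ δ := by
            rw [← Real.rpow_mul (by positivity), one_div_mul_cancel hδ.ne', Real.rpow_one]
        _ ≤ _ := Real.rpow_le_rpow (by positivity) h1 hδ.le
    rw [div_le_iff₀ hc] at h2
    linarith
  have hx : (1 : ℝ) ≤ 1 + t / b := by
    have : 0 ≤ t / b := by positivity
    linarith
  have hle : ∀ p, t ^ p / M p ≤ (1 + t / b) ^ N := by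
    have small : ∀ p, t ^ p / M p ≤ (1 + t / b) ^ p := by
      intro p
      induction p with
      | zero => simp [hM.zero]
      | succ p ih =>
        rw [pow_succ, pow_succ, hM.succ_eq, mul_comm (growthQuot M p), mul_div_mul_comm]
        have h1 : t / growthQuot M p ≤ 1 + t / b := by
          have : t / growthQuot M p ≤ t / b :=
            div_le_div_of_nonneg_left ht.le hb (hM.growthQuot_monotone (Nat.zero_le _))
          linarith
        exact mul_le_mul ih h1 (div_pos ht (hM.growthQuot_pos p)).le (by positivity)
    intro p
    rcases le_total p N with hp | hp
    · exact (small p).trans (pow_le_pow_right₀ hx hp)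
    · induction p, hp using Nat.le_induction with
      | base => exact small N
      | succ p hp ih =>
        refine le_trans ?_ ih
        rw [pow_succ, hM.succ_eq, mul_comm (growthQuot M p), mul_div_mul_comm]
        exact mul_le_of_le_one_right (div_pos (pow_pos ht _) (hM.pos p)).le
          ((div_le_one (hM.growthQuot_pos p)).2 (hN p hp))
  have hpos : 0 < t ^ p / M p := div_pos (pow_pos ht _) (hM.pos p)
  calc Real.log (t ^ p / M p) ≤ Real.log ((1 + t / b) ^ N) := Real.log_le_log hpos (hle p)
    _ = N * Real.log (1 + t / b) := Real.log_pow _ _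
    _ ≤ (((1 / c) ^ (1 / δ) + 1) * (1 + t) ^ (1 / δ)) * ((1 + 1 / b) * (1 + t)) := by
        have h1 : (N : ℝ) ≤ ((1 / c) ^ (1 / δ) + 1) * (1 + t) ^ (1 / δ) := by
          have h2 : (N : ℝ) ≤ (t / c) ^ (1 / δ) + 1 := (Nat.ceil_lt_add_one (by positivity)).le
          have h3 : (t / c) ^ (1 / δ) ≤ (1 / c) ^ (1 / δ) * (1 + t) ^ (1 / δ) := by
            rw [← Real.mul_rpow (by positivity) (by positivity)]
            refine Real.rpow_le_rpow (by positivity) ?_ (by positivity)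
            rw [one_div_mul_eq_div]
            gcongr
            linarith
          have h4 : (1 : ℝ) ≤ (1 + t) ^ (1 / δ) := Real.one_le_rpow (by linarith) (by positivity)
          linarith
        have h5 : Real.log (1 + t / b) ≤ (1 + 1 / b) * (1 + t) := by
          have h6 := Real.log_le_sub_one_of_pos (show 0 < 1 + t / b by positivity)
          have h7 : t / b ≤ (1 + 1 / b) * (1 + t) := by
            have : 0 < 1 / b := by positivity
            rw [div_eq_mul_one_div]
            nlinarith
          linarith
        exact mul_le_mul h1 h5 (Real.log_nonneg hx) (by positivity)
    _ = _ := by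
        rw [Real.rpow_add (by positivity), Real.rpow_one]
        ring

lemma bddAbove (hM : StronglyRegular M) {t : ℝ} (ht : 0 < t) :
    BddAbove (range fun p : ℕ => Real.log (t ^ p / M p)) := by
  obtain ⟨C, K, -, -, h⟩ := hM.exists_log_le
  exact ⟨_, forall_mem_range.2 fun p => h t ht p⟩

lemma log_le_assocFun (hM : StronglyRegular M) {t : ℝ} (ht : 0 < t) (p : ℕ) :
    Real.log (t ^ p / M p) ≤ assocFun M t := by
  rw [assocFun, if_neg ht.ne']
  exact le_ciSup (hM.bddAbove ht) p

lemma assocFun_nonneg (hM : StronglyRegular M) {t : ℝ} (ht : 0 ≤ t) : 0 ≤ assocFun M t := by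
  rcases ht.eq_or_lt with rfl | ht
  · simp [assocFun]
  · simpa [hM.zero] using hM.log_le_assocFun ht 0

lemma assocFun_mono (hM : StronglyRegular M) {s t : ℝ} (hs : 0 ≤ s) (hst : s ≤ t) :
    assocFun M s ≤ assocFun M t := by
  rcases hs.eq_or_lt with rfl | hs
  · simpa [assocFun] using hM.assocFun_nonneg hst
  · rw [assocFun, if_neg hs.ne']
    refine ciSup_le fun p => le_trans ?_ (hM.log_le_assocFun (hs.trans_le hst) p)
    have := hM.pos p
    exact Real.log_le_log (by positivity) (by gcongr)

lemma exp_neg_assocFun_le (hM : StronglyRegular M) {t : ℝ} (ht : 0 < t) (p : ℕ) :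
    Real.exp (-assocFun M t) ≤ M p / t ^ p := by
  have hp := hM.pos p
  rw [← Real.le_log_iff_exp_le (by positivity), neg_le, ← Real.log_inv, inv_div]
  exact hM.log_le_assocFun ht p

/-- The supremum at `t = growthQuot M p` is attained at the index `p`. This is the radius at which
Cauchy's estimate for the `p`-th coefficient of `E` is optimal. -/
lemma exp_assocFun_growthQuot_le (hM : StronglyRegular M) (p : ℕ) :
    Real.exp (assocFun M (growthQuot M p)) ≤ growthQuot M p ^ p / M p := by
  have hq := hM.growthQuot_pos p
  have hp := hM.pos p
  rw [← Real.le_log_iff_exp_le (by positivity), assocFun, if_neg hq.ne']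
  refine ciSup_le fun j => Real.log_le_log ?_ (hM.pow_div_le_pow_div p j)
  have := hM.pos j
  positivity

/-- `exp (M (t))` absorbs a linear factor at the cost of a dilation. -/
lemma exists_mul_exp_assocFun_le (hM : StronglyRegular M) :
    ∃ C A : ℝ, 0 < C ∧ 1 ≤ A ∧ ∀ t : ℝ, 0 ≤ t →
      (1 + t) * Real.exp (assocFun M t) ≤ C * Real.exp (assocFun M (A * t)) := by
  obtain ⟨A, hA, h⟩ := hM.mg
  set B := max A 1 with hB
  have hB1 : 1 ≤ B := le_max_right _ _
  have hBA : A ≤ B := le_max_left _ _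
  have hM1 := hM.pos 1
  refine ⟨1 + B * M 1, B, by positivity, hB1, fun t ht => ?_⟩
  rcases ht.eq_or_lt with rfl | ht
  · simp [assocFun]
    positivity
  have hBt : 0 < B * t := by positivity
  -- The factor `t` raises `t ^ p / M p` to the index `p + 1`; moderate growth pays for replacing `M
  -- p` by `M (p + 1)` with the dilation `B`.
  have key : t * Real.exp (assocFun M t) ≤ B * M 1 * Real.exp (assocFun M (B * t)) := by
    rw [← le_div_iff₀' ht, ← Real.le_log_iff_exp_le (by positivity), assocFun, if_neg ht.ne']
    refine ciSup_le fun p => ?_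
    have hp := hM.pos p
    have hp1 := hM.pos (p + 1)
    refine Real.log_le_log (by positivity) ?_
    rw [le_div_iff₀' ht]
    have h1 : (B * t) ^ (p + 1) / M (p + 1) ≤ Real.exp (assocFun M (B * t)) := by
      rw [← Real.log_le_iff_le_exp (by positivity)]
      exact hM.log_le_assocFun hBt _
    refine le_trans ?_ (mul_le_mul_of_nonneg_left h1 (by positivity))
    have h2 : M (p + 1) ≤ B ^ (p + 1) * M p * M 1 := by
      refine (h p 1).trans ?_
      gcongr
    rw [mul_div_assoc', mul_div_assoc', div_le_div_iff₀ hp hp1, ← pow_succ']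
    calc t ^ (p + 1) * M (p + 1) ≤ t ^ (p + 1) * (B ^ (p + 1) * M p * M 1) := by gcongr
      _ = 1 * (M 1 * (B * t) ^ (p + 1) * M p) := by rw [mul_pow]; ring
      _ ≤ B * (M 1 * (B * t) ^ (p + 1) * M p) := by gcongr
      _ = _ := by ring
  have h2 : Real.exp (assocFun M t) ≤ Real.exp (assocFun M (B * t)) :=
    Real.exp_le_exp.2 (hM.assocFun_mono ht.le (by nlinarith))
  calc _ = Real.exp (assocFun M t) + t * Real.exp (assocFun M t) := by ring
    _ ≤ Real.exp (assocFun M (B * t)) + B * M 1 * Real.exp (assocFun M (B * t)) := by gcongr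
    _ = _ := by ring

/-- Moderate growth with `p = q = 2 ^ k`, iterated. The base grows only geometrically in `k`, that
is, polynomially in the index `2 ^ k`; this is what makes the order of the associated function
positive. -/
lemma exists_two_pow_le (hM : StronglyRegular M) : ∃ D A : ℝ, 1 ≤ D ∧ 1 ≤ A ∧
    ∀ k : ℕ, M (2 ^ k) ≤ (D * A ^ k) ^ 2 ^ k := by
  obtain ⟨A, hA, h⟩ := hM.mg
  set B := max A 1 with hB
  have hB1 : 1 ≤ B := le_max_right _ _
  have hBA : A ≤ B := le_max_left _ _
  refine ⟨max (M 1) 1, B, le_max_right _ _, hB1, fun k => ?_⟩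
  have hD : (1 : ℝ) ≤ max (M 1) 1 := le_max_right _ _
  induction k with
  | zero => simp
  | succ k ih =>
    have hk := hM.pos (2 ^ k)
    have h1 := h (2 ^ k) (2 ^ k)
    rw [← two_mul, ← pow_succ'] at h1
    calc M (2 ^ (k + 1)) ≤ A ^ 2 ^ (k + 1) * M (2 ^ k) * M (2 ^ k) := h1
      _ ≤ B ^ 2 ^ (k + 1) * (max (M 1) 1 * B ^ k) ^ 2 ^ k * (max (M 1) 1 * B ^ k) ^ 2 ^ k := by
          gcongr
      _ = (max (M 1) 1 * B ^ (k + 1)) ^ 2 ^ (k + 1) := by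
          rw [mul_assoc, ← mul_pow, ← sq, ← pow_mul, ← pow_succ', pow_succ B k, ← mul_assoc,
            mul_pow _ B]
          ring

end StronglyRegular

/-! ### The order of the associated function -/

lemma tendsto_assocFun_atTop {a : ℕ → ℝ} (ha : ∀ p, 0 < a p)
    (hb : ∀ t : ℝ, 0 < t → BddAbove (range fun p : ℕ => Real.log (t ^ p / a p))) :
    Tendsto (assocFun a) atTop atTop := by
  have h1 : Tendsto (fun t : ℝ => Real.log (t / a 1)) atTop atTop :=
    Real.tendsto_log_atTop.comp (tendsto_id.atTop_div_const (ha 1))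
  refine tendsto_atTop_mono' _ ?_ h1
  filter_upwards [eventually_gt_atTop 0] with t ht
  rw [assocFun, if_neg ht.ne']
  simpa using le_ciSup (hb t ht) 1

lemma growthOrder_le_of_eventually {a : ℕ → ℝ} {b : ℝ}
    (h : ∀ᶠ t : ℝ in atTop, max 0 (Real.log (assocFun a t) / Real.log t) ≤ b) :
    growthOrder a ≤ b :=
  limsup_le_of_le (isCoboundedUnder_le_of_le _ (x := 0) fun _ => le_max_left _ _) h

lemma eventually_ratio_le_of_le_rpow {a : ℕ → ℝ} (ha : ∀ p, 0 < a p)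
    (hbdd : ∀ t : ℝ, 0 < t → BddAbove (range fun p : ℕ => Real.log (t ^ p / a p))) {b : ℝ}
    (hb : 0 ≤ b) (h : ∀ᶠ t : ℝ in atTop, assocFun a t ≤ t ^ b) :
    ∀ᶠ t : ℝ in atTop, max 0 (Real.log (assocFun a t) / Real.log t) ≤ b := by
  filter_upwards [h, (tendsto_assocFun_atTop ha hbdd).eventually_gt_atTop 0,
    eventually_gt_atTop 1] with t h1 h2 h3
  refine max_le hb ?_
  rw [div_le_iff₀ (Real.log_pos h3), ← Real.log_rpow (by linarith)]
  exact Real.log_le_log h2 h1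

lemma eventually_const_mul_rpow_add_le {b b' C D : ℝ} (hb : b < b') (hb0 : 0 < b') :
    ∀ᶠ t : ℝ in atTop, C * t ^ b + D ≤ t ^ b' := by
  have h1 : Tendsto (fun t : ℝ => C * t ^ (-(b' - b)) + D * t ^ (-b')) atTop (𝓝 (C * 0 + D * 0)) :=
    ((tendsto_rpow_neg_atTop (sub_pos.2 hb)).const_mul C).add
      ((tendsto_rpow_neg_atTop hb0).const_mul D)
  rw [mul_zero, mul_zero, add_zero] at h1
  filter_upwards [h1.eventually_lt_const zero_lt_one, eventually_gt_atTop 0] with t h2 h3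
  have h4 : 0 < t ^ b' := Real.rpow_pos_of_pos h3 _
  calc C * t ^ b + D = (C * t ^ (-(b' - b)) + D * t ^ (-b')) * t ^ b' := by
        rw [add_mul, mul_assoc, mul_assoc, ← Real.rpow_add h3, ← Real.rpow_add h3]
        simp
    _ ≤ 1 * t ^ b' := by gcongr
    _ = t ^ b' := one_mul _

/-- At `t = exp (L (k + 1))` the single index `2 ^ k` already gives `assocFun a t ≥ 2 ^ k`, by the
choice of `L`. The ratio of logarithms is then at least `log 2 / (2 L)` for arbitrarily large `t`.
The bound `hb` is needed because a real limsup is meaningful only for a bounded function. -/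
lemma growthOrder_pos_of_two_pow_le {a : ℕ → ℝ} (ha : ∀ p, 0 < a p)
    (hbdd : ∀ t : ℝ, 0 < t → BddAbove (range fun p : ℕ => Real.log (t ^ p / a p))) {b : ℝ}
    (hb : ∀ᶠ t : ℝ in atTop, max 0 (Real.log (assocFun a t) / Real.log t) ≤ b)
    {D A : ℝ} (hD : 1 ≤ D) (hA : 1 ≤ A) (h : ∀ k : ℕ, a (2 ^ k) ≤ (D * A ^ k) ^ 2 ^ k) :
    0 < growthOrder a := by
  set L : ℝ := Real.log D + Real.log A + 1 with hL
  have hlD := Real.log_nonneg hD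
  have hlA := Real.log_nonneg hA
  have hL0 : 0 < L := by positivity
  set c : ℝ := Real.log 2 / (2 * L)
  have hl2 : 0 < Real.log 2 := Real.log_pos (by norm_num)
  have hc : 0 < c := by positivity
  refine hc.trans_le (le_limsup_of_frequently_le ?_ ⟨b, hb⟩)
  have htend : Tendsto (fun k : ℕ => Real.exp (L * (k + 1))) atTop atTop :=
    Real.tendsto_exp_atTop.comp (Tendsto.const_mul_atTop hL0
      (tendsto_atTop_add_const_right _ _ tendsto_natCast_atTop_atTop))
  refine htend.frequently ?_
  refine Eventually.frequently ?_
  filter_upwards [eventually_ge_atTop 1] with k hk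
  have hk' : (1 : ℝ) ≤ k := by exact_mod_cast hk
  set t := Real.exp (L * (k + 1)) with ht
  have ht0 : 0 < t := Real.exp_pos _
  have h1 : (2 : ℝ) ^ k ≤ assocFun a t := by
    rw [assocFun, if_neg ht0.ne']
    refine le_trans ?_ (le_ciSup (hbdd t ht0) (2 ^ k))
    have h2 : Real.log (a (2 ^ k)) ≤ 2 ^ k * (Real.log D + k * Real.log A) := by
      refine (Real.log_le_log (ha _) (h k)).trans (le_of_eq ?_)
      rw [Real.log_pow, Real.log_mul (by positivity) (by positivity), Real.log_pow]
      push_cast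
      ring
    rw [Real.log_div (by positivity) (ha _).ne', Real.log_pow, ht, Real.log_exp]
    push_cast
    have h3 : (2 : ℝ) ^ k * 1 ≤ 2 ^ k * (L * (k + 1) - (Real.log D + k * Real.log A)) := by
      refine mul_le_mul_of_nonneg_left ?_ (by positivity)
      rw [hL]
      nlinarith
    linarith
  refine le_max_of_le_right ?_
  rw [ht, Real.log_exp, ← ht, le_div_iff₀ (by positivity)]
  have h4 : k * Real.log 2 ≤ Real.log (assocFun a t) := by
    rw [← Real.log_pow]
    exact Real.log_le_log (by positivity) h1
  refine le_trans ?_ h4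
  calc c * (L * (k + 1)) = Real.log 2 * ((k + 1) / 2) := by
        simp only [c]
        field_simp
    _ ≤ Real.log 2 * k := by
        refine mul_le_mul_of_nonneg_left ?_ hl2.le
        linarith
    _ = _ := mul_comm _ _

namespace StronglyRegular

variable {M : ℕ → ℝ}

lemma exists_eventually_ratio_le (hM : StronglyRegular M) : ∃ b : ℝ, 0 ≤ b ∧
    ∀ᶠ t : ℝ in atTop, max 0 (Real.log (assocFun M t) / Real.log t) ≤ b := by
  obtain ⟨C, K, hC, hK, h⟩ := hM.exists_log_le
  refine ⟨K + 1, by positivity,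
    eventually_ratio_le_of_le_rpow hM.pos (fun t ht => hM.bddAbove ht) (by positivity) ?_⟩
  filter_upwards [eventually_const_mul_rpow_add_le (C := C * 2 ^ K) (D := 0)
    (show K < K + 1 by linarith) (by positivity), eventually_gt_atTop 1] with t h1 h2
  have ht : 0 < t := by linarith
  rw [assocFun, if_neg ht.ne']
  refine ciSup_le fun p => (h t ht p).trans (le_trans ?_ h1)
  rw [add_zero, mul_assoc, ← Real.mul_rpow (by norm_num) ht.le]
  gcongr
  linarith

lemma growthOrder_pos (hM : StronglyRegular M) : 0 < growthOrder M := by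
  obtain ⟨b, -, hb⟩ := hM.exists_eventually_ratio_le
  obtain ⟨D, A, hD, hA, h⟩ := hM.exists_two_pow_le
  exact growthOrder_pos_of_two_pow_le hM.pos (fun t ht => hM.bddAbove ht) hb hD hA h

lemma omegaIndex_pos (hM : StronglyRegular M) : 0 < omegaIndex M := one_div_pos.2 hM.growthOrder_pos

variable {a : ℕ → ℝ} {c k : ℝ}

lemma log_le_of_lower_bound (hM : StronglyRegular M) (hc : 0 < c) (hk : 0 < k)
    (h : ∀ p, c * k ^ p * M p ≤ a p) {t : ℝ} (ht : 0 < t) (p : ℕ) :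
    Real.log (t ^ p / a p) ≤ assocFun M (t / k) + Real.log (1 / c) := by
  have hp := hM.pos p
  have hap : 0 < a p := lt_of_lt_of_le (by positivity) (h p)
  refine le_trans ?_ (add_le_add_left (hM.log_le_assocFun (div_pos ht hk) p) _)
  rw [← Real.log_mul (by positivity) (by positivity)]
  refine Real.log_le_log (by positivity) ?_
  rw [div_pow, div_div, div_mul_div_comm, mul_one]
  refine div_le_div_of_nonneg_left (by positivity) (by positivity) (le_trans (le_of_eq ?_) (h p))
  ring

lemma bddAbove_of_lower_bound (hM : StronglyRegular M) (hc : 0 < c) (hk : 0 < k)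
    (h : ∀ p, c * k ^ p * M p ≤ a p) {t : ℝ} (ht : 0 < t) :
    BddAbove (range fun p : ℕ => Real.log (t ^ p / a p)) :=
  ⟨_, forall_mem_range.2 fun p => hM.log_le_of_lower_bound hc hk h ht p⟩

lemma eventually_ratio_le_of_lower_bound (hM : StronglyRegular M) (hc : 0 < c) (hk : 0 < k)
    (h : ∀ p, c * k ^ p * M p ≤ a p) {b : ℝ} (hb : growthOrder M < b) :
    ∀ᶠ t : ℝ in atTop, max 0 (Real.log (assocFun a t) / Real.log t) ≤ b := by
  have ha : ∀ p, 0 < a p := fun p =>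
    lt_of_lt_of_le (mul_pos (mul_pos hc (pow_pos hk _)) (hM.pos p)) (h p)
  obtain ⟨b', h1, h2⟩ := exists_between hb
  have hb' : 0 < b' := hM.growthOrder_pos.trans h1
  obtain ⟨B, -, hB⟩ := hM.exists_eventually_ratio_le
  have hev : ∀ᶠ t : ℝ in atTop, max 0 (Real.log (assocFun M t) / Real.log t) < b' :=
    eventually_lt_of_limsup_lt h1 ⟨B, hB⟩
  refine eventually_ratio_le_of_le_rpow ha (fun t ht => hM.bddAbove_of_lower_bound hc hk h ht)
    (hb'.trans h2).le ?_
  have htk : Tendsto (fun t : ℝ => t / k) atTop atTop := tendsto_id.atTop_div_const hk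
  filter_upwards [htk.eventually hev, htk.eventually_gt_atTop 1, eventually_gt_atTop 0,
    htk.eventually ((tendsto_assocFun_atTop hM.pos fun t ht => hM.bddAbove ht).eventually_gt_atTop 0),
    eventually_const_mul_rpow_add_le (C := (1 / k) ^ b') (D := Real.log (1 / c)) h2 (hb'.trans h2)]
    with t h3 h4 h5 h6 h7
  rw [assocFun, if_neg h5.ne']
  refine ciSup_le fun p => (hM.log_le_of_lower_bound hc hk h h5 p).trans (le_trans ?_ h7)
  refine add_le_add_left ?_ _
  have h8 := (le_max_right _ _).trans_lt h3
  rw [div_lt_iff₀ (Real.log_pos h4), ← Real.log_rpow (by linarith),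
    Real.log_lt_log_iff h6 (by positivity)] at h8
  rw [← Real.mul_rpow (by positivity) h5.le, one_div_mul_eq_div]
  exact h8.le

/-- A sequence equivalent to a strongly regular one has at least the same index. -/
lemma omegaIndex_le_of_equiv (hM : StronglyRegular M) (hc : 0 < c) (hk : 0 < k)
    (h : ∀ p, c * k ^ p * M p ≤ a p) {C B : ℝ} (hC : 1 ≤ C) (hB : 1 ≤ B)
    (h' : ∀ p, a p ≤ C * B ^ p * M p) : omegaIndex M ≤ omegaIndex a := by
  have ha : ∀ p, 0 < a p := fun p =>
    lt_of_lt_of_le (mul_pos (mul_pos hc (pow_pos hk _)) (hM.pos p)) (h p)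
  obtain ⟨D, A, hD, hA, hDA⟩ := hM.exists_two_pow_le
  -- The comparison of orders can be inverted only if the smaller one is positive, since `1 / 0 =
  -- 0`. This is where the upper bound for `a` enters.
  have hpos : 0 < growthOrder a := by
    refine growthOrder_pos_of_two_pow_le ha (fun t ht => hM.bddAbove_of_lower_bound hc hk h ht)
      (hM.eventually_ratio_le_of_lower_bound hc hk h (lt_add_one _))
      (D := C * B * D) (A := A) ?_ hA fun i => ?_
    · exact one_le_mul_of_one_le_of_one_le (one_le_mul_of_one_le_of_one_le hC hB) hD
    · have hM2 := hM.pos (2 ^ i)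
      calc a (2 ^ i) ≤ C * B ^ 2 ^ i * M (2 ^ i) := h' _
        _ ≤ C ^ 2 ^ i * B ^ 2 ^ i * (D * A ^ i) ^ 2 ^ i := by
            have : C ≤ C ^ 2 ^ i := le_self_pow₀ hC (by positivity)
            have := hDA i
            gcongr
        _ = _ := by rw [← mul_pow, ← mul_pow]; ring
  refine one_div_le_one_div_of_le hpos (le_of_forall_gt_imp_ge_of_dense fun b hb => ?_)
  exact growthOrder_le_of_eventually (hM.eventually_ratio_le_of_lower_bound hc hk h hb)

end StronglyRegular

/-! ### Complex analysis -/

section Analysis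

variable {F : Type*} [NormedAddCommGroup F] [NormedSpace ℂ F]

/-- A locally dominated integral of holomorphic functions is holomorphic in the parameter. -/
lemma differentiableAt_integral_of_dominated [CompleteSpace F] {α : Type*} [MeasurableSpace α]
    {μ : Measure α} {f : ℂ → α → F} {z₀ : ℂ} {R : ℝ} (hR : 0 < R)
    (hmeas : ∀ z ∈ Metric.ball z₀ R, AEStronglyMeasurable (f z) μ)
    (hdiff : ∀ᵐ a ∂μ, DifferentiableOn ℂ (fun z => f z a) (Metric.ball z₀ R))
    {g : α → ℝ} (hg : Integrable g μ) (hb : ∀ᵐ a ∂μ, ∀ z ∈ Metric.ball z₀ R, ‖f z a‖ ≤ g a) :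
    DifferentiableAt ℂ (fun z => ∫ a, f z a ∂μ) z₀ := by
  have h0 : z₀ ∈ Metric.ball z₀ R := Metric.mem_ball_self hR
  have hder : ∀ᵐ a ∂μ, ∀ z ∈ Metric.ball z₀ (R / 2),
      HasDerivAt (fun z => f z a) (deriv (fun z => f z a) z) z := by
    filter_upwards [hdiff] with a ha z hz
    exact (ha.differentiableAt (Metric.isOpen_ball.mem_nhds
      (Metric.ball_subset_ball (by linarith) hz))).hasDerivAt
  -- The derivative is the pointwise limit of difference quotients along a sequence tending to `z₀`
  -- inside the ball, hence measurable.
  have hmeas' : AEStronglyMeasurable (fun a => deriv (fun z => f z a) z₀) μ := by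
    set x : ℕ → ℂ := fun n => z₀ + ((R / ((n : ℝ) + 2) : ℝ) : ℂ) with hx
    have hxt : Tendsto x atTop (𝓝[≠] z₀) := by
      refine tendsto_nhdsWithin_iff.2 ⟨?_, Eventually.of_forall fun n => ?_⟩
      · have h1 : Tendsto (fun n : ℕ => R / ((n : ℝ) + 2)) atTop (𝓝 0) :=
          tendsto_const_nhds.div_atTop (tendsto_atTop_add_const_right _ _
            tendsto_natCast_atTop_atTop)
        have h2 := (Complex.continuous_ofReal.tendsto 0).comp h1
        simpa [hx] using h2.const_add z₀
      · have : (0 : ℝ) < R / ((n : ℝ) + 2) := by positivity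
        simpa [hx] using ⟨hR.ne', by exact_mod_cast (show (n : ℝ) + 2 ≠ 0 by positivity)⟩
    have hxmem : ∀ n, x n ∈ Metric.ball z₀ R := fun n => by
      simp only [hx, Metric.mem_ball, dist_self_add_left, Complex.norm_real, Real.norm_eq_abs]
      rw [abs_of_pos (by positivity), div_lt_iff₀ (by positivity)]
      have : (0 : ℝ) ≤ n := Nat.cast_nonneg n
      nlinarith
    refine aestronglyMeasurable_of_tendsto_ae atTop
      (f := fun n a => slope (fun z => f z a) z₀ (x n)) (fun n => ?_) ?_
    · simp only [slope_def_module]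
      exact ((hmeas _ (hxmem n)).sub (hmeas _ h0)).const_smul _
    · filter_upwards [hder] with a ha
      exact (ha z₀ (Metric.mem_ball_self (by linarith))).tendsto_slope.comp hxt
  refine (hasDerivAt_integral_of_dominated_loc_of_deriv_le
    (F := f) (F' := fun z a => deriv (fun z => f z a) z) (bound := fun a => g a / (R / 4))
    (s := Metric.ball z₀ (R / 2))
    (Metric.ball_mem_nhds z₀ (half_pos hR)) ?_ ?_ hmeas' ?_ (hg.div_const _)
    hder).2.differentiableAt
  · filter_upwards [Metric.ball_mem_nhds z₀ hR] with z hz using hmeas z hz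
  · exact hg.mono' (hmeas _ h0) (hb.mono fun a ha => ha _ h0)
  · filter_upwards [hdiff, hb] with a ha hba z hz
    have hsub : Metric.closedBall z (R / 4) ⊆ Metric.ball z₀ R := fun w hw => by
      rw [Metric.mem_ball] at hz ⊢
      rw [Metric.mem_closedBall] at hw
      linarith [dist_triangle w z z₀]
    -- Cauchy's estimate on a circle of radius `R / 4` converts the majorant of `f` into one of its
    -- derivative.
    exact Complex.norm_deriv_le_of_forall_mem_sphere_norm_le (by positivity)
      ((ha.mono hsub).diffContOnCl_ball (U := Metric.closedBall z (R / 4)) subset_rfl)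
      fun w hw => hba w (hsub (Metric.sphere_subset_closedBall hw))

/-- Invariance of a path integral of a holomorphic function under the linear homotopy
`p + s q`, provided the end point contributions agree. -/
lemma integral_eq_of_linear_homotopy [CompleteSpace F] {U : Set ℂ} (hU : IsOpen U) {h : ℂ → F}
    (hh : DifferentiableOn ℂ h U) {p q : ℝ → ℂ} (hp : ContDiff ℝ 1 p) (hq : ContDiff ℝ 1 q)
    (hmem : ∀ s ∈ Icc (0 : ℝ) 1, ∀ t ∈ Icc (0 : ℝ) 1, p t + s * q t ∈ U)
    (hend : ∀ s ∈ Icc (0 : ℝ) 1, q 1 • h (p 1 + s * q 1) = q 0 • h (p 0 + s * q 0)) :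
    ∫ t in (0 : ℝ)..1, deriv p t • h (p t)
      = ∫ t in (0 : ℝ)..1, (deriv p t + deriv q t) • h (p t + q t) := by
  have hdp : ∀ t, HasDerivAt p (deriv p t) t := fun t =>
    (hp.differentiable one_ne_zero t).hasDerivAt
  have hdq : ∀ t, HasDerivAt q (deriv q t) t := fun t =>
    (hq.differentiable one_ne_zero t).hasDerivAt
  have hcp' : Continuous (deriv p) := hp.continuous_deriv le_rfl
  have hcq' : Continuous (deriv q) := hq.continuous_deriv le_rfl
  have hcp := hp.continuous
  have hcq := hq.continuous
  have hcd : ContinuousOn (deriv h) U := (hh.deriv hU).continuousOn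
  have hdh : ∀ z ∈ U, HasDerivAt h (deriv h z) z := fun z hz =>
    (hh.differentiableAt (hU.mem_nhds hz)).hasDerivAt
  -- `D` is both `∂/∂t` of `q t • h (p t + s q t)` and `∂/∂s` of `(p' t + s q' t) • h (p t + s q
  -- t)`. Integrating over the square in the two orders gives the claim, and no second derivatives
  -- of the paths are needed. The end condition makes the `t`-integral vanish.
  set D : ℝ → ℝ → F := fun s t => deriv q t • h (p t + s * q t)
    + ((deriv p t + s * deriv q t) * q t) • deriv h (p t + s * q t) with hD
  have hmaps : MapsTo (fun x : ℝ × ℝ => p x.2 + x.1 * q x.2) (Icc 0 1 ×ˢ Icc 0 1) U :=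
    fun x hx => hmem _ hx.1 _ hx.2
  have hcont : ContinuousOn (fun x : ℝ × ℝ => p x.2 + x.1 * q x.2) (Icc 0 1 ×ˢ Icc 0 1) := by
    fun_prop
  have hDcont : ContinuousOn (Function.uncurry D) (Icc 0 1 ×ˢ Icc 0 1) := by
    have h1 : ContinuousOn (fun x : ℝ × ℝ => h (p x.2 + x.1 * q x.2)) (Icc 0 1 ×ˢ Icc 0 1) :=
      hh.continuousOn.comp hcont hmaps
    have h2 : ContinuousOn (fun x : ℝ × ℝ => deriv h (p x.2 + x.1 * q x.2))
        (Icc 0 1 ×ˢ Icc 0 1) := hcd.comp hcont hmaps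
    refine ContinuousOn.add (ContinuousOn.smul (Continuous.continuousOn (by fun_prop)) h1)
      (ContinuousOn.smul (Continuous.continuousOn (by fun_prop)) h2)
  have hDs : ∀ s ∈ Icc (0 : ℝ) 1, ContinuousOn (D s) (Icc 0 1) := fun s hs =>
    hDcont.comp (f := fun t => (s, t)) (by fun_prop) fun t ht => ⟨hs, ht⟩
  have hDt : ∀ t ∈ Icc (0 : ℝ) 1, ContinuousOn (fun s => D s t) (Icc 0 1) := fun t ht =>
    hDcont.comp (f := fun s => (s, t)) (by fun_prop) fun s hs => ⟨hs, ht⟩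
  have hI : uIcc (0 : ℝ) 1 = Icc 0 1 := uIcc_of_le zero_le_one
  have hη : ∀ s t : ℝ, HasDerivAt (fun t => p t + s * q t) (deriv p t + s * deriv q t) t :=
    fun s t => (hdp t).add ((hdq t).const_mul (s : ℂ))
  have e1 : ∀ s ∈ Icc (0 : ℝ) 1, ∫ t in (0 : ℝ)..1, D s t = 0 := by
    intro s hs
    have : ∀ t ∈ uIcc (0 : ℝ) 1, HasDerivAt (fun t => q t • h (p t + s * q t)) (D s t) t := by
      intro t ht
      rw [hI] at ht
      have h1 := (hdh _ (hmem s hs t ht)).scomp t (hη s t)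
      have h2 := (hdq t).smul h1
      rw [smul_smul, mul_comm (q t)] at h2
      exact h2.congr_deriv (add_comm _ _)
    rw [intervalIntegral.integral_eq_sub_of_hasDerivAt this
      (ContinuousOn.intervalIntegrable (by rw [hI]; exact hDs s hs)), hend s hs, sub_self]
  have e2 : ∀ t ∈ Icc (0 : ℝ) 1, ∫ s in (0 : ℝ)..1, D s t
      = (deriv p t + deriv q t) • h (p t + q t) - deriv p t • h (p t) := by
    intro t ht
    have : ∀ s ∈ uIcc (0 : ℝ) 1, HasDerivAt
        (fun s : ℝ => (deriv p t + s * deriv q t) • h (p t + s * q t)) (D s t) s := by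
      intro s hs
      rw [hI] at hs
      have hc : HasDerivAt (fun s : ℝ => (s : ℂ)) 1 s := Complex.ofRealCLM.hasDerivAt
      have h1 : HasDerivAt (fun s : ℝ => p t + s * q t) (q t) s := by
        simpa using (hc.mul_const (q t)).const_add (p t)
      have h2 : HasDerivAt (fun s : ℝ => deriv p t + s * deriv q t) (deriv q t) s := by
        simpa using (hc.mul_const (deriv q t)).const_add (deriv p t)
      have h3 := h2.smul ((hdh _ (hmem s hs t ht)).scomp s h1)
      rw [smul_smul] at h3
      exact h3.congr_deriv (add_comm _ _)
    rw [intervalIntegral.integral_eq_sub_of_hasDerivAt this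
      (ContinuousOn.intervalIntegrable (by rw [hI]; exact hDt t ht))]
    simp
  have hint : ∀ s ∈ Icc (0 : ℝ) 1, IntervalIntegrable
      (fun t => (deriv p t + s * deriv q t) • h (p t + s * q t)) volume 0 1 := by
    intro s hs
    refine ContinuousOn.intervalIntegrable ?_
    rw [hI]
    refine ContinuousOn.smul (by fun_prop) ?_
    exact hh.continuousOn.comp (by fun_prop) fun t ht => hmem s hs t ht
  have i0 := hint 0 (by simp)
  have i1 := hint 1 (by simp)
  simp only [Complex.ofReal_zero, zero_mul, add_zero] at i0
  simp only [Complex.ofReal_one, one_mul] at i1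
  have hfub : ∫ s in (0 : ℝ)..1, ∫ t in (0 : ℝ)..1, D s t
      = ∫ t in (0 : ℝ)..1, ∫ s in (0 : ℝ)..1, D s t := by
    refine intervalIntegral_intervalIntegral_swap ?_
    rw [uIoc_of_le zero_le_one]
    exact (hDcont.integrableOn_compact (isCompact_Icc.prod isCompact_Icc)).mono_set
      (prod_mono Ioc_subset_Icc_self Ioc_subset_Icc_self)
  rw [intervalIntegral.integral_congr (g := fun _ => (0 : F))
      (fun s hs => e1 s (by rwa [hI] at hs)),
    intervalIntegral.integral_congr (fun t ht => e2 t (by rwa [hI] at ht)),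
    intervalIntegral.integral_sub i1 i0] at hfub
  rw [intervalIntegral.integral_zero] at hfub
  exact (sub_eq_zero.1 hfub.symm).symm

/-- A holomorphic function on a convex open set which is invariant under real translations is
constant. -/
lemma eq_of_real_translation_invariant {U : Set ℂ} (hU : IsOpen U) (hc : Convex ℝ U) {f : ℂ → F}
    (hf : DifferentiableOn ℂ f U) (hinv : ∀ z ∈ U, ∀ x : ℝ, f (z + x) = f z) {z w : ℂ}
    (hz : z ∈ U) (hw : w ∈ U) : f z = f w := by
  refine hU.is_const_of_deriv_eq_zero hc.isPreconnected hf (fun ζ hζ => ?_) hz hw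
  -- The complex derivative is the derivative in the real direction, where `f` is constant.
  have h1 : HasDerivAt f (deriv f ζ) (ζ + ((0 : ℝ) : ℂ)) := by
    simpa using (hf.differentiableAt (hU.mem_nhds hζ)).hasDerivAt
  have h2 : HasDerivAt (fun x : ℝ => ζ + (x : ℂ)) 1 0 :=
    Complex.ofRealCLM.hasDerivAt.const_add ζ
  have h3 := h1.scomp (0 : ℝ) h2
  have h4 : (f ∘ fun x : ℝ => ζ + (x : ℂ)) = fun _ => f ζ := funext fun x => hinv ζ hζ x
  rw [h4, one_smul] at h3
  exact h3.unique (hasDerivAt_const _ _)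

lemma hasFPowerSeriesOnBall_of_hasSum {f : ℂ → F} {a : ℕ → F} {R : ℝ} (hR : 0 < R)
    (h : ∀ z : ℂ, ‖z‖ < R → HasSum (fun p => z ^ p • a p) (f z)) :
    HasFPowerSeriesOnBall f (fun p => ContinuousMultilinearMap.mkPiRing ℂ (Fin p) (a p)) 0
      (ENNReal.ofReal R) := by
  refine ⟨?_, ENNReal.ofReal_pos.2 hR, fun {y} hy => ?_⟩
  · refine ENNReal.le_of_forall_nnreal_lt fun x hx => ?_
    have hxR : (x : ℝ) < R := by
      rw [ENNReal.lt_ofReal_iff_toReal_lt (by simp)] at hx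
      simpa using hx
    have h1 := (h ((x : ℝ) : ℂ) (by simpa using hxR)).summable.tendsto_atTop_zero
    refine FormalMultilinearSeries.le_radius_of_tendsto _ (l := 0) ?_
    have h2 := h1.norm
    rw [norm_zero] at h2
    refine h2.congr fun p => ?_
    rw [norm_smul, ContinuousMultilinearMap.norm_mkPiRing, norm_pow, mul_comm]
    simp
  · have hy' : ‖y‖ < R := by
      rw [Metric.mem_eball, edist_zero_right, ← ofReal_norm, ENNReal.ofReal_lt_ofReal_iff hR] at hy
      exact hy
    simpa using h y hy'

lemma iteratedDeriv_zero_of_hasSum [CompleteSpace F] {f : ℂ → F} {a : ℕ → F} {R : ℝ} (hR : 0 < R)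
    (h : ∀ z : ℂ, ‖z‖ < R → HasSum (fun p => z ^ p • a p) (f z)) (p : ℕ) :
    iteratedDeriv p f 0 = (p.factorial : ℂ) • a p := by
  have := (hasFPowerSeriesOnBall_of_hasSum hR h).factorial_smul 1 p
  rw [iteratedDeriv_eq_iteratedFDeriv, ← this]
  simp [Nat.cast_smul_eq_nsmul]

lemma differentiableOn_ball_of_hasSum [CompleteSpace F] {f : ℂ → F} {a : ℕ → F} {R : ℝ}
    (hR : 0 < R) (h : ∀ z : ℂ, ‖z‖ < R → HasSum (fun p => z ^ p • a p) (f z)) :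
    DifferentiableOn ℂ f (Metric.ball 0 R) := by
  have := (hasFPowerSeriesOnBall_of_hasSum hR h).differentiableOn
  rwa [Metric.eball_ofReal] at this

lemma norm_coeff_mul_pow_le_of_hasSum {f : ℂ → ℂ} {a : ℕ → ℂ}
    (h : ∀ z : ℂ, HasSum (fun p => z ^ p * a p) (f z)) {R C : ℝ} (hR : 0 < R)
    (hC : ∀ z : ℂ, ‖z‖ = R → ‖f z‖ ≤ C) (p : ℕ) : ‖a p‖ ≤ C / R ^ p := by
  have hd : DifferentiableOn ℂ f (Metric.ball 0 (R + 1)) :=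
    differentiableOn_ball_of_hasSum (by linarith) fun z _ => h z
  have h1 := Complex.norm_iteratedDeriv_le_of_forall_mem_sphere_norm_le (c := 0) p hR
    (hd.diffContOnCl_ball (Metric.closedBall_subset_ball (by linarith)))
    (C := C) fun z hz => hC z (by simpa using hz)
  rw [iteratedDeriv_zero_of_hasSum hR (fun z _ => h z), norm_smul, mul_div_assoc] at h1
  have h2 : (0 : ℝ) < p.factorial := by exact_mod_cast p.factorial_pos
  simpa [h2] using h1

end Analysis

/-! ### The substitution `u = exp x`, under which rays become horizontal lines -/

section ExpSubstitution

variable {F : Type*} [NormedAddCommGroup F] [NormedSpace ℝ F]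

lemma integrableOn_Ioi_zero_iff_comp_exp (g : ℝ → F) :
    IntegrableOn g (Ioi 0) ↔ Integrable (fun x => Real.exp x • g (Real.exp x)) := by
  have h := integrableOn_image_iff_integrableOn_abs_deriv_smul (f := Real.exp) (f' := Real.exp)
    MeasurableSet.univ (fun x _ => (Real.hasDerivAt_exp x).hasDerivWithinAt)
    Real.exp_injective.injOn g
  rw [image_univ, Real.range_exp, integrableOn_univ] at h
  simpa only [abs_of_pos (Real.exp_pos _)] using h

lemma integral_Ioi_zero_eq_comp_exp (g : ℝ → F) :
    ∫ x in Ioi (0 : ℝ), g x = ∫ x, Real.exp x • g (Real.exp x) := by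
  have h := integral_image_eq_integral_abs_deriv_smul (f := Real.exp) (f' := Real.exp)
    MeasurableSet.univ (fun x _ => (Real.hasDerivAt_exp x).hasDerivWithinAt)
    Real.exp_injective.injOn g
  rw [image_univ, Real.range_exp, setIntegral_univ] at h
  simpa only [abs_of_pos (Real.exp_pos _)] using h

end ExpSubstitution

/-- Summable `L¹` norms give an integrable sum. -/
lemma integrable_of_hasSum_of_summable_integral_norm {α : Type*} [MeasurableSpace α]
    {μ : Measure α} {f : ℕ → α → ℂ} {g : α → ℂ} (hf : ∀ i, Integrable (f i) μ)
    (hs : Summable fun i => ∫ a, ‖f i a‖ ∂μ) (hg : ∀ a, HasSum (fun i => f i a) (g a))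
    (hgm : AEStronglyMeasurable g μ) : Integrable g μ := by
  refine ⟨hgm, ?_⟩
  have h1 : ∫⁻ a, ‖g a‖ₑ ∂μ ≤ ∑' i, ∫⁻ a, ‖f i a‖ₑ ∂μ := by
    rw [← lintegral_tsum fun i => (hf i).1.enorm]
    refine lintegral_mono fun a => ?_
    rw [← (hg a).tsum_eq]
    exact enorm_tsum_le_tsum_enorm
  refine h1.trans_lt ?_
  have h2 : ∀ i, ∫⁻ a, ‖f i a‖ₑ ∂μ = ENNReal.ofReal (∫ a, ‖f i a‖ ∂μ) := fun i =>
    (ofReal_integral_norm_eq_lintegral_enorm (hf i)).symm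
  simp only [h2]
  rw [← ENNReal.ofReal_tsum_of_nonneg (fun i => integral_nonneg fun a => norm_nonneg _) hs]
  exact ENNReal.ofReal_lt_top

/-! ### Kernel functions in the logarithmic coordinate -/

/-- Half of the opening of the sector on which the kernel `e` is defined. -/
noncomputable def halfOpening (M : ℕ → ℝ) : ℝ := omegaIndex M * Real.pi / 2

/-- The function `z ^ n e(z)` in the logarithmic coordinate. -/
noncomputable def logKernel (e : ℂ → ℂ) (n : ℕ) (β : ℂ) : ℂ :=
  Complex.exp (n * β) * e (Complex.exp β)

lemma exp_mem_planeSector {α : ℝ} {β : ℂ} (hα : α ≤ 2 * Real.pi) (h : |β.im| < α / 2) :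
    Complex.exp β ∈ planeSector α := by
  refine ⟨Complex.exp_ne_zero _, ?_⟩
  have h' := abs_lt.1 h
  rw [← Complex.log_im, Complex.log_exp (by linarith) (by linarith)]
  exact h

lemma isOpen_abs_im_lt (b : ℝ) : IsOpen {β : ℂ | |β.im| < b} :=
  isOpen_lt (by fun_prop) continuous_const

lemma convex_abs_im_add_lt (a b : ℝ) : Convex ℝ {β : ℂ | |a + β.im| < b} := by
  have h : {β : ℂ | |a + β.im| < b} = Complex.imLm ⁻¹' Metric.ball (-a) b := by
    ext β
    simp [Real.dist_eq, add_comm]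
  rw [h]
  exact (convex_ball _ _).linear_preimage _

namespace IsKernelPair

variable {M m : ℕ → ℝ} {e E : ℂ → ℂ}

lemma halfOpening_lt_pi (hK : IsKernelPair M e E) : halfOpening M < Real.pi := by
  have := mul_lt_mul_of_pos_right hK.omega_lt_two Real.pi_pos
  rw [halfOpening]
  linarith

lemma exp_mem (hK : IsKernelPair M e E) {β : ℂ} (h : |β.im| < halfOpening M) :
    Complex.exp β ∈ planeSector (omegaIndex M * Real.pi) := by
  have := hK.halfOpening_lt_pi
  rw [halfOpening] at this
  exact exp_mem_planeSector (by linarith) h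

lemma isOpen_planeSector (hK : IsKernelPair M e E) :
    IsOpen (planeSector (omegaIndex M * Real.pi)) := by
  have hW := hK.halfOpening_lt_pi
  have h : planeSector (omegaIndex M * Real.pi)
      = Complex.slitPlane ∩ Complex.arg ⁻¹' {x | |x| < omegaIndex M * Real.pi / 2} := by
    ext z
    simp only [planeSector, mem_ofPred_eq, mem_inter_iff, mem_preimage]
    refine ⟨fun h => ⟨?_, h.2⟩, fun h => ⟨Complex.slitPlane_ne_zero h.1, h.2⟩⟩
    rw [Complex.mem_slitPlane_iff_arg]
    refine ⟨fun h' => ?_, h.1⟩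
    have := h.2
    rw [h', abs_of_pos Real.pi_pos] at this
    rw [halfOpening] at hW
    linarith
  rw [h]
  exact ContinuousOn.isOpen_inter_preimage
    (fun z hz => (Complex.continuousAt_arg hz).continuousWithinAt) Complex.isOpen_slitPlane
    (isOpen_lt continuous_abs continuous_const)

lemma differentiableAt_logKernel (hK : IsKernelPair M e E) (n : ℕ) {β : ℂ}
    (h : |β.im| < halfOpening M) : DifferentiableAt ℂ (logKernel e n) β := by
  have h1 : DifferentiableAt ℂ e (Complex.exp β) :=
    hK.e_hol.differentiableAt (hK.isOpen_planeSector.mem_nhds (hK.exp_mem h))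
  exact ((differentiableAt_id.const_mul (n : ℂ)).cexp).mul (h1.comp β Complex.differentiableAt_exp)

lemma continuous_logKernel (hK : IsKernelPair M e E) (n : ℕ) {β : ℂ}
    (h : |β.im| < halfOpening M) : Continuous fun x : ℝ => logKernel e n (x + β) := by
  rw [continuous_iff_continuousAt]
  intro x
  refine ContinuousAt.comp (g := logKernel e n) (f := fun x : ℝ => (x : ℂ) + β)
    (hK.differentiableAt_logKernel n ?_).continuousAt (by fun_prop)
  simpa using h

lemma exists_norm_le_of_abs_im_le (hM : StronglyRegular M) (hK : IsKernelPair M e E) {b : ℝ}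
    (hb : b < halfOpening M) : ∃ c k : ℝ, 0 < c ∧ 0 < k ∧ ∀ β : ℂ, |β.im| ≤ b → ∀ p : ℕ,
      ‖e (Complex.exp β)‖ ≤ c * (M p * k ^ p) * Real.exp (-(p * β.re)) := by
  -- With this `ε` the half opening of the smaller sector is `(halfOpening M + b) / 2`, which
  -- exceeds `b`.
  obtain ⟨c, k, hc, hk, h⟩ := hK.e_decay (halfOpening M - b) (by linarith)
  refine ⟨c, k, hc, hk, fun β hβ p => ?_⟩
  have hW := hK.halfOpening_lt_pi
  have h1 : Complex.exp β ∈ planeSector (omegaIndex M * Real.pi - (halfOpening M - b)) := by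
    rw [halfOpening] at *
    exact exp_mem_planeSector (by linarith) (by linarith)
  refine (h _ h1).trans ?_
  rw [mul_assoc]
  refine mul_le_mul_of_nonneg_left ?_ hc.le
  rw [Complex.norm_exp]
  refine (hM.exp_neg_assocFun_le (by positivity) p).trans (le_of_eq ?_)
  rw [div_pow, ← Real.exp_nat_mul, Real.exp_neg]
  have := Real.exp_pos (p * β.re)
  field_simp

/-- Local uniform integrability of `e` at the origin in the logarithmic coordinate. -/
lemma exists_lintegral_iSup_lt_top (hK : IsKernelPair M e E) : ∃ T : ℝ, ∀ β₀ : ℂ,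
    |β₀.im| < halfOpening M → ∃ δ : ℝ, 0 < δ ∧ (∀ β ∈ Metric.ball β₀ δ, |β.im| < halfOpening M) ∧
      ∫⁻ x in Iic T, (⨆ β ∈ Metric.ball β₀ δ, ‖e (Complex.exp ((x : ℝ) + β))‖ₑ) < ⊤ := by
  obtain ⟨t₀, ht₀, h⟩ := hK.e_int
  refine ⟨Real.log t₀, fun β₀ hβ₀ => ?_⟩
  -- The hypothesis concerns `e (t / z)`. With `t = exp x` and `z = exp (-β)` this is `e (exp (x +
  -- β))`, hence the minus sign in the base point.
  obtain ⟨U, hU, hzU, -, hfin⟩ := h (Complex.exp (-β₀)) (hK.exp_mem (by simpa using hβ₀))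
  have hV : IsOpen ({β : ℂ | |β.im| < halfOpening M} ∩ (fun β => Complex.exp (-β)) ⁻¹' U) :=
    (isOpen_abs_im_lt _).inter (hU.preimage (by fun_prop))
  obtain ⟨δ, hδ, hball⟩ := Metric.isOpen_iff.1 hV β₀ ⟨hβ₀, hzU⟩
  refine ⟨δ, hδ, fun β hβ => (hball hβ).1, lt_of_le_of_lt ?_ hfin⟩
  have himg : Real.exp '' Iic (Real.log t₀) = Ioc 0 t₀ := by
    rw [Real.image_exp_Iic, Real.exp_log ht₀]
  rw [← himg, lintegral_image_eq_lintegral_abs_deriv_mul measurableSet_Iic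
    (fun x _ => (Real.hasDerivAt_exp x).hasDerivWithinAt) Real.exp_injective.injOn]
  refine lintegral_mono fun x => ?_
  have hx : ENNReal.ofReal (Real.exp x) ≠ 0 := by simpa using Real.exp_pos x
  rw [abs_of_pos (Real.exp_pos _), ENNReal.mul_div_cancel hx ENNReal.ofReal_ne_top]
  refine iSup₂_le fun β hβ => ?_
  refine le_trans (le_of_eq ?_) (le_iSup₂ (f := fun z (_ : z ∈ U) =>
    ‖e (((Real.exp x : ℝ) : ℂ) / z)‖ₑ) (Complex.exp (-β)) (hball hβ).2)
  rw [Complex.ofReal_exp, ← Complex.exp_sub, sub_neg_eq_add]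

/-- Locally uniform integrable majorants of the kernel along horizontal lines. -/
lemma exists_locally_dominated (hM : StronglyRegular M) (hK : IsKernelPair M e E) {β₀ : ℂ}
    (hβ₀ : |β₀.im| < halfOpening M) : ∃ δ : ℝ, 0 < δ ∧
      (∀ β ∈ Metric.ball β₀ δ, |β.im| < halfOpening M) ∧
      ∀ n : ℕ, ∃ g : ℝ → ℝ, Integrable g ∧
        ∀ᵐ x : ℝ, ∀ β ∈ Metric.ball β₀ δ, ‖logKernel e n (x + β)‖ ≤ g x := by
  obtain ⟨T, hT⟩ := hK.exists_lintegral_iSup_lt_top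
  obtain ⟨δ₁, hδ₁, hball₁, hfin₁⟩ := hT β₀ hβ₀
  obtain ⟨b, hb1, hb2⟩ := exists_between hβ₀
  obtain ⟨c, k, hc, hk, hdec⟩ := exists_norm_le_of_abs_im_le hM hK hb2
  set δ := min δ₁ (b - |β₀.im|) with hδdef
  have hδ : 0 < δ := lt_min hδ₁ (by linarith)
  have hsub : Metric.ball β₀ δ ⊆ Metric.ball β₀ δ₁ := Metric.ball_subset_ball (min_le_left _ _)
  have him : ∀ β ∈ Metric.ball β₀ δ, |β.im| ≤ b := fun β hβ => by
    have h1 : ‖β - β₀‖ < b - |β₀.im| := by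
      rw [← dist_eq_norm]
      exact (Metric.mem_ball.1 hβ).trans_le (min_le_right _ _)
    have h2 := Complex.abs_im_le_norm (β - β₀)
    rw [Complex.sub_im] at h2
    have h3 := abs_sub_abs_le_abs_sub β.im β₀.im
    linarith
  have hre : ∀ β ∈ Metric.ball β₀ δ, |β.re - β₀.re| ≤ δ := fun β hβ => by
    have h2 := Complex.abs_re_le_norm (β - β₀)
    rw [Complex.sub_re] at h2
    exact h2.trans (by rw [← dist_eq_norm]; exact (Metric.mem_ball.1 hβ).le)
  refine ⟨δ, hδ, fun β hβ => hball₁ β (hsub hβ), fun n => ?_⟩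
  set S : ℝ → ENNReal := fun x => ⨆ β ∈ Metric.ball β₀ δ, ‖e (Complex.exp ((x : ℝ) + β))‖ₑ with hS
  have hSfin : ∫⁻ x in Iic T, S x < ⊤ :=
    lt_of_le_of_lt (lintegral_mono fun x => biSup_mono fun β hβ => hsub hβ) hfin₁
  -- The supremum is over an uncountable family, so measurability comes from lower semicontinuity.
  have hSmeas : Measurable S := by
    refine LowerSemicontinuous.measurable (lowerSemicontinuous_biSup fun β hβ => ?_)
    refine Continuous.lowerSemicontinuous ?_
    have h0 := (hK.continuous_logKernel 0 (hball₁ β (hsub hβ))).enorm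
    simpa [logKernel] using h0
  have hSae : ∀ᵐ x ∂(volume.restrict (Iic T)), S x < ⊤ := ae_lt_top hSmeas hSfin.ne
  have hSint : IntegrableOn (fun x => (S x).toReal) (Iic T) :=
    integrable_toReal_of_lintegral_ne_top hSmeas.aemeasurable hSfin.ne
  set g₁ : ℝ → ℝ := fun x => Real.exp (n * (T + β₀.re + δ)) * (S x).toReal
  set K : ℝ := c * (M (n + 1) * k ^ (n + 1)) * Real.exp (-(β₀.re - δ))
  set g₂ : ℝ → ℝ := fun x => K * Real.exp (-x)
  have hg₁ : IntegrableOn g₁ (Iic T) := hSint.const_mul _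
  have hg₂ : IntegrableOn g₂ (Ioi T) := (integrableOn_exp_neg_Ioi T).const_mul _
  refine ⟨(Iic T).indicator g₁ + (Ioi T).indicator g₂,
    ((integrable_indicator_iff measurableSet_Iic).2 hg₁).add
      ((integrable_indicator_iff measurableSet_Ioi).2 hg₂), ?_⟩
  rw [ae_restrict_iff' measurableSet_Iic] at hSae
  filter_upwards [hSae] with x hx β hβ
  have hnorm : ‖logKernel e n (x + β)‖
      = Real.exp (n * (x + β.re)) * ‖e (Complex.exp (x + β))‖ := by
    rw [logKernel, norm_mul, Complex.norm_exp]
    simp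
  have hβre := abs_le.1 (hre β hβ)
  rw [hnorm]
  rcases le_or_gt x T with hxT | hxT
  · simp only [Pi.add_apply, indicator_of_mem (mem_Iic.2 hxT),
      indicator_of_notMem (notMem_Ioi.2 hxT), add_zero, g₁]
    refine mul_le_mul ?_ ?_ (norm_nonneg _) (Real.exp_pos _).le
    · exact Real.exp_le_exp.2 (mul_le_mul_of_nonneg_left (by linarith) (Nat.cast_nonneg _))
    · rw [← toReal_enorm]
      exact ENNReal.toReal_mono (hx hxT).ne (le_iSup₂ (f := fun β (_ : β ∈ Metric.ball β₀ δ) =>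
        ‖e (Complex.exp ((x : ℝ) + β))‖ₑ) β hβ)
  · simp only [Pi.add_apply, indicator_of_mem (mem_Ioi.2 hxT),
      indicator_of_notMem (notMem_Iic.2 hxT), zero_add, g₂, K]
    -- One power more than `n` leaves the integrable factor `exp (-x)` after multiplication by `exp
    -- (n x)`.
    have h1 := hdec (x + β) (by simpa using him β hβ) (n + 1)
    have hM1 := hM.pos (n + 1)
    calc _ ≤ Real.exp (n * (x + β.re)) * (c * (M (n + 1) * k ^ (n + 1))
            * Real.exp (-(((n + 1 : ℕ) : ℝ) * ((x : ℂ) + β).re))) := by gcongr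
      _ = c * (M (n + 1) * k ^ (n + 1)) * Real.exp (-(x + β.re)) := by
          rw [mul_left_comm, ← Real.exp_add]
          congr 2
          push_cast
          simp
          ring
      _ ≤ c * (M (n + 1) * k ^ (n + 1)) * Real.exp (-(β₀.re - δ) + -x) := by
          gcongr
          linarith
      _ = _ := by
          rw [Real.exp_add]
          ring

lemma integrable_logKernel (hM : StronglyRegular M) (hK : IsKernelPair M e E) {β : ℂ}
    (hβ : |β.im| < halfOpening M) (n : ℕ) : Integrable fun x : ℝ => logKernel e n (x + β) := by
  obtain ⟨δ, hδ, -, h⟩ := exists_locally_dominated hM hK hβ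
  obtain ⟨g, hg, hb⟩ := h n
  exact hg.mono' (hK.continuous_logKernel n hβ).aestronglyMeasurable
    (hb.mono fun x hx => hx β (Metric.mem_ball_self hδ))

/-- Integrability at the origin is given only locally uniformly in the direction; compactness of
`[-b, b]` makes the bound uniform. -/
lemma exists_lintegral_Iic_le (hK : IsKernelPair M e E) {b : ℝ} (hb : b < halfOpening M) :
    ∃ T J : ℝ, 0 ≤ J ∧ ∀ α : ℝ, |α| ≤ b →
      ∫⁻ x in Iic T, ‖e (Complex.exp ((x : ℝ) + α * Complex.I))‖ₑ ≤ ENNReal.ofReal J := by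
  obtain ⟨T, hT⟩ := hK.exists_lintegral_iSup_lt_top
  have key : ∃ J : ENNReal, J < ⊤ ∧ ∀ α ∈ Icc (-b) b,
      ∫⁻ x in Iic T, ‖e (Complex.exp ((x : ℝ) + α * Complex.I))‖ₑ ≤ J := by
    refine isCompact_Icc.induction_on
      (p := fun s : Set ℝ => ∃ J : ENNReal, J < ⊤ ∧ ∀ α ∈ s,
        ∫⁻ x in Iic T, ‖e (Complex.exp ((x : ℝ) + α * Complex.I))‖ₑ ≤ J) ?_ ?_ ?_ ?_
    · exact ⟨0, by simp, by simp⟩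
    · rintro s t hst ⟨J, hJ, h⟩
      exact ⟨J, hJ, fun α hα => h α (hst hα)⟩
    · rintro s t ⟨J, hJ, h⟩ ⟨J', hJ', h'⟩
      refine ⟨max J J', max_lt hJ hJ', fun α hα => hα.elim (fun hα => (h α hα).trans
        (le_max_left _ _)) fun hα => (h' α hα).trans (le_max_right _ _)⟩
    · intro α hα
      obtain ⟨δ, hδ, -, hfin⟩ := hT (α * Complex.I) (by
        simpa using (abs_le.2 hα).trans_lt hb)
      refine ⟨Metric.ball α δ, mem_nhdsWithin_of_mem_nhds (Metric.ball_mem_nhds _ hδ), _, hfin,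
        fun α' hα' => lintegral_mono fun x => ?_⟩
      refine le_iSup₂ (f := fun β (_ : β ∈ Metric.ball (α * Complex.I) δ) =>
        ‖e (Complex.exp ((x : ℝ) + β))‖ₑ) (α' * Complex.I) ?_
      rw [Metric.mem_ball, dist_eq_norm, ← sub_mul, norm_mul, Complex.norm_I, mul_one,
        ← Complex.ofReal_sub, Complex.norm_real, ← dist_eq_norm]
      exact hα'
  obtain ⟨J, hJ, h⟩ := key
  refine ⟨T, J.toReal, ENNReal.toReal_nonneg, fun α hα => ?_⟩
  rw [ENNReal.ofReal_toReal hJ.ne]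
  exact h α (abs_le.1 hα)

/-- The line is split at `T`. On the left `exp (n x) ≤ exp (T n)` multiplies an integral bounded
uniformly in the direction; on the right decay of order `n + 1` gives a multiple of `M (n + 1) * k ^
(n + 1)`. -/
lemma exists_integral_norm_le_M (hM : StronglyRegular M) (hK : IsKernelPair M e E) {b : ℝ}
    (hb : b < halfOpening M) : ∃ C B : ℝ, 1 ≤ C ∧ 1 ≤ B ∧ ∀ n : ℕ, ∀ α : ℝ, |α| ≤ b →
      ∫ x : ℝ, ‖logKernel e n (x + α * Complex.I)‖ ≤ C * B ^ n * M n := by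
  obtain ⟨T, J, hJ, hTJ⟩ := hK.exists_lintegral_Iic_le hb
  obtain ⟨c, k, hc, hk, hdec⟩ := exists_norm_le_of_abs_im_le hM hK hb
  obtain ⟨A, hA, hmg⟩ := hM.mg
  have hM1 := hM.pos 1
  have hn : ∀ (n : ℕ) (α : ℝ), |α| ≤ b → ∫ x : ℝ, ‖logKernel e n (x + α * Complex.I)‖
      ≤ Real.exp T ^ n * J + c * (M (n + 1) * k ^ (n + 1)) * Real.exp (-T) := by
    intro n α hα
    have hα' : |((α : ℂ) * Complex.I).im| < halfOpening M := by simpa using hα.trans_lt hb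
    have hint := (integrable_logKernel hM hK hα' n).norm
    have hnorm : ∀ x : ℝ, ‖logKernel e n (x + α * Complex.I)‖
        = Real.exp (n * x) * ‖e (Complex.exp (x + α * Complex.I))‖ := fun x => by
      rw [logKernel, norm_mul, Complex.norm_exp]
      simp
    rw [← integral_add_compl measurableSet_Iic hint (s := Iic T), compl_Iic]
    refine add_le_add ?_ ?_
    · rw [integral_eq_lintegral_of_nonneg_ae (ae_of_all _ fun x => norm_nonneg _)
        hint.1.restrict]
      refine ENNReal.toReal_le_of_le_ofReal (by positivity) ?_
      calc ∫⁻ x in Iic T, ENNReal.ofReal ‖logKernel e n (x + α * Complex.I)‖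
          ≤ ∫⁻ x in Iic T, ENNReal.ofReal (Real.exp T ^ n)
              * ‖e (Complex.exp ((x : ℝ) + α * Complex.I))‖ₑ := by
            refine setLIntegral_mono' measurableSet_Iic fun x hx => ?_
            rw [hnorm, ENNReal.ofReal_mul (Real.exp_pos _).le, ofReal_norm]
            gcongr
            rw [← Real.exp_nat_mul]
            exact Real.exp_le_exp.2 (mul_le_mul_of_nonneg_left hx (Nat.cast_nonneg _))
        _ = ENNReal.ofReal (Real.exp T ^ n)
              * ∫⁻ x in Iic T, ‖e (Complex.exp ((x : ℝ) + α * Complex.I))‖ₑ :=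
            lintegral_const_mul' _ _ ENNReal.ofReal_ne_top
        _ ≤ _ := by
            rw [ENNReal.ofReal_mul (by positivity)]
            gcongr
            exact hTJ α hα
    · calc ∫ x in Ioi T, ‖logKernel e n (x + α * Complex.I)‖
          ≤ ∫ x in Ioi T, c * (M (n + 1) * k ^ (n + 1)) * Real.exp (-x) := by
            refine setIntegral_mono_on hint.integrableOn
              ((integrableOn_exp_neg_Ioi T).const_mul _) measurableSet_Ioi fun x _ => ?_
            have h1 := hdec (x + α * Complex.I) (by simpa using hα) (n + 1)
            rw [hnorm]
            calc _ ≤ Real.exp (n * x) * (c * (M (n + 1) * k ^ (n + 1))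
                  * Real.exp (-(((n + 1 : ℕ) : ℝ) * ((x : ℂ) + α * Complex.I).re))) := by gcongr
              _ = _ := by
                  rw [mul_left_comm, ← Real.exp_add]
                  congr 2
                  push_cast
                  simp
                  ring
        _ = _ := by rw [integral_const_mul, integral_exp_neg_Ioi]
  -- The second entry absorbs `exp T ^ n` through `M 1 ^ n ≤ M n`; the third absorbs `M (n + 1) * k
  -- ^ (n + 1)` through moderate growth.
  set B := max 1 (max (Real.exp T / M 1) (A * k)) with hB
  have hB1 : 1 ≤ B := le_max_left _ _
  have hB2 : Real.exp T ≤ B * M 1 := by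
    rw [← div_le_iff₀ hM1]
    exact (le_max_left _ _).trans (le_max_right _ _)
  have hB3 : A * k ≤ B := (le_max_right _ _).trans (le_max_right _ _)
  refine ⟨1 + J + c * (B * M 1) * Real.exp (-T), B, ?_, hB1, fun n α hα => (hn n α hα).trans ?_⟩
  · have : 0 ≤ c * (B * M 1) * Real.exp (-T) := by positivity
    linarith
  · have hMn := hM.pos n
    have h1 : Real.exp T ^ n * J ≤ J * (B ^ n * M n) := by
      rw [mul_comm]
      refine mul_le_mul_of_nonneg_left ?_ hJ
      calc Real.exp T ^ n ≤ (B * M 1) ^ n := by gcongr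
        _ = B ^ n * M 1 ^ n := mul_pow _ _ _
        _ ≤ _ := by
            gcongr
            exact hM.one_pow_le n
    have h2 : M (n + 1) * k ^ (n + 1) ≤ (B * M 1) * (B ^ n * M n) := by
      calc M (n + 1) * k ^ (n + 1) ≤ (A ^ (n + 1) * M n * M 1) * k ^ (n + 1) := by
            gcongr
            exact hmg n 1
        _ = (A * k) ^ (n + 1) * M n * M 1 := by rw [mul_pow]; ring
        _ ≤ B ^ (n + 1) * M n * M 1 := by gcongr
        _ = _ := by ring
    calc _ ≤ J * (B ^ n * M n) + c * ((B * M 1) * (B ^ n * M n)) * Real.exp (-T) := by gcongr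
      _ ≤ 1 * (B ^ n * M n) + (J * (B ^ n * M n)
            + c * ((B * M 1) * (B ^ n * M n)) * Real.exp (-T)) := by
          have : 0 ≤ 1 * (B ^ n * M n) := by positivity
          linarith
      _ = _ := by ring

lemma momentFun_eq_integral (e : ℂ → ℂ) (p : ℕ) :
    momentFun e p = ∫ x : ℝ, logKernel e p x := by
  rw [momentFun, mellin, integral_Ioi_zero_eq_comp_exp]
  refine integral_congr_ae (ae_of_all _ fun x => ?_)
  have h : ((Real.exp x : ℝ) : ℂ) ≠ 0 := by exact_mod_cast (Real.exp_pos x).ne'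
  simp only [logKernel, smul_eq_mul, Complex.real_smul]
  rw [Complex.cpow_sub _ _ h, Complex.cpow_natCast, Complex.cpow_one, Complex.exp_nat_mul,
    ← Complex.ofReal_exp]
  field_simp

/-- The moments are bounded from above by `M`. -/
lemma exists_moment_le (hM : StronglyRegular M) (hK : IsKernelPair M e E)
    (hm : IsMomentSequence e m) : ∃ C B : ℝ, 1 ≤ C ∧ 1 ≤ B ∧ ∀ p, m p ≤ C * B ^ p * M p := by
  have hW : 0 < halfOpening M := by
    have := hM.omegaIndex_pos
    rw [halfOpening]
    positivity
  obtain ⟨C, B, hC, hB, h⟩ := exists_integral_norm_le_M hM hK hW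
  refine ⟨C, B, hC, hB, fun p => le_trans ?_ (h p 0 (by simp))⟩
  have h1 : m p = ‖momentFun e p‖ := by
    rw [← (hm p).2, Complex.norm_real, Real.norm_of_nonneg (hm p).1.le]
  rw [h1, momentFun_eq_integral]
  simpa using norm_integral_le_integral_norm (μ := volume) fun x : ℝ => logKernel e p x

/-- The moments are bounded from below by `M`. -/
lemma exists_le_moment (hM : StronglyRegular M) (hK : IsKernelPair M e E)
    (hm : IsMomentSequence e m) : ∃ c k : ℝ, 0 < c ∧ 0 < k ∧ ∀ p, c * k ^ p * M p ≤ m p := by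
  obtain ⟨c, k, hc, hk, h⟩ := hK.E_growth
  refine ⟨1 / c, k, by positivity, hk, fun p => ?_⟩
  have hq := hM.growthQuot_pos p
  have hMp := hM.pos p
  have hmp := (hm p).1
  have hser : ∀ z : ℂ, HasSum (fun p : ℕ => z ^ p * (momentFun e p)⁻¹) (E z) := fun z => by
    simpa only [div_eq_mul_inv] using hK.E_series z
  -- Cauchy's estimate for the coefficient `1 / m p` of `E`. At this radius the growth bound of `E`
  -- is evaluated at `growthQuot M p`, where it equals `c` times a quantity at most `growthQuot M p
  -- ^ p / M p`.
  have h1 := norm_coeff_mul_pow_le_of_hasSum hser (R := growthQuot M p * k)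
    (C := c * (growthQuot M p ^ p / M p)) (by positivity) (fun z hz => by
      refine (h z).trans (mul_le_mul_of_nonneg_left ?_ hc.le)
      rw [hz, mul_div_assoc, div_self hk.ne', mul_one]
      exact hM.exp_assocFun_growthQuot_le p) p
  rw [← (hm p).2, norm_inv, Complex.norm_real, Real.norm_of_nonneg hmp.le, mul_pow] at h1
  have h2 : c * (growthQuot M p ^ p / M p) / (growthQuot M p ^ p * k ^ p)
      = (1 / c * k ^ p * M p)⁻¹ := by
    field_simp
  rw [h2] at h1
  exact (inv_le_inv₀ hmp (by positivity)).1 h1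

/-- The rays are found inside the opening `ω(M)π`, whereas the directions in the theorem are
measured by `ω(m)`; this inequality is all that the passage requires. -/
lemma omegaIndex_le_omegaIndex_moment (hM : StronglyRegular M) (hK : IsKernelPair M e E)
    (hm : IsMomentSequence e m) : omegaIndex M ≤ omegaIndex m := by
  obtain ⟨C, B, hC, hB, h⟩ := exists_moment_le hM hK hm
  obtain ⟨c, k, hc, hk, h'⟩ := exists_le_moment hM hK hm
  exact hM.omegaIndex_le_of_equiv hc hk h' hC hB h

/-- Moderate growth passes from `M` to the equivalent sequence `m`. It yields a common radius of
convergence for all the series `∑ m (n + p) / m p x ^ p`. -/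
lemma exists_moment_add_le (hM : StronglyRegular M) (hK : IsKernelPair M e E)
    (hm : IsMomentSequence e m) : ∃ C A : ℝ, 1 ≤ C ∧ 1 ≤ A ∧
      ∀ n p, m (n + p) ≤ C * A ^ (n + p) * (m n * m p) := by
  obtain ⟨C, B, hC, hB, h⟩ := exists_moment_le hM hK hm
  obtain ⟨c, k, hc, hk, h'⟩ := exists_le_moment hM hK hm
  obtain ⟨A, hA, hmg⟩ := hM.mg
  refine ⟨max 1 (C / c ^ 2), max 1 (B * A / k), le_max_left _ _, le_max_left _ _, fun n p => ?_⟩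
  have hn := hM.pos n
  have hp := hM.pos p
  have hmn := (hm n).1
  have hmp := (hm p).1
  calc m (n + p) ≤ C * B ^ (n + p) * M (n + p) := h _
    _ ≤ C * B ^ (n + p) * (A ^ (n + p) * M n * M p) := by
        gcongr
        exact hmg n p
    _ = C / c ^ 2 * (B * A / k) ^ (n + p) * ((c * k ^ n * M n) * (c * k ^ p * M p)) := by
        rw [div_pow, mul_pow, pow_add k]
        field_simp
    _ ≤ max 1 (C / c ^ 2) * max 1 (B * A / k) ^ (n + p) * (m n * m p) := by
        have h1 := h' n
        have h2 := h' p
        have h3 := le_max_right 1 (C / c ^ 2)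
        have h4 := le_max_right 1 (B * A / k)
        gcongr

lemma exists_integral_norm_le_moment (hM : StronglyRegular M) (hK : IsKernelPair M e E)
    (hm : IsMomentSequence e m) {b : ℝ} (hb : b < halfOpening M) :
    ∃ C B : ℝ, 1 ≤ C ∧ 1 ≤ B ∧ ∀ n : ℕ, ∀ α : ℝ, |α| ≤ b →
      ∫ x : ℝ, ‖logKernel e n (x + α * Complex.I)‖ ≤ C * B ^ n * m n := by
  obtain ⟨C, B, hC, hB, h⟩ := exists_integral_norm_le_M hM hK hb
  obtain ⟨c, k, hc, hk, h'⟩ := exists_le_moment hM hK hm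
  refine ⟨max 1 (C / c), max 1 (B / k), le_max_left _ _, le_max_left _ _,
    fun n α hα => (h n α hα).trans ?_⟩
  have hn := hM.pos n
  have hmn := (hm n).1
  calc C * B ^ n * M n = C / c * (B / k) ^ n * (c * k ^ n * M n) := by
        rw [div_pow]
        field_simp
    _ ≤ max 1 (C / c) * max 1 (B / k) ^ n * m n := by
        have h1 := h' n
        have h3 := le_max_right 1 (C / c)
        have h4 := le_max_right 1 (B / k)
        gcongr

end IsKernelPair

/-! ### The Borel-type kernel `∑ m (n + p) / m p x ^ p` and its continuation -/

/-- The integral `∫ u ^ n e(u) E(x u) du / u` along a ray, in logarithmic coordinates, with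
`x = -exp y` and with the ray shifted by `β`. -/
noncomputable def rayIntegral (e E : ℂ → ℂ) (n : ℕ) (y β : ℂ) : ℂ :=
  ∫ s : ℝ, logKernel e n (s + β) * E (-Complex.exp (y + s + β))

/-- The direction used for the argument `x = -exp y`. -/
noncomputable def rayShift (M : ℕ → ℝ) (y : ℂ) : ℂ :=
  ((-(halfOpening M / Real.pi) * y.im : ℝ) : ℂ) * Complex.I

/-- A real shift of `β` rescales the ray onto itself, which is a translation of the integration
variable. -/
lemma rayIntegral_add_real (e E : ℂ → ℂ) (n : ℕ) (y β : ℂ) (x : ℝ) :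
    rayIntegral e E n y (β + x) = rayIntegral e E n y β := by
  refine Eq.trans (integral_congr_ae (ae_of_all _ fun s => ?_)) (integral_add_right_eq_self
    (fun s : ℝ => logKernel e n (s + β) * E (-Complex.exp (y + s + β))) x)
  simp only [Complex.ofReal_add]
  congr 2 <;> ring_nf

lemma rayShift_im (M : ℕ → ℝ) (y : ℂ) :
    (rayShift M y).im = -(halfOpening M / Real.pi) * y.im := by
  rw [rayShift, Complex.im_ofReal_mul]
  simp

namespace IsKernelPair

variable {M m : ℕ → ℝ} {e E : ℂ → ℂ}

lemma halfOpening_pos (hM : StronglyRegular M) : 0 < halfOpening M := by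
  have := hM.omegaIndex_pos
  rw [halfOpening]
  positivity

/-- Polynomial decay of `E` outside the unit disc, compactness inside. The sector used has half
opening `(b + π - W) / 2` with `W = halfOpening M`, strictly between `b` and `π - W`. -/
lemma exists_norm_E_neg_exp_le (hM : StronglyRegular M) (hK : IsKernelPair M e E) {b : ℝ} (hb0 : 0 ≤ b)
    (hb : b < Real.pi - halfOpening M) : ∃ C : ℝ, 0 < C ∧ ∀ y : ℂ, |y.im| ≤ b →
      ‖E (-Complex.exp y)‖ ≤ C := by
  obtain ⟨β, hβ, h⟩ := hK.E_decay
  have hW : omegaIndex M * Real.pi = 2 * halfOpening M := by rw [halfOpening]; ring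
  obtain ⟨c, hc, hdec⟩ := h (b + (Real.pi - halfOpening M)) (by linarith)
    (by rw [hW]; linarith) 1 one_pos
  obtain ⟨D, hD⟩ := (isCompact_closedBall (0 : ℂ) 1).exists_bound_of_continuousOn
    hK.E_hol.continuous.continuousOn
  refine ⟨max c D, lt_max_of_lt_left hc, fun y hy => ?_⟩
  rcases le_total 1 ‖-Complex.exp y‖ with h1 | h1
  · have hWpos : b + (Real.pi - halfOpening M) ≤ 2 * Real.pi := by
      linarith [halfOpening_pos hM]
    refine (hdec _ ?_ h1).trans (le_trans ?_ (le_max_left _ _))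
    · rw [neg_neg]
      exact exp_mem_planeSector hWpos (by linarith)
    · exact div_le_self hc.le (Real.one_le_rpow h1 hβ.le)
  · exact (hD _ (by simpa using h1)).trans (le_max_right _ _)

lemma continuous_rayIntegrand (hK : IsKernelPair M e E) (n : ℕ) (y : ℂ) {β : ℂ}
    (hβ : |β.im| < halfOpening M) :
    Continuous fun s : ℝ => logKernel e n (s + β) * E (-Complex.exp (y + s + β)) := by
  have := hK.E_hol.continuous
  exact (hK.continuous_logKernel n hβ).mul (by fun_prop)

lemma integrable_rayIntegrand (hM : StronglyRegular M) (hK : IsKernelPair M e E) (n : ℕ) {y β : ℂ}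
    (hβ : |β.im| < halfOpening M) (hy : |y.im + β.im| < Real.pi - halfOpening M) :
    Integrable fun s : ℝ => logKernel e n (s + β) * E (-Complex.exp (y + s + β)) := by
  obtain ⟨C, hC, h⟩ := exists_norm_E_neg_exp_le hM hK (abs_nonneg _) hy
  refine ((integrable_logKernel hM hK hβ n).norm.mul_const C).mono'
    (hK.continuous_rayIntegrand n y hβ).aestronglyMeasurable (ae_of_all _ fun s => ?_)
  rw [norm_mul]
  gcongr
  exact h _ (by simp)

lemma differentiableAt_rayIntegral_right (hM : StronglyRegular M) (hK : IsKernelPair M e E)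
    (n : ℕ) {y β : ℂ} (hβ : |β.im| < halfOpening M)
    (hy : |y.im + β.im| < Real.pi - halfOpening M) :
    DifferentiableAt ℂ (rayIntegral e E n y) β := by
  obtain ⟨δ, hδ, hball, hdom⟩ := exists_locally_dominated hM hK hβ
  obtain ⟨g, hg, hgb⟩ := hdom n
  obtain ⟨b, hb1, hb2⟩ := exists_between hy
  obtain ⟨C, hC, hE⟩ := exists_norm_E_neg_exp_le hM hK ((abs_nonneg _).trans hb1.le) hb2
  have hsub : Metric.ball β (min δ (b - |y.im + β.im|)) ⊆ Metric.ball β δ :=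
    Metric.ball_subset_ball (min_le_left _ _)
  have him : ∀ β' ∈ Metric.ball β (min δ (b - |y.im + β.im|)), |y.im + β'.im| ≤ b := by
    intro β' hβ'
    have h1 : ‖β' - β‖ < b - |y.im + β.im| := by
      rw [← dist_eq_norm]
      exact (Metric.mem_ball.1 hβ').trans_le (min_le_right _ _)
    have h2 := Complex.abs_im_le_norm (β' - β)
    rw [Complex.sub_im] at h2
    have h3 := abs_sub_abs_le_abs_sub (y.im + β'.im) (y.im + β.im)
    rw [add_sub_add_left_eq_sub] at h3
    linarith
  refine differentiableAt_integral_of_dominated (lt_min hδ (by linarith))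
    (fun β' hβ' => (hK.continuous_rayIntegrand n y (hball _ (hsub hβ'))).aestronglyMeasurable)
    (ae_of_all _ fun s β' hβ' => ?_) (hg.mul_const C) ?_
  · have h1 : DifferentiableAt ℂ (logKernel e n) (s + β') :=
      hK.differentiableAt_logKernel n (by simpa using hball _ (hsub hβ'))
    have h2 : DifferentiableAt ℂ (fun β : ℂ => logKernel e n (s + β)) β' :=
      h1.comp β' (differentiableAt_id.const_add _)
    have h3 := hK.E_hol
    exact (h2.mul (by fun_prop)).differentiableWithinAt
  · filter_upwards [hgb] with s hs β' hβ'
    rw [norm_mul]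
    exact mul_le_mul (hs _ (hsub hβ')) (hE _ (by simpa using him _ hβ')) (norm_nonneg _)
      ((norm_nonneg _).trans (hs _ (hsub hβ')))

lemma differentiableAt_rayIntegral_left (hM : StronglyRegular M) (hK : IsKernelPair M e E)
    (n : ℕ) {y β : ℂ} (hβ : |β.im| < halfOpening M)
    (hy : |y.im + β.im| < Real.pi - halfOpening M) :
    DifferentiableAt ℂ (fun y => rayIntegral e E n y β) y := by
  obtain ⟨b, hb1, hb2⟩ := exists_between hy
  obtain ⟨C, hC, hE⟩ := exists_norm_E_neg_exp_le hM hK ((abs_nonneg _).trans hb1.le) hb2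
  have him : ∀ y' ∈ Metric.ball y (b - |y.im + β.im|), |y'.im + β.im| ≤ b := by
    intro y' hy'
    have h1 : ‖y' - y‖ < b - |y.im + β.im| := by
      rw [← dist_eq_norm]
      exact Metric.mem_ball.1 hy'
    have h2 := Complex.abs_im_le_norm (y' - y)
    rw [Complex.sub_im] at h2
    have h3 := abs_sub_abs_le_abs_sub (y'.im + β.im) (y.im + β.im)
    rw [add_sub_add_right_eq_sub] at h3
    linarith
  refine differentiableAt_integral_of_dominated (R := b - |y.im + β.im|) (by linarith)
    (fun y' _ => (hK.continuous_rayIntegrand n y' hβ).aestronglyMeasurable)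
    (ae_of_all _ fun s y' _ => ?_) ((integrable_logKernel hM hK hβ n).norm.mul_const C)
    (ae_of_all _ fun s y' hy' => ?_)
  · have h3 := hK.E_hol
    have h4 : Differentiable ℂ fun y' => logKernel e n (s + β) * E (-Complex.exp (y' + s + β)) := by
      fun_prop
    exact (h4 y').differentiableWithinAt
  · rw [norm_mul]
    gcongr
    exact hE _ (by simpa using him _ hy')

/-- The ray integral does not depend on the direction of the ray. -/
lemma rayIntegral_eq (hM : StronglyRegular M) (hK : IsKernelPair M e E) (n : ℕ) {y β β' : ℂ}
    (hβ : |β.im| < halfOpening M) (hy : |y.im + β.im| < Real.pi - halfOpening M)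
    (hβ' : |β'.im| < halfOpening M) (hy' : |y.im + β'.im| < Real.pi - halfOpening M) :
    rayIntegral e E n y β = rayIntegral e E n y β' := by
  have hopen : IsOpen ({β : ℂ | |0 + β.im| < halfOpening M}
      ∩ {β : ℂ | |y.im + β.im| < Real.pi - halfOpening M}) :=
    (isOpen_lt (by fun_prop) continuous_const).inter (isOpen_lt (by fun_prop) continuous_const)
  -- The integral is holomorphic in the complex shift `β` and invariant under real shifts, hence
  -- constant on the strip allowed by the two constraints. This replaces a contour rotation and
  -- avoids estimates on arcs at `0` and `∞`.
  refine eq_of_real_translation_invariant hopen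
    ((convex_abs_im_add_lt _ _).inter (convex_abs_im_add_lt _ _))
    (fun b hb => (differentiableAt_rayIntegral_right hM hK n (by simpa using hb.1)
      hb.2).differentiableWithinAt)
    (fun b _ x => rayIntegral_add_real e E n y b x) ⟨by simpa using hβ, hy⟩
    ⟨by simpa using hβ', hy'⟩

/-- The shift divides the angle `Im y` in the proportion `W : π - W`, with `W = halfOpening M`. Both
constraints, `W` for `e` and `π - W` for `E`, are then met with the same ratio `|Im y| / π`,
uniformly when `|Im y| ≤ b < π`. -/
lemma abs_rayShift_im_le (hM : StronglyRegular M) {y : ℂ} {b : ℝ} (hy : |y.im| ≤ b) :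
    |(rayShift M y).im| ≤ halfOpening M * (b / Real.pi) := by
  have hW := halfOpening_pos hM
  rw [rayShift_im, abs_mul, abs_neg, abs_of_pos (by positivity)]
  calc halfOpening M / Real.pi * |y.im| ≤ halfOpening M / Real.pi * b := by gcongr
    _ = _ := by ring

lemma abs_add_rayShift_im_le (hK : IsKernelPair M e E) {y : ℂ} {b : ℝ} (hy : |y.im| ≤ b) :
    |y.im + (rayShift M y).im| ≤ (Real.pi - halfOpening M) * (b / Real.pi) := by
  have hW := hK.halfOpening_lt_pi
  have h1 : 0 ≤ (Real.pi - halfOpening M) / Real.pi :=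
    div_nonneg (by linarith) Real.pi_pos.le
  have h2 : y.im + (rayShift M y).im = (Real.pi - halfOpening M) / Real.pi * y.im := by
    rw [rayShift_im]
    field_simp [Real.pi_pos.ne']
    ring
  rw [h2, abs_mul, abs_of_nonneg h1]
  calc _ ≤ (Real.pi - halfOpening M) / Real.pi * b := by gcongr
    _ = _ := by ring

lemma abs_rayShift_im_lt (hM : StronglyRegular M) {y : ℂ} (hy : |y.im| < Real.pi) :
    |(rayShift M y).im| < halfOpening M := by
  have hW := halfOpening_pos hM
  refine (abs_rayShift_im_le hM le_rfl).trans_lt ?_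
  have : |y.im| / Real.pi < 1 := (div_lt_one Real.pi_pos).2 hy
  nlinarith

lemma abs_add_rayShift_im_lt (hK : IsKernelPair M e E) {y : ℂ} (hy : |y.im| < Real.pi) :
    |y.im + (rayShift M y).im| < Real.pi - halfOpening M := by
  have hW := hK.halfOpening_lt_pi
  refine (abs_add_rayShift_im_le hK le_rfl).trans_lt ?_
  have : |y.im| / Real.pi < 1 := (div_lt_one Real.pi_pos).2 hy
  nlinarith

/-- `rayShift` is not holomorphic in `y`, but near a given `y` the direction can be frozen without
changing the integral. -/
lemma differentiableAt_rayIntegral_rayShift (hM : StronglyRegular M) (hK : IsKernelPair M e E)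
    (n : ℕ) {y : ℂ} (hy : |y.im| < Real.pi) :
    DifferentiableAt ℂ (fun y => rayIntegral e E n y (rayShift M y)) y := by
  have h1 := abs_rayShift_im_lt hM hy
  have h2 := hK.abs_add_rayShift_im_lt hy
  refine (differentiableAt_rayIntegral_left hM hK n h1 h2).congr_of_eventuallyEq ?_
  have hopen : IsOpen ({y' : ℂ | |y'.im| < Real.pi}
      ∩ {y' : ℂ | |y'.im + (rayShift M y).im| < Real.pi - halfOpening M}) :=
    (isOpen_lt (by fun_prop) continuous_const).inter (isOpen_lt (by fun_prop) continuous_const)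
  filter_upwards [hopen.mem_nhds ⟨hy, h2⟩] with y' hy'
  exact rayIntegral_eq hM hK n (abs_rayShift_im_lt hM hy'.1) (hK.abs_add_rayShift_im_lt hy'.1) h1
    hy'.2

lemma exists_norm_rayIntegral_le (hM : StronglyRegular M) (hK : IsKernelPair M e E)
    (hm : IsMomentSequence e m) {b : ℝ} (hb0 : 0 ≤ b) (hb : b < Real.pi) :
    ∃ C B : ℝ, 0 < C ∧ 0 < B ∧ ∀ n : ℕ, ∀ y : ℂ, |y.im| ≤ b →
      ‖rayIntegral e E n y (rayShift M y)‖ ≤ C * B ^ n * m n := by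
  have hW := halfOpening_pos hM
  have hWπ := hK.halfOpening_lt_pi
  have hbπ : b / Real.pi < 1 := (div_lt_one Real.pi_pos).2 hb
  have hbπ0 : 0 ≤ b / Real.pi := div_nonneg hb0 Real.pi_pos.le
  obtain ⟨C, B, hC, hB, h⟩ := exists_integral_norm_le_moment hM hK hm
    (b := halfOpening M * (b / Real.pi)) (by nlinarith)
  obtain ⟨D, hD, hE⟩ := exists_norm_E_neg_exp_le hM hK (b := (Real.pi - halfOpening M) * (b / Real.pi))
    (mul_nonneg (by linarith) hbπ0) (by nlinarith)
  refine ⟨C * D, B, by positivity, by positivity, fun n y hy => ?_⟩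
  have hyπ := hy.trans_lt hb
  set α : ℝ := -(halfOpening M / Real.pi) * y.im with hα
  have hα' : rayShift M y = (α : ℂ) * Complex.I := rfl
  have hint := integrable_logKernel hM hK (abs_rayShift_im_lt hM hyπ) n
  calc ‖rayIntegral e E n y (rayShift M y)‖
      ≤ ∫ s : ℝ, ‖logKernel e n (s + rayShift M y)‖ * D := by
        refine norm_integral_le_of_norm_le (hint.norm.mul_const D) (ae_of_all _ fun s => ?_)
        rw [norm_mul]
        gcongr
        exact hE _ (by simpa using hK.abs_add_rayShift_im_le hy)
    _ = (∫ s : ℝ, ‖logKernel e n (s + α * Complex.I)‖) * D := by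
        rw [integral_mul_const, hα']
    _ ≤ C * B ^ n * m n * D := by
        gcongr
        refine h n α ?_
        have := abs_rayShift_im_le hM hy
        rwa [rayShift_im] at this
    _ = _ := by ring

lemma summable_moment_series (hm : IsMomentSequence e m) {C A x₀ : ℝ} (hC : 0 ≤ C) (hA : 0 < A)
    (hCA : ∀ n p, m (n + p) ≤ C * A ^ (n + p) * (m n * m p)) (hx₀ : A * x₀ ≤ 1 / 2) (n : ℕ) {x : ℂ}
    (hx : ‖x‖ < x₀) :
    Summable (fun p => ‖((m (n + p) / m p : ℝ) : ℂ) * x ^ p‖) ∧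
      ∑' p, ‖((m (n + p) / m p : ℝ) : ℂ) * x ^ p‖ ≤ C * A ^ n * m n * 2 := by
  have hb : ∀ p, ‖((m (n + p) / m p : ℝ) : ℂ) * x ^ p‖ ≤ C * A ^ n * m n * (1 / 2) ^ p := by
    intro p
    have h1 := (hm (n + p)).1
    have h2 := (hm p).1
    have h3 := (hm n).1
    rw [norm_mul, Complex.norm_real, Real.norm_of_nonneg (by positivity), norm_pow]
    have h4 : m (n + p) / m p ≤ C * A ^ n * m n * A ^ p := by
      rw [div_le_iff₀ h2]
      refine (hCA n p).trans (le_of_eq ?_)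
      ring
    calc _ ≤ (C * A ^ n * m n * A ^ p) * x₀ ^ p := by gcongr
      _ = C * A ^ n * m n * (A * x₀) ^ p := by ring
      _ ≤ _ := by
          have : 0 ≤ A * x₀ := mul_nonneg hA.le ((norm_nonneg _).trans hx.le)
          gcongr
  have hg := (hasSum_geometric_of_lt_one (r := (1 / 2 : ℝ)) (by norm_num) (by norm_num)).mul_left
    (C * A ^ n * m n)
  have hs := Summable.of_nonneg_of_le (fun p => norm_nonneg _) hb hg.summable
  refine ⟨hs, (hs.tsum_le_tsum hb hg.summable).trans (le_of_eq ?_)⟩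
  rw [hg.tsum_eq]
  norm_num

/-- Along the positive axis the kernel integral is the sum of the series of moments. -/
lemma hasSum_integral_logKernel (hM : StronglyRegular M) (hK : IsKernelPair M e E)
    (hm : IsMomentSequence e m) {C A D B x₀ : ℝ} (hC : 0 ≤ C) (hA : 0 < A)
    (hCA : ∀ n p, m (n + p) ≤ C * A ^ (n + p) * (m n * m p)) (hD : 0 ≤ D) (hB : 0 < B)
    (hDB : ∀ n : ℕ, ∫ x : ℝ, ‖logKernel e n x‖ ≤ D * B ^ n * m n)
    (hx₀ : A * B * x₀ ≤ 1 / 2) (n : ℕ) {x : ℂ} (hx : ‖x‖ < x₀) :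
    Integrable (fun s : ℝ => logKernel e n s * E (x * Complex.exp s)) ∧
      HasSum (fun p => ((m (n + p) / m p : ℝ) : ℂ) * x ^ p)
        (∫ s : ℝ, logKernel e n s * E (x * Complex.exp s)) := by
  have hW := halfOpening_pos hM
  have hint : ∀ p, Integrable fun s : ℝ => logKernel e p s := fun p => by
    simpa using integrable_logKernel hM hK (β := 0) (by simpa using hW) p
  -- The `p`-th term of `E (x exp s)` carries `exp (p s)`, which raises the order of the kernel from
  -- `n` to `n + p`; its integral is the moment `m (n + p)`. Smallness of `x` makes the `L¹` norms
  -- geometrically summable.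
  set f : ℕ → ℝ → ℂ := fun p s => (x ^ p / m p) * logKernel e (n + p) s with hf
  have hfint : ∀ p, Integrable (f p) := fun p => (hint _).const_mul _
  have hfsum : Summable fun p => ∫ s, ‖f p s‖ := by
    refine Summable.of_nonneg_of_le (fun p => integral_nonneg fun s => norm_nonneg _)
      (fun p => ?_) ((summable_geometric_of_lt_one (r := (1 / 2 : ℝ)) (by norm_num)
        (by norm_num)).mul_left (D * C * B ^ n * A ^ n * m n))
    have h1 := (hm (n + p)).1
    have h2 := (hm p).1
    have h3 := (hm n).1
    have hx0 : 0 ≤ x₀ := (norm_nonneg _).trans hx.le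
    simp only [hf, norm_mul, norm_div, norm_pow, Complex.norm_real]
    rw [integral_const_mul, Real.norm_of_nonneg h2.le]
    calc _ ≤ ‖x‖ ^ p / m p * (D * B ^ (n + p) * m (n + p)) := by
          gcongr
          exact hDB _
      _ ≤ x₀ ^ p / m p * (D * B ^ (n + p) * (C * A ^ (n + p) * (m n * m p))) := by
          gcongr
          exact hCA n p
      _ = D * C * B ^ n * A ^ n * m n * (A * B * x₀) ^ p := by
          field_simp
          ring
      _ ≤ _ := by
          have : 0 ≤ A * B * x₀ := mul_nonneg (by positivity) ((norm_nonneg _).trans hx.le)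
          gcongr
  have hsum : ∀ s : ℝ, HasSum (fun p => f p s) (logKernel e n s * E (x * Complex.exp s)) := by
    intro s
    have h1 := (hK.E_series (x * Complex.exp s)).mul_left (logKernel e n s)
    refine h1.congr_fun fun p => ?_
    simp only [hf, logKernel]
    rw [← (hm p).2, mul_pow, ← Complex.exp_nat_mul]
    push_cast
    rw [add_mul, Complex.exp_add]
    ring
  have hmeas : AEStronglyMeasurable (fun s : ℝ => logKernel e n s * E (x * Complex.exp s)) := by
    have := hK.E_hol.continuous
    have h2 : Continuous fun s : ℝ => E (x * Complex.exp s) := by fun_prop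
    exact (hint n).1.mul h2.aestronglyMeasurable
  refine ⟨integrable_of_hasSum_of_summable_integral_norm hfint hfsum hsum hmeas, ?_⟩
  have h3 := hasSum_integral_of_summable_integral_norm hfint hfsum
  simp only [(hsum _).tsum_eq] at h3
  refine h3.congr_fun fun p => ?_
  simp only [hf]
  rw [integral_const_mul, ← momentFun_eq_integral, ← (hm (n + p)).2]
  push_cast
  ring

end IsKernelPair

namespace IsKernelPair

variable {M m : ℕ → ℝ} {e E : ℂ → ℂ}

/-- Both sides are holomorphic on the half-strip `|Im y| < π`, `Re y < log x₀`. They agree for small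
`|Im y|`, where the direction `0` is admissible, and the identity theorem does the rest. -/
lemma rayIntegral_eq_axisIntegral (hM : StronglyRegular M) (hK : IsKernelPair M e E) (n : ℕ)
    {x₀ : ℝ} (hx₀ : 0 < x₀)
    (hd : DifferentiableOn ℂ (fun x => ∫ s : ℝ, logKernel e n s * E (x * Complex.exp s))
      (Metric.ball 0 x₀)) {y : ℂ} (hy : |y.im| < Real.pi) (hyx : y.re < Real.log x₀) :
    rayIntegral e E n y (rayShift M y)
      = ∫ s : ℝ, logKernel e n s * E (-Complex.exp y * Complex.exp s) := by
  have hW := halfOpening_pos hM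
  have hWπ := hK.halfOpening_lt_pi
  set V : Set ℂ := {y | |0 + y.im| < Real.pi} ∩ {y | y.re < Real.log x₀} with hV
  have hVo : IsOpen V := (isOpen_lt (by fun_prop) continuous_const).inter
    (isOpen_lt Complex.continuous_re continuous_const)
  have hVc : Convex ℝ V := (convex_abs_im_add_lt _ _).inter (convex_halfSpace_re_lt _)
  have hball : ∀ y ∈ V, -Complex.exp y ∈ Metric.ball (0 : ℂ) x₀ := fun y hy => by
    rw [mem_ball_zero_iff, norm_neg, Complex.norm_exp, ← Real.lt_log_iff_exp_lt hx₀]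
    exact hy.2
  have h1 : DifferentiableOn ℂ (fun y => rayIntegral e E n y (rayShift M y)) V := fun y hy =>
    (differentiableAt_rayIntegral_rayShift hM hK n (by simpa using hy.1)).differentiableWithinAt
  have h2 : DifferentiableOn ℂ
      (fun y => ∫ s : ℝ, logKernel e n s * E (-Complex.exp y * Complex.exp s)) V :=
    hd.comp (f := fun y => -Complex.exp y) (by fun_prop) hball
  have hy₀ : ((Real.log x₀ - 1 : ℝ) : ℂ) ∈ V := ⟨by simpa using Real.pi_pos, by
    simp only [mem_ofPred_eq, Complex.ofReal_re]
    linarith⟩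
  refine (h1.analyticOnNhd hVo).eqOn_of_preconnected_of_eventuallyEq (h2.analyticOnNhd hVo)
    hVc.isPreconnected hy₀ ?_ ⟨by simpa using hy, hyx⟩
  have hopen : IsOpen (V ∩ {y | |y.im| < Real.pi - halfOpening M}) :=
    hVo.inter (isOpen_abs_im_lt _)
  filter_upwards [hopen.mem_nhds ⟨hy₀, by simp; linarith⟩] with y hy
  have hyπ : |y.im| < Real.pi := by simpa using hy.1.1
  rw [rayIntegral_eq hM hK n (abs_rayShift_im_lt hM hyπ) (hK.abs_add_rayShift_im_lt hyπ)
    (β' := 0) (by simpa using hW) (by simpa using hy.2), rayIntegral]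
  simp only [add_zero, Complex.exp_add, neg_mul]

/-- The kernel `∑ m (n + p) / m p x ^ p`: analytic continuation to the plane cut along the positive
real axis, integral representation, and estimates. -/
theorem exists_continued_kernel (hM : StronglyRegular M) (hK : IsKernelPair M e E)
    (hm : IsMomentSequence e m) : ∃ x₀ : ℝ, 0 < x₀ ∧ ∃ κ : ℕ → ℂ → ℂ,
      (∀ n x, (‖x‖ < x₀ ∨ -x ∈ Complex.slitPlane) → DifferentiableAt ℂ (κ n) x) ∧
      (∀ n x, ‖x‖ < x₀ → HasSum (fun p => ((m (n + p) / m p : ℝ) : ℂ) * x ^ p) (κ n x)) ∧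
      (∀ x, (‖x‖ < x₀ ∨ -x ∈ Complex.slitPlane) → ∃ α : ℝ, |α| < halfOpening M ∧ ∀ n,
        Integrable (fun s : ℝ => logKernel e n (s + α * Complex.I)
          * E (x * Complex.exp (s + α * Complex.I))) ∧
        κ n x = ∫ s : ℝ, logKernel e n (s + α * Complex.I)
          * E (x * Complex.exp (s + α * Complex.I))) ∧
      (∀ δ : ℝ, 0 < δ → ∃ C B : ℝ, 0 < C ∧ 0 < B ∧ ∀ n x,
        (‖x‖ < x₀ ∨ (-x ∈ Complex.slitPlane ∧ |(-x).arg| ≤ Real.pi - δ)) →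
          ‖κ n x‖ ≤ C * B ^ n * m n) := by
  have hW := halfOpening_pos hM
  obtain ⟨C, A, hC, hA, hCA⟩ := exists_moment_add_le hM hK hm
  obtain ⟨D, B, hD, hB, hDB'⟩ := exists_integral_norm_le_moment hM hK hm hW
  have hDB : ∀ n : ℕ, ∫ x : ℝ, ‖logKernel e n x‖ ≤ D * B ^ n * m n := fun n => by
    simpa using hDB' n 0 (by simp)
  have hA0 : 0 < A := by linarith
  have hB0 : 0 < B := by linarith
  -- The ratio `A * B * x₀` of the dominating geometric series becomes `1 / 2`. Since `A` and `B` do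
  -- not depend on `n`, one disc serves all the kernels.
  set x₀ : ℝ := 1 / (2 * (A * B)) with hx₀def
  have hx₀ : 0 < x₀ := by positivity
  have hABx : A * B * x₀ ≤ 1 / 2 := by
    rw [hx₀def]
    field_simp
    rfl
  have hAx : A * x₀ ≤ 1 / 2 := by
    refine le_trans ?_ hABx
    gcongr
    exact le_mul_of_one_le_right hA0.le hB
  have haxis := fun (n : ℕ) (x : ℂ) (hx : ‖x‖ < x₀) =>
    hasSum_integral_logKernel hM hK hm (by linarith) hA0 hCA (by linarith) hB0 hDB hABx n hx
  set S : ℕ → ℂ → ℂ := fun n x => ∫ s : ℝ, logKernel e n s * E (x * Complex.exp s) with hS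
  have hSd : ∀ n, DifferentiableOn ℂ (S n) (Metric.ball 0 x₀) := fun n =>
    differentiableOn_ball_of_hasSum hx₀ (a := fun p => ((m (n + p) / m p : ℝ) : ℂ))
      fun z hz => by simpa only [smul_eq_mul, mul_comm] using (haxis n z hz).2
  -- The choice in the overlap is immaterial: there the two expressions coincide by the identity
  -- theorem.
  set κ : ℕ → ℂ → ℂ := fun n x => if ‖x‖ < x₀ then S n x else
    rayIntegral e E n (Complex.log (-x)) (rayShift M (Complex.log (-x))) with hκ
  have hlog : ∀ x : ℂ, -x ∈ Complex.slitPlane → |(Complex.log (-x)).im| < Real.pi := fun x hx => by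
    rw [Complex.log_im]
    refine lt_of_le_of_ne (Complex.abs_arg_le_pi _) fun h => ?_
    rcases (abs_eq Real.pi_pos.le).1 h with h | h
    · exact (Complex.mem_slitPlane_iff_arg.1 hx).1 h
    · exact (Complex.neg_pi_lt_arg _).ne' h
  have hκS : ∀ n x, ‖x‖ < x₀ → κ n x = S n x := fun n x hx => if_pos hx
  have hκR : ∀ n x, -x ∈ Complex.slitPlane → κ n x
      = rayIntegral e E n (Complex.log (-x)) (rayShift M (Complex.log (-x))) := by
    intro n x hx
    by_cases h : ‖x‖ < x₀
    · have hx0 : -x ≠ 0 := Complex.slitPlane_ne_zero hx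
      rw [hκS n x h, rayIntegral_eq_axisIntegral hM hK n hx₀ (hSd n) (hlog x hx),
        Complex.exp_log hx0, neg_neg]
      rw [Complex.log_re, norm_neg]
      exact Real.log_lt_log (by simpa using hx0) h
    · exact if_neg h
  refine ⟨x₀, hx₀, κ, ?_, ?_, ?_, ?_⟩
  · rintro n x (hx | hx)
    · have hmem : Metric.ball (0 : ℂ) x₀ ∈ 𝓝 x := Metric.isOpen_ball.mem_nhds (by simpa using hx)
      refine ((hSd n).differentiableAt hmem).congr_of_eventuallyEq ?_
      filter_upwards [hmem] with x' hx' using hκS n x' (by simpa using hx')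
    · have h1 := differentiableAt_rayIntegral_rayShift hM hK n (hlog x hx)
      have h2 : DifferentiableAt ℂ (fun x => Complex.log (-x)) x := differentiableAt_id.neg.clog hx
      refine (h1.comp x h2).congr_of_eventuallyEq ?_
      have hopen : IsOpen {x : ℂ | -x ∈ Complex.slitPlane} :=
        Complex.isOpen_slitPlane.preimage continuous_neg
      filter_upwards [hopen.mem_nhds hx] with x' hx' using hκR n x' hx'
  · intro n x hx
    rw [hκS n x hx]
    exact (haxis n x hx).2
  · intro x hx
    by_cases h : -x ∈ Complex.slitPlane
    · have hx0 : -x ≠ 0 := Complex.slitPlane_ne_zero h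
      have hyπ := hlog x h
      have h1 := abs_rayShift_im_lt hM hyπ
      refine ⟨-(halfOpening M / Real.pi) * (Complex.log (-x)).im, by rwa [rayShift_im] at h1,
        fun n => ?_⟩
      have h2 : ∀ s : ℝ, -Complex.exp (Complex.log (-x) + s + rayShift M (Complex.log (-x)))
          = x * Complex.exp (s + rayShift M (Complex.log (-x))) := fun s => by
        rw [add_assoc, Complex.exp_add, Complex.exp_log hx0]
        ring
      have h3 := integrable_rayIntegrand hM hK n h1 (hK.abs_add_rayShift_im_lt hyπ)
      have h4 := hκR n x h
      rw [rayIntegral] at h4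
      simp only [h2] at h3 h4
      exact ⟨h3, h4⟩
    -- Here `x` is a nonnegative real number, which occurs only inside the disc, and the positive
    -- axis itself serves as the ray. In both cases `α` does not depend on `n`.
    · have hx' := hx.resolve_right h
      refine ⟨0, by simpa using hW, fun n => ?_⟩
      rw [hκS n x hx']
      simpa [hS] using (haxis n x hx').1
  · intro δ hδ
    -- The maximum with `0` covers `δ > π`.
    obtain ⟨C', B', hC', hB', h⟩ := exists_norm_rayIntegral_le hM hK hm
      (b := max 0 (Real.pi - δ)) (le_max_left _ _) (max_lt Real.pi_pos (by linarith))
    refine ⟨max (C * 2) C', max A B', by positivity, by positivity, fun n x hx => ?_⟩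
    have hmn := (hm n).1
    rcases hx with hx | ⟨hx, hx'⟩
    · have h1 : HasSum _ (S n x) := (haxis n x hx).2
      have h2 := summable_moment_series hm (by linarith) hA0 hCA hAx n hx
      rw [hκS n x hx]
      calc ‖S n x‖ ≤ C * A ^ n * m n * 2 := by
            rw [← h1.tsum_eq]
            exact (norm_tsum_le_tsum_norm h2.1).trans h2.2
        _ = C * 2 * A ^ n * m n := by ring
        _ ≤ _ := by
            gcongr
            · exact le_max_left _ _
            · exact le_max_left _ _
    · rw [hκR n x hx]
      refine (h n _ (le_max_of_le_right (by rwa [Complex.log_im]))).trans ?_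
      gcongr
      · exact le_max_right _ _
      · exact le_max_right _ _

end IsKernelPair

/-! ### Functions on the hat domain in the logarithmic coordinate -/

section Paths

variable {F : Type*} [NormedAddCommGroup F] [NormedSpace ℂ F]
variable {d θ r : ℝ} {φ : HatPoint → F}

lemma norm_exp_lt_iff_re_lt_log (hr : 0 < r) (ω : ℂ) : ‖Complex.exp ω‖ < r ↔ ω.re < Real.log r := by
  rw [Complex.norm_exp, Real.lt_log_iff_exp_lt hr]

lemma logPoint_of_norm_lt {ω : ℂ} (h : ‖Complex.exp ω‖ < r) :
    logPoint r ω = .disc (Complex.exp ω) := if_pos h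

lemma IsHolOnHat.logPoint_eq_sec (hφ : IsHolOnHat d θ r φ) {ω : ℂ} (h : |ω.im - d| < θ / 2) :
    φ (logPoint r ω) = φ (.sec ω) := by
  by_cases h' : ‖Complex.exp ω‖ < r
  · rw [logPoint_of_norm_lt h', hφ.agree ω h h']
  · rw [logPoint, if_neg h']

lemma isOpen_logDomain (d θ r : ℝ) : IsOpen (logDomain d θ r) := by
  have h1 : IsOpen {ω : ℂ | ‖Complex.exp ω‖ < r} := isOpen_lt (by fun_prop) continuous_const
  have h2 : IsOpen {ω : ℂ | |ω.im - d| < θ / 2} := isOpen_lt (by fun_prop) continuous_const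
  exact h1.union h2

lemma IsHolOnHat.differentiableOn_logPoint (hφ : IsHolOnHat d θ r φ) :
    DifferentiableOn ℂ (fun ω => φ (logPoint r ω)) (logDomain d θ r) := by
  rintro ω (h | h)
  · have hopen : IsOpen {ω : ℂ | ‖Complex.exp ω‖ < r} := isOpen_lt (by fun_prop) continuous_const
    have h1 : DifferentiableAt ℂ (fun w => φ (.disc w)) (Complex.exp ω) :=
      hφ.disc.differentiableAt (Metric.isOpen_ball.mem_nhds (by simpa using h))
    refine ((h1.comp ω Complex.differentiableAt_exp).congr_of_eventuallyEq
      ?_).differentiableWithinAt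
    filter_upwards [hopen.mem_nhds h] with ω' hω'
    rw [logPoint_of_norm_lt hω']
    rfl
  · have hopen : IsOpen {ω : ℂ | |ω.im - d| < θ / 2} := isOpen_lt (by fun_prop) continuous_const
    refine ((hφ.sec.differentiableAt (hopen.mem_nhds h)).congr_of_eventuallyEq
      ?_).differentiableWithinAt
    filter_upwards [hopen.mem_nhds h] with ω' hω' using hφ.logPoint_eq_sec hω'

lemma logPoint_add_two_pi {ω : ℂ} (h : ‖Complex.exp ω‖ < r) :
    logPoint r (ω + 2 * Real.pi * Complex.I) = logPoint r ω := by
  rw [logPoint_of_norm_lt h, logPoint_of_norm_lt, Complex.exp_periodic ω]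
  rwa [Complex.exp_periodic ω]

/-! ### Paths that wind once around the origin -/

/-- The logarithm `x t + i (a + 2 π t)` of a closed path with modulus `exp (x t)`. -/
noncomputable def windingPath (x : ℝ → ℝ) (a t : ℝ) : ℂ :=
  x t + ((a + 2 * Real.pi * t : ℝ) : ℂ) * Complex.I

@[simp] lemma windingPath_re (x : ℝ → ℝ) (a t : ℝ) : (windingPath x a t).re = x t := by
  simp [windingPath]

@[simp] lemma windingPath_im (x : ℝ → ℝ) (a t : ℝ) :
    (windingPath x a t).im = a + 2 * Real.pi * t := by
  simp [windingPath]

/-- The set on which the continued kernel is holomorphic. -/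
def kernelDomain (x₀ : ℝ) : Set ℂ := {x | ‖x‖ < x₀ ∨ -x ∈ Complex.slitPlane}

lemma isOpen_kernelDomain (x₀ : ℝ) : IsOpen (kernelDomain x₀) :=
  (isOpen_lt continuous_norm continuous_const).union
    (Complex.isOpen_slitPlane.preimage continuous_neg)

lemma ofReal_mul_mem_slitPlane {c : ℝ} (hc : 0 < c) {z : ℂ} (hz : z ∈ Complex.slitPlane) :
    (c : ℂ) * z ∈ Complex.slitPlane := by
  rw [Complex.mem_slitPlane_iff_arg] at hz ⊢
  rw [Complex.arg_real_mul _ hc]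
  exact ⟨hz.1, mul_ne_zero (by exact_mod_cast hc.ne') hz.2⟩

/-- The paths along which the moment derivatives at `z` are represented. -/
structure IsAdmissible (d θ r x₀ : ℝ) (z : ℂ) (x : ℝ → ℝ) (a : ℝ) : Prop where
  contDiff : ContDiff ℝ 1 x
  ends : x 0 = x 1
  lt : x 0 < Real.log r
  mem : ∀ t ∈ Icc (0 : ℝ) 1, x t < Real.log r ∨ |a + 2 * Real.pi * t - d| < θ / 2
  kernel : ∀ t ∈ Icc (0 : ℝ) 1, ‖z‖ * Real.exp (-x t) < x₀ ∨
    -(z * Complex.exp (-(((a + 2 * Real.pi * t : ℝ) : ℂ) * Complex.I))) ∈ Complex.slitPlane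

namespace IsAdmissible

variable {x₀ : ℝ} {z : ℂ} {x y : ℝ → ℝ} {a : ℝ}

lemma contDiff_windingPath (h : IsAdmissible d θ r x₀ z x a) :
    ContDiff ℝ 1 (windingPath x a) := by
  have h1 := h.contDiff
  have h2 : ContDiff ℝ 1 fun t => (x t : ℂ) := Complex.ofRealCLM.contDiff.comp h1
  have h3 : ContDiff ℝ 1 fun t : ℝ => ((a + 2 * Real.pi * t : ℝ) : ℂ) :=
    Complex.ofRealCLM.contDiff.comp (f := fun t : ℝ => a + 2 * Real.pi * t) (by fun_prop)
  exact h2.add (h3.mul contDiff_const)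

lemma mem_logDomain (hr : 0 < r) (h : IsAdmissible d θ r x₀ z x a) {t : ℝ}
    (ht : t ∈ Icc (0 : ℝ) 1) : windingPath x a t ∈ logDomain d θ r := by
  rw [logDomain, mem_ofPred_eq, norm_exp_lt_iff_re_lt_log hr]
  simpa using h.mem t ht

lemma mem_kernelDomain (h : IsAdmissible d θ r x₀ z x a) {t : ℝ} (ht : t ∈ Icc (0 : ℝ) 1) :
    z * Complex.exp (-windingPath x a t) ∈ kernelDomain x₀ := by
  refine (h.kernel t ht).imp (fun h => ?_) fun h => ?_
  · rw [norm_mul, Complex.norm_exp]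
    simpa using h
  · have := ofReal_mul_mem_slitPlane (Real.exp_pos (-x t)) h
    rw [windingPath, neg_add, Complex.exp_add, ← Complex.ofReal_neg, ← Complex.ofReal_exp]
    convert this using 1
    ring

/-- Admissible paths form a convex set. -/
lemma add_mul_sub (h : IsAdmissible d θ r x₀ z x a) (h' : IsAdmissible d θ r x₀ z y a) {s : ℝ}
    (hs : s ∈ Icc (0 : ℝ) 1) : IsAdmissible d θ r x₀ z (fun t => x t + s * (y t - x t)) a := by
  have h1 := h.contDiff
  have h2 := h'.contDiff
  -- At each `t` both paths have the same argument, so an alternative on the argument alone is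
  -- shared by all intermediate paths. The alternatives on the modulus are an upper and a lower
  -- bound for `x t`, preserved because the intermediate value lies between the minimum and the
  -- maximum.
  have hle : ∀ t, x t + s * (y t - x t) ≤ max (x t) (y t) := fun t => by
    have h3 := le_max_left (x t) (y t)
    have h4 := le_max_right (x t) (y t)
    nlinarith [hs.1, hs.2]
  have hge : ∀ t, min (x t) (y t) ≤ x t + s * (y t - x t) := fun t => by
    have h3 := min_le_left (x t) (y t)
    have h4 := min_le_right (x t) (y t)
    nlinarith [hs.1, hs.2]
  refine ⟨by fun_prop, by simp only [h.ends, h'.ends], (hle 0).trans_lt (max_lt h.lt h'.lt),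
    fun t ht => ?_, fun t ht => ?_⟩
  · rcases h.mem t ht with h3 | h3
    · rcases h'.mem t ht with h4 | h4
      · exact Or.inl ((hle t).trans_lt (max_lt h3 h4))
      · exact Or.inr h4
    · exact Or.inr h3
  · rcases h.kernel t ht with h3 | h3
    · rcases h'.kernel t ht with h4 | h4
      · refine Or.inl ?_
        rcases min_choice (x t) (y t) with h5 | h5
        · have := hge t
          rw [h5] at this
          refine lt_of_le_of_lt ?_ h3
          gcongr
        · have := hge t
          rw [h5] at this
          refine lt_of_le_of_lt ?_ h4
          gcongr
      · exact Or.inr h4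
    · exact Or.inr h3

lemma isCircleDeformation (hr : 0 < r) (h : IsAdmissible d θ r x₀ z x a) {r₁ : ℝ} (hr₁ : 0 < r₁)
    (hr₁r : r₁ < r) : IsCircleDeformation d θ r r₁ (windingPath x a) := by
  have hlog : Real.log r₁ < Real.log r := Real.log_lt_log hr₁ hr₁r
  have hlt : ∀ s ∈ Icc (0 : ℝ) 1, ∀ b : ℝ, b < Real.log r →
      Real.log r₁ + s * (b - Real.log r₁) < Real.log r := fun s hs b hb => by
    rcases hs.1.eq_or_lt with h0 | h0
    · simpa [← h0] using hlog
    · nlinarith [hs.2]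
  have hx := h.contDiff.continuous
  refine ⟨⟨1, fun i => i, Nat.mono_cast, by simp, by simp, fun i _ =>
    h.contDiff_windingPath.contDiffOn⟩, a,
    fun p => windingPath (fun t => Real.log r₁ + p.1 * (x t - Real.log r₁)) a p.2, ?_, ?_, ?_,
    ?_, ?_⟩
  · simp only [windingPath]
    fun_prop
  · intro s hs t ht
    rw [logDomain, mem_ofPred_eq, norm_exp_lt_iff_re_lt_log hr, windingPath_re, windingPath_im]
    exact (h.mem t ht).imp (hlt s hs _) id
  · intro s hs
    rw [norm_exp_lt_iff_re_lt_log hr, windingPath_re]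
    refine ⟨hlt s hs _ h.lt, ?_⟩
    simp only [windingPath, h.ends]
    push_cast
    ring
  · intro t _
    simp [windingPath]
  · intro t _
    simp [windingPath]

end IsAdmissible

/-- The integrand of the Cauchy type integral with the kernel `κ`, in logarithmic coordinates. -/
noncomputable def cauchyIntegrand (r : ℝ) (φ : HatPoint → F) (κ : ℂ → ℂ) (n : ℕ) (z ω : ℂ) : F :=
  (Complex.exp (-(n * ω)) * κ (z * Complex.exp (-ω))) • φ (logPoint r ω)

/-- The Cauchy type integral with the kernel `κ` along the path with logarithm `γ`. -/
noncomputable def cauchyIntegral (r : ℝ) (φ : HatPoint → F) (κ : ℂ → ℂ) (n : ℕ) (z : ℂ)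
    (γ : ℝ → ℂ) : F :=
  (2 * Real.pi * Complex.I)⁻¹ •
    ∫ t in (0 : ℝ)..1, deriv γ t • cauchyIntegrand r φ κ n z (γ t)

variable {x₀ : ℝ} {κ : ℂ → ℂ}

lemma differentiableOn_cauchyIntegrand (hφ : IsHolOnHat d θ r φ)
    (hκ : ∀ x ∈ kernelDomain x₀, DifferentiableAt ℂ κ x) (n : ℕ) (z : ℂ) :
    DifferentiableOn ℂ (cauchyIntegrand r φ κ n z)
      (logDomain d θ r ∩ (fun ω => z * Complex.exp (-ω)) ⁻¹' kernelDomain x₀) := by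
  intro ω hω
  have h1 : DifferentiableAt ℂ (fun ω => κ (z * Complex.exp (-ω))) ω :=
    (hκ _ hω.2).comp ω (by fun_prop)
  have h2 : DifferentiableAt ℂ (fun ω => φ (logPoint r ω)) ω :=
    hφ.differentiableOn_logPoint.differentiableAt ((isOpen_logDomain d θ r).mem_nhds hω.1)
  have h3 : DifferentiableAt ℂ (fun ω : ℂ => Complex.exp (-(n * ω))) ω := by fun_prop
  exact ((h3.mul h1).smul h2).differentiableWithinAt

lemma cauchyIntegrand_add_two_pi (κ : ℂ → ℂ) (n : ℕ) (z : ℂ) {ω : ℂ} (h : ‖Complex.exp ω‖ < r) :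
    cauchyIntegrand r φ κ n z (ω + 2 * Real.pi * Complex.I) = cauchyIntegrand r φ κ n z ω := by
  have h1 : Complex.exp (-(ω + 2 * Real.pi * Complex.I)) = Complex.exp (-ω) := by
    rw [neg_add, ← sub_eq_add_neg, Complex.exp_periodic.sub_eq]
  have h2 : Complex.exp (-(n * (ω + 2 * Real.pi * Complex.I))) = Complex.exp (-(n * ω)) := by
    rw [mul_add, neg_add, ← sub_eq_add_neg, Complex.exp_periodic.sub_nat_mul_eq]
  rw [cauchyIntegrand, cauchyIntegrand, h1, h2, logPoint_add_two_pi h]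

/-- The Cauchy type integral does not depend on the admissible path. -/
lemma cauchyIntegral_eq [CompleteSpace F] (hr : 0 < r) (hφ : IsHolOnHat d θ r φ)
    (hκ : ∀ x ∈ kernelDomain x₀, DifferentiableAt ℂ κ x) (n : ℕ) {z : ℂ} {x y : ℝ → ℝ} {a : ℝ}
    (hx : IsAdmissible d θ r x₀ z x a) (hy : IsAdmissible d θ r x₀ z y a) :
    cauchyIntegral r φ κ n z (windingPath x a) = cauchyIntegral r φ κ n z (windingPath y a) := by
  -- The paths differ only in their moduli. The end contributions cancel because all intermediate
  -- paths close up inside the disc, where the integrand is `2πi`-periodic.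
  set q : ℝ → ℂ := fun t => ((y t - x t : ℝ) : ℂ) with hqdef
  have hq : ContDiff ℝ 1 q := Complex.ofRealCLM.contDiff.comp (hy.contDiff.sub hx.contDiff)
  have hp := hx.contDiff_windingPath
  have hadd : ∀ s t : ℝ, windingPath x a t + s * q t
      = windingPath (fun t => x t + s * (y t - x t)) a t := fun s t => by
    simp only [windingPath, hqdef]
    push_cast
    ring
  have hadd1 : ∀ t : ℝ, windingPath x a t + q t = windingPath y a t := fun t => by
    simp only [windingPath, hqdef]
    push_cast
    ring
  have hU : IsOpen (logDomain d θ r ∩ (fun ω => z * Complex.exp (-ω)) ⁻¹' kernelDomain x₀) :=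
    (isOpen_logDomain d θ r).inter ((isOpen_kernelDomain x₀).preimage (by fun_prop))
  have hmain := integral_eq_of_linear_homotopy hU (differentiableOn_cauchyIntegrand hφ hκ n z) hp
    hq (fun s hs t ht => by
      rw [hadd]
      have := hx.add_mul_sub hy hs
      exact ⟨this.mem_logDomain hr ht, this.mem_kernelDomain ht⟩)
    (fun s hs => by
      have h1 := hx.add_mul_sub hy hs
      have h2 : q 1 = q 0 := by simp only [hqdef, hx.ends, hy.ends]
      rw [hadd, hadd, h2]
      congr 1
      have h3 : windingPath (fun t => x t + s * (y t - x t)) a 1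
          = windingPath (fun t => x t + s * (y t - x t)) a 0 + 2 * Real.pi * Complex.I := by
        have := h1.ends
        simp only [windingPath] at this ⊢
        rw [this]
        push_cast
        ring
      rw [h3]
      refine cauchyIntegrand_add_two_pi κ n z ?_
      rw [norm_exp_lt_iff_re_lt_log hr, windingPath_re]
      exact h1.lt)
  rw [cauchyIntegral, cauchyIntegral, hmain]
  congr 1
  refine intervalIntegral.integral_congr fun t _ => ?_
  simp only [hadd1]
  congr 1
  rw [← deriv_fun_add (hp.differentiable one_ne_zero t) (hq.differentiable one_ne_zero t)]
  simp only [hadd1]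

/-! ### The inner integral -/

/-- The substitution `ξ = u / w` with `w = exp γ`: a ray of direction `α` for `u` becomes one of
direction `α - arg w` for `ξ`, and `log |ξ|` is shifted by `-log |w|`. The factor `w ^ (-(n + 1))`
comes out. -/
lemma exp_smul_innerIntegrand (e E : ℂ → ℂ) (n : ℕ) (z γ : ℂ) (α σ : ℝ) :
    Real.exp σ • innerIntegrand e E n z (Complex.exp γ) (α - γ.im) (Real.exp σ)
      = Complex.exp (-((n + 1) * γ)) * (logKernel e n (((σ + γ.re : ℝ) : ℂ) + α * Complex.I)
        * E (z * Complex.exp (-γ) * Complex.exp (((σ + γ.re : ℝ) : ℂ) + α * Complex.I))) := by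
  set v : ℂ := ((σ + γ.re : ℝ) : ℂ) + α * Complex.I with hv
  have h1 : ((Real.exp σ : ℝ) : ℂ) * Complex.exp (((α - γ.im : ℝ) : ℂ) * Complex.I)
      = Complex.exp (-γ) * Complex.exp v := by
    rw [Complex.ofReal_exp, ← Complex.exp_add, ← Complex.exp_add, hv]
    congr 1
    conv_rhs => rw [← Complex.re_add_im γ]
    push_cast
    simp only [Complex.add_re, Complex.ofReal_re, Complex.ofReal_im, Complex.mul_re,
      Complex.I_re, Complex.I_im]
    push_cast
    ring
  have h2 : Complex.exp γ * (Complex.exp (-γ) * Complex.exp v) = Complex.exp v := by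
    rw [← mul_assoc, ← Complex.exp_add, add_neg_cancel, Complex.exp_zero, one_mul]
  have h3 : Complex.exp (-((n + 1) * γ)) = Complex.exp (-γ) ^ (n + 1) := by
    rw [← Complex.exp_nat_mul]
    congr 1
    push_cast
    ring
  have h4 := Complex.exp_ne_zero v
  simp only [innerIntegrand, h1, h2, h3, logKernel, Complex.real_smul, Complex.exp_nat_mul]
  rw [← mul_assoc z]
  calc _ = (((Real.exp σ : ℝ) : ℂ) * Complex.exp (((α - γ.im : ℝ) : ℂ) * Complex.I))
        * ((Complex.exp (-γ) * Complex.exp v) ^ n * E (z * Complex.exp (-γ) * Complex.exp v)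
          * (e (Complex.exp v) / Complex.exp v)) := by ring
    _ = _ := by
        rw [h1]
        field_simp
        ring

lemma innerIntegral_eq (e E : ℂ → ℂ) (n : ℕ) (z γ : ℂ) (α : ℝ) :
    innerIntegral e E n z (Complex.exp γ) (α - γ.im)
      = Complex.exp (-((n + 1) * γ)) * ∫ s : ℝ, logKernel e n (s + α * Complex.I)
        * E (z * Complex.exp (-γ) * Complex.exp (s + α * Complex.I)) := by
  rw [innerIntegral, integral_Ioi_zero_eq_comp_exp]
  simp only [exp_smul_innerIntegrand]
  rw [integral_const_mul]
  congr 1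
  exact integral_add_right_eq_self (fun s : ℝ => logKernel e n (s + α * Complex.I)
        * E (z * Complex.exp (-γ) * Complex.exp (s + α * Complex.I))) γ.re

lemma integrableOn_innerIntegrand {e E : ℂ → ℂ} {n : ℕ} {z γ : ℂ} {α : ℝ}
    (h : Integrable fun s : ℝ => logKernel e n (s + α * Complex.I)
        * E (z * Complex.exp (-γ) * Complex.exp (s + α * Complex.I))) :
    IntegrableOn (innerIntegrand e E n z (Complex.exp γ) (α - γ.im)) (Ioi 0) := by
  rw [integrableOn_Ioi_zero_iff_comp_exp]
  simp only [exp_smul_innerIntegrand]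
  exact (h.comp_add_right γ.re).const_mul _

/-- The representation of the Cauchy type integral by iterated integrals. -/
lemma IsAdmissible.exists_direction {e E : ℂ → ℂ} {κ : ℕ → ℂ → ℂ} {W W' : ℝ} (hW : W ≤ W')
    (hr : 0 < r) (hφ : IsHolOnHat d θ r φ)
    (hκ : ∀ n, ∀ x ∈ kernelDomain x₀, DifferentiableAt ℂ (κ n) x)
    (hrep : ∀ x ∈ kernelDomain x₀, ∃ α : ℝ, |α| < W ∧ ∀ n,
        Integrable (fun s : ℝ => logKernel e n (s + α * Complex.I)
          * E (x * Complex.exp (s + α * Complex.I))) ∧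
        κ n x = ∫ s : ℝ, logKernel e n (s + α * Complex.I)
          * E (x * Complex.exp (s + α * Complex.I)))
    {z : ℂ} {x : ℝ → ℝ} {a : ℝ} (hx : IsAdmissible d θ r x₀ z x a) :
    ∃ τ : ℝ → ℝ, (∀ t ∈ Icc (0 : ℝ) 1,
        τ t ∈ Ioo (-(windingPath x a t).im - W') (-(windingPath x a t).im + W')) ∧
      ∀ n : ℕ, (∀ t ∈ Icc (0 : ℝ) 1, IntegrableOn
          (innerIntegrand e E n z (Complex.exp (windingPath x a t)) (τ t)) (Ioi 0)) ∧
        IntervalIntegrable (outerIntegrand e E r φ n z (windingPath x a) τ) volume 0 1 ∧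
        cauchyIntegral r φ (κ n) n z (windingPath x a) = (2 * Real.pi * Complex.I)⁻¹ •
          ∫ t in (0 : ℝ)..1, outerIntegrand e E r φ n z (windingPath x a) τ t := by
  have h1 : ∀ t : ℝ, ∃ α : ℝ, t ∈ Icc (0 : ℝ) 1 → |α| < W ∧ ∀ n,
      Integrable (fun s : ℝ => logKernel e n (s + α * Complex.I)
          * E (z * Complex.exp (-windingPath x a t) * Complex.exp (s + α * Complex.I))) ∧
        κ n (z * Complex.exp (-windingPath x a t))
          = ∫ s : ℝ, logKernel e n (s + α * Complex.I)
          * E (z * Complex.exp (-windingPath x a t) * Complex.exp (s + α * Complex.I)) := by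
    intro t
    by_cases ht : t ∈ Icc (0 : ℝ) 1
    · obtain ⟨α, hα⟩ := hrep _ (hx.mem_kernelDomain ht)
      exact ⟨α, fun _ => hα⟩
    · exact ⟨0, fun h => absurd h ht⟩
  choose α hα using h1
  have hp := hx.contDiff_windingPath
  have hI : uIcc (0 : ℝ) 1 = Icc 0 1 := uIcc_of_le zero_le_one
  refine ⟨fun t => α t - (windingPath x a t).im, fun t ht => ?_, fun n =>
    ⟨fun t ht => integrableOn_innerIntegrand ((hα t ht).2 n).1, ?_⟩⟩
  · have := abs_lt.1 ((hα t ht).1.trans_le hW)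
    exact ⟨by linarith, by linarith⟩
  -- The directions are chosen pointwise, without any regularity in `t`. Integrability still holds
  -- because the outer integrand coincides on `[0, 1]` with the continuous integrand built from `κ`.
  have heq : EqOn (fun t => deriv (windingPath x a) t •
      cauchyIntegrand r φ (κ n) n z (windingPath x a t))
      (outerIntegrand e E r φ n z (windingPath x a) fun t => α t - (windingPath x a t).im)
      (Icc 0 1) := by
    intro t ht
    simp only [outerIntegrand, cauchyIntegrand, innerIntegral_eq, ← ((hα t ht).2 n).2, smul_smul]
    congr 1
    have : Complex.exp (-((n + 1) * windingPath x a t)) * Complex.exp (windingPath x a t)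
        = Complex.exp (-(n * windingPath x a t)) := by
      rw [← Complex.exp_add]
      congr 1
      ring
    rw [← this]
    ring
  have hcont : ContinuousOn (fun t => deriv (windingPath x a) t •
      cauchyIntegrand r φ (κ n) n z (windingPath x a t)) (Icc 0 1) := by
    refine (hp.continuous_deriv le_rfl).continuousOn.smul ?_
    exact (differentiableOn_cauchyIntegrand hφ (hκ n) n z).continuousOn.comp hp.continuous.continuousOn
      fun t ht => ⟨hx.mem_logDomain hr ht, hx.mem_kernelDomain ht⟩
  refine ⟨ContinuousOn.intervalIntegrable (by rw [hI]; exact hcont.congr heq.symm), ?_⟩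
  rw [cauchyIntegral, intervalIntegral.integral_congr (by rwa [hI])]

end Paths

/-! ### Holomorphy of the Cauchy type integral in `log z` and its Taylor series at the origin -/

section MomentIntegral

variable {F : Type*} [NormedAddCommGroup F] [NormedSpace ℂ F]
variable {d θ r x₀ : ℝ} {φ : HatPoint → F} {κ : ℂ → ℂ}

/-- For a fixed shape `u` the path attached to `z = exp ζ` is the translate by `ζ` of one fixed
path. Starting at the argument `Im ζ - π` places the direction of `z` at `t = 1 / 2`. -/
lemma windingPath_translate (ζ : ℂ) (u : ℝ → ℝ) :
    windingPath (fun t => ζ.re + u t) (ζ.im - Real.pi)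
      = fun t => ζ + windingPath u (-Real.pi) t := by
  funext t
  apply Complex.ext
  · simp
  · simp
    ring

/-- Along the translated path the quotient `z / w` no longer involves `ζ`, so the kernel condition
constrains the shape `u` only. The remaining conditions on `ζ` are open, uniformly on the compact
interval, which gives stability under small changes of `ζ`. -/
lemma isAdmissible_exp_iff (ζ : ℂ) (u : ℝ → ℝ) :
    IsAdmissible d θ r x₀ (Complex.exp ζ) (fun t => ζ.re + u t) (ζ.im - Real.pi) ↔
      ContDiff ℝ 1 u ∧ u 0 = u 1 ∧ ζ.re + u 0 < Real.log r ∧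
      (∀ t ∈ Icc (0 : ℝ) 1, ζ.re + u t < Real.log r ∨
        |ζ.im - Real.pi + 2 * Real.pi * t - d| < θ / 2) ∧
      ∀ t ∈ Icc (0 : ℝ) 1, Real.exp (-u t) < x₀ ∨
        -Complex.exp (((Real.pi - 2 * Real.pi * t : ℝ) : ℂ) * Complex.I) ∈ Complex.slitPlane := by
  have h1 : ∀ t, ‖Complex.exp ζ‖ * Real.exp (-(ζ.re + u t)) = Real.exp (-u t) := fun t => by
    rw [Complex.norm_exp, ← Real.exp_add]
    congr 1
    ring
  have h2 : ∀ t : ℝ, -(Complex.exp ζ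
        * Complex.exp (-(((ζ.im - Real.pi + 2 * Real.pi * t : ℝ) : ℂ) * Complex.I)))
      = ((Real.exp ζ.re : ℝ) : ℂ)
        * -Complex.exp (((Real.pi - 2 * Real.pi * t : ℝ) : ℂ) * Complex.I) := fun t => by
    rw [mul_neg, Complex.ofReal_exp, ← Complex.exp_add, ← Complex.exp_add]
    congr 2
    apply Complex.ext
    · simp
    · simp
      ring
  have h3 : ∀ t : ℝ, -(Complex.exp ζ
        * Complex.exp (-(((ζ.im - Real.pi + 2 * Real.pi * t : ℝ) : ℂ) * Complex.I)))
        ∈ Complex.slitPlane ↔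
      -Complex.exp (((Real.pi - 2 * Real.pi * t : ℝ) : ℂ) * Complex.I) ∈ Complex.slitPlane := by
    intro t
    rw [h2]
    refine ⟨fun h => ?_, ofReal_mul_mem_slitPlane (Real.exp_pos _)⟩
    have h4 := ofReal_mul_mem_slitPlane (Real.exp_pos (-ζ.re)) h
    rwa [← mul_assoc, ← Complex.ofReal_mul, ← Real.exp_add, neg_add_cancel, Real.exp_zero,
      Complex.ofReal_one, one_mul] at h4
  constructor
  · rintro ⟨a1, a2, a3, a4, a5⟩
    refine ⟨?_, by simpa using a2, a3, a4, fun t ht => ?_⟩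
    · simpa using a1.sub (contDiff_const (c := ζ.re))
    · simpa only [h1, h3] using a5 t ht
  · rintro ⟨a1, a2, a3, a4, a5⟩
    refine ⟨by fun_prop, by simpa using a2, a3, a4, fun t ht => ?_⟩
    simpa only [h1, h3] using a5 t ht

lemma eventually_isAdmissible_exp {ζ : ℂ} {u : ℝ → ℝ}
    (h : IsAdmissible d θ r x₀ (Complex.exp ζ) (fun t => ζ.re + u t) (ζ.im - Real.pi)) :
    ∀ᶠ ζ' in 𝓝 ζ,
      IsAdmissible d θ r x₀ (Complex.exp ζ') (fun t => ζ'.re + u t) (ζ'.im - Real.pi) := by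
  obtain ⟨a1, a2, a3, a4, a5⟩ := (isAdmissible_exp_iff ζ u).1 h
  have hu := a1.continuous
  have h1 : ∀ᶠ ζ' : ℂ in 𝓝 ζ, ζ'.re + u 0 < Real.log r :=
    (isOpen_lt (Complex.continuous_re.add continuous_const) continuous_const).mem_nhds a3
  have h2 : ∀ᶠ ζ' : ℂ in 𝓝 ζ, ∀ t ∈ Icc (0 : ℝ) 1, ζ'.re + u t < Real.log r ∨
        |ζ'.im - Real.pi + 2 * Real.pi * t - d| < θ / 2 := by
    refine isCompact_Icc.eventually_forall_of_forall_eventually fun t ht => ?_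
    have ho1 : IsOpen {p : ℂ × ℝ | p.1.re + u p.2 < Real.log r} :=
      isOpen_lt (by fun_prop) continuous_const
    have ho2 : IsOpen {p : ℂ × ℝ | |p.1.im - Real.pi + 2 * Real.pi * p.2 - d| < θ / 2} :=
      isOpen_lt (by fun_prop) continuous_const
    exact (ho1.union ho2).mem_nhds (a4 t ht)
  filter_upwards [h1, h2] with ζ' h3 h4
  exact (isAdmissible_exp_iff ζ' u).2 ⟨a1, a2, h3, h4, a5⟩

lemma differentiableAt_cauchyIntegral [CompleteSpace F] (hr : 0 < r) (hφ : IsHolOnHat d θ r φ)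
    (hκ : ∀ x ∈ kernelDomain x₀, DifferentiableAt ℂ κ x) (n : ℕ) {ζ : ℂ} {u : ℝ → ℝ}
    (h : IsAdmissible d θ r x₀ (Complex.exp ζ) (fun t => ζ.re + u t) (ζ.im - Real.pi)) :
    DifferentiableAt ℂ (fun ζ : ℂ => cauchyIntegral r φ κ n (Complex.exp ζ)
      (windingPath (fun t => ζ.re + u t) (ζ.im - Real.pi))) ζ := by
  set η : ℝ → ℂ := windingPath u (-Real.pi) with hη
  have huC : ContDiff ℝ 1 u := ((isAdmissible_exp_iff ζ u).1 h).1
  have hηC : ContDiff ℝ 1 η := by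
    have h1 := h.contDiff_windingPath
    rw [windingPath_translate] at h1
    simpa using h1.sub (contDiff_const (c := ζ))
  have hη' : Continuous (deriv η) := hηC.continuous_deriv le_rfl
  have hηc := hηC.continuous
  -- In the moving frame `κ` is evaluated at points independent of `ζ`; the dependence on `ζ` sits
  -- in `w ^ (-n)` and in `φ`.
  set G : ℂ → ℝ → F := fun ζ t => deriv η t • ((Complex.exp (-(n * (ζ + η t)))
    * κ (Complex.exp (-η t))) • φ (logPoint r (ζ + η t))) with hG
  have hexp : ∀ (ζ : ℂ) t, Complex.exp ζ * Complex.exp (-(ζ + η t)) = Complex.exp (-η t) :=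
    fun ζ t => by
      rw [← Complex.exp_add]
      congr 1
      ring
  have hrew : ∀ ζ : ℂ, cauchyIntegral r φ κ n (Complex.exp ζ)
      (windingPath (fun t => ζ.re + u t) (ζ.im - Real.pi))
      = (2 * Real.pi * Complex.I)⁻¹ • ∫ t in Ioc (0 : ℝ) 1, G ζ t := by
    intro ζ
    rw [windingPath_translate, cauchyIntegral, intervalIntegral.integral_of_le zero_le_one]
    simp only [cauchyIntegrand, ← hη, hexp, deriv_const_add', hG]
  obtain ⟨R, hR, hball⟩ := Metric.eventually_nhds_iff_ball.1 (eventually_isAdmissible_exp h)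
  have hmem : ∀ ζ' ∈ Metric.ball ζ R, ∀ t ∈ Icc (0 : ℝ) 1,
      ζ' + η t ∈ logDomain d θ r ∧ Complex.exp (-η t) ∈ kernelDomain x₀ := by
    intro ζ' hζ' t ht
    have h1 := (hball ζ' hζ').mem_logDomain hr ht
    have h2 := (hball ζ' hζ').mem_kernelDomain ht
    rw [windingPath_translate] at h1 h2
    rw [hexp] at h2
    exact ⟨h1, h2⟩
  have hκc : ContinuousOn (fun t => κ (Complex.exp (-η t))) (Icc 0 1) := by
    have h1 : ContinuousOn κ (kernelDomain x₀) := fun x hx =>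
      (hκ x hx).continuousAt.continuousWithinAt
    exact h1.comp (by fun_prop) fun t ht => (hmem ζ (Metric.mem_ball_self hR) t ht).2
  have hGc : ContinuousOn (Function.uncurry G) (Metric.ball ζ R ×ˢ Icc 0 1) := by
    have h1 : ContinuousOn (fun p : ℂ × ℝ => φ (logPoint r (p.1 + η p.2)))
        (Metric.ball ζ R ×ˢ Icc 0 1) :=
      hφ.differentiableOn_logPoint.continuousOn.comp (f := fun p : ℂ × ℝ => p.1 + η p.2)
        (by fun_prop) fun p hp => (hmem p.1 hp.1 p.2 hp.2).1
    have h2 : ContinuousOn (fun p : ℂ × ℝ => κ (Complex.exp (-η p.2)))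
        (Metric.ball ζ R ×ˢ Icc 0 1) :=
      hκc.comp (f := fun p : ℂ × ℝ => p.2) continuousOn_snd fun p hp => hp.2
    refine ContinuousOn.smul (by fun_prop) (ContinuousOn.smul (ContinuousOn.mul ?_ h2) h1)
    exact Continuous.continuousOn (by fun_prop)
  have hsub : Metric.closedBall ζ (R / 2) ⊆ Metric.ball ζ R :=
    Metric.closedBall_subset_ball (by linarith)
  obtain ⟨C, hC⟩ := ((isCompact_closedBall ζ (R / 2)).prod (isCompact_Icc (a := (0 : ℝ))
    (b := 1))).exists_bound_of_continuousOn (hGc.mono (prod_mono hsub subset_rfl))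
  simp only [hrew]
  refine DifferentiableAt.const_smul ?_ _
  refine differentiableAt_integral_of_dominated (R := R / 2) (by linarith) (g := fun _ => C)
    (fun ζ' hζ' => ?_) ?_ (integrable_const C) ?_
  · have h1 : ContinuousOn (G ζ') (Icc 0 1) := hGc.comp (f := fun t => (ζ', t)) (by fun_prop)
      fun t ht => ⟨hsub (Metric.ball_subset_closedBall hζ'), ht⟩
    exact (h1.mono Ioc_subset_Icc_self).aestronglyMeasurable measurableSet_Ioc
  · filter_upwards [ae_restrict_mem measurableSet_Ioc] with t ht ζ' hζ'
    have h1 : DifferentiableAt ℂ (fun ω => φ (logPoint r ω)) (ζ' + η t) :=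
      hφ.differentiableOn_logPoint.differentiableAt ((isOpen_logDomain d θ r).mem_nhds
        (hmem ζ' (hsub (Metric.ball_subset_closedBall hζ')) t (Ioc_subset_Icc_self ht)).1)
    have h2 : DifferentiableAt ℂ (fun ζ => φ (logPoint r (ζ + η t))) ζ' :=
      h1.comp (f := fun ζ : ℂ => ζ + η t) ζ' (differentiableAt_id.add_const _)
    have h3 : DifferentiableAt ℂ (fun ζ => Complex.exp (-(n * (ζ + η t)))
      * κ (Complex.exp (-η t))) ζ' := by fun_prop
    exact ((h3.smul h2).const_smul (deriv η t)).differentiableWithinAt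
  · filter_upwards [ae_restrict_mem measurableSet_Ioc] with t ht ζ' hζ'
    exact hC (ζ', t) ⟨Metric.ball_subset_closedBall hζ', Ioc_subset_Icc_self ht⟩

/-! ### Circles -/

lemma isAdmissible_const {z : ℂ} {L a : ℝ} (hL : L < Real.log r)
    (hz : ‖z‖ * Real.exp (-L) < x₀) : IsAdmissible d θ r x₀ z (fun _ => L) a :=
  ⟨contDiff_const, rfl, hL, fun _ _ => Or.inl hL, fun _ _ => Or.inl hz⟩

lemma windingPath_const_add (L a t : ℝ) : windingPath (fun _ => L) a t
    = windingPath (fun _ => L) 0 (t + a / (2 * Real.pi)) := by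
  apply Complex.ext
  · simp
  · simp
    field_simp
    ring

lemma deriv_windingPath_const (L a t : ℝ) :
    deriv (windingPath (fun _ => L) a) t = 2 * Real.pi * Complex.I := by
  have h1 : HasDerivAt (fun t : ℝ => a + 2 * Real.pi * t) (2 * Real.pi) t := by
    simpa using ((hasDerivAt_id t).const_mul (2 * Real.pi)).const_add a
  have h2 := (h1.ofReal_comp.mul_const Complex.I).const_add (L : ℂ)
  refine (h2.congr_deriv ?_ : HasDerivAt (windingPath (fun _ => L) a) _ t).deriv
  push_cast
  ring

lemma cauchyIntegral_const (r : ℝ) (φ : HatPoint → F) (κ : ℂ → ℂ) (n : ℕ) (z : ℂ) (L a : ℝ) :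
    cauchyIntegral r φ κ n z (windingPath (fun _ => L) a)
      = ∫ t in (0 : ℝ)..1, cauchyIntegrand r φ κ n z (windingPath (fun _ => L) a t) := by
  simp only [cauchyIntegral, deriv_windingPath_const]
  rw [intervalIntegral.integral_smul, inv_smul_smul₀ Complex.two_pi_I_ne_zero]

/-- On a circle the starting point is irrelevant. -/
lemma cauchyIntegral_const_eq (hr : 0 < r) (φ : HatPoint → F) (κ : ℂ → ℂ) (n : ℕ) (z : ℂ)
    {L : ℝ} (hL : L < Real.log r) (a : ℝ) :
    cauchyIntegral r φ κ n z (windingPath (fun _ => L) a)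
      = cauchyIntegral r φ κ n z (windingPath (fun _ => L) 0) := by
  rw [cauchyIntegral_const, cauchyIntegral_const]
  simp only [windingPath_const_add L a]
  have hper : Function.Periodic
      (fun t => cauchyIntegrand r φ κ n z (windingPath (fun _ => L) 0 t)) 1 := by
    intro t
    have h1 : windingPath (fun _ => L) 0 (t + 1)
        = windingPath (fun _ => L) 0 t + 2 * Real.pi * Complex.I := by
      simp only [windingPath]
      push_cast
      ring
    simp only [h1]
    refine cauchyIntegrand_add_two_pi κ n z ?_
    rwa [norm_exp_lt_iff_re_lt_log hr, windingPath_re]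
  rw [intervalIntegral.integral_comp_add_right
    (fun t => cauchyIntegrand r φ κ n z (windingPath (fun _ => L) 0 t)), zero_add, add_comm (1 : ℝ)]
  simpa using hper.intervalIntegral_add_eq (a / (2 * Real.pi)) 0

lemma integral_exp_neg_smul_eq_taylorCoeffs [CompleteSpace F] (hφ : IsHolOnHat d θ r φ) {L : ℝ}
    (hr : 0 < r) (hL : L < Real.log r) (q : ℕ) :
    ∫ t in (0 : ℝ)..1, Complex.exp (-(q * windingPath (fun _ => L) 0 t))
      • φ (.disc (Complex.exp (windingPath (fun _ => L) 0 t))) = taylorCoeffs φ q := by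
  have hLr : Real.exp L < r := (Real.lt_log_iff_exp_lt hr).1 hL
  have h1 := (hφ.disc.diffContOnCl_ball (c := 0) (R := Real.exp L)
    (Metric.closedBall_subset_ball hLr)).circleIntegral_one_div_sub_center_pow_smul
      (Real.exp_pos L) q
  have h2 := intervalIntegral.integral_comp_mul_left (a := 0) (b := 1)
    (fun θ : ℝ => deriv (circleMap 0 (Real.exp L)) θ • (1 / (circleMap 0 (Real.exp L) θ - 0) ^ (q + 1))
      • φ (.disc (circleMap 0 (Real.exp L) θ))) (c := 2 * Real.pi) (by positivity)
  rw [circleIntegral] at h1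
  rw [mul_zero, mul_one, h1] at h2
  have h3 : ∀ t : ℝ, circleMap 0 (Real.exp L) (2 * Real.pi * t)
      = Complex.exp (windingPath (fun _ => L) 0 t) := fun t => by
    rw [circleMap, windingPath, Complex.exp_add, zero_add, Complex.ofReal_exp, zero_add]
  have h4 : ∀ t : ℝ, deriv (circleMap 0 (Real.exp L)) (2 * Real.pi * t)
      • (1 / (circleMap 0 (Real.exp L) (2 * Real.pi * t) - 0) ^ (q + 1))
      • φ (.disc (circleMap 0 (Real.exp L) (2 * Real.pi * t)))
      = Complex.I • (Complex.exp (-(q * windingPath (fun _ => L) 0 t))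
      • φ (.disc (Complex.exp (windingPath (fun _ => L) 0 t)))) := fun t => by
    rw [deriv_circleMap, h3, smul_smul, smul_smul, sub_zero]
    congr 1
    have := Complex.exp_ne_zero (windingPath (fun _ => L) 0 t)
    rw [Complex.exp_neg, Complex.exp_nat_mul, pow_succ]
    field_simp
  simp only [h4] at h2
  rw [intervalIntegral.integral_smul] at h2
  have h5 := congrArg (fun v => Complex.I⁻¹ • v) h2
  simp only [inv_smul_smul₀ Complex.I_ne_zero] at h5
  rw [h5, taylorCoeffs, ← Complex.coe_smul, smul_smul, smul_smul]
  congr 1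
  have := Real.pi_ne_zero
  have hπ : (Real.pi : ℂ) ≠ 0 := by exact_mod_cast this
  push_cast
  field_simp

/-- The Cauchy type integral over a circle is the sum of the moment derivative series. -/
lemma hasSum_cauchyIntegral_const [CompleteSpace F] (hr : 0 < r) (hφ : IsHolOnHat d θ r φ)
    {m : ℕ → ℝ} (n : ℕ)
    (hκ : ∀ x : ℂ, ‖x‖ < x₀ → HasSum (fun p => ((m (n + p) / m p : ℝ) : ℂ) * x ^ p) (κ x))
    {L : ℝ} (hL : L < Real.log r) {z : ℂ} (hz : ‖z‖ * Real.exp (-L) < x₀) :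
    HasSum (fun p => z ^ p • (((m (n + p) / m p : ℝ) : ℂ) • taylorCoeffs φ (n + p)))
      (cauchyIntegral r φ κ n z (windingPath (fun _ => L) 0)) := by
  set w : ℝ → ℂ := windingPath (fun _ => L) 0 with hw
  have hwc : Continuous w := by
    rw [hw]
    unfold windingPath
    fun_prop
  have hwlt : ∀ t, ‖Complex.exp (w t)‖ < r := fun t => by
    rw [norm_exp_lt_iff_re_lt_log hr, hw, windingPath_re]
    exact hL
  have hφc : Continuous fun t => φ (.disc (Complex.exp (w t))) :=
    hφ.disc.continuousOn.comp_continuous (f := fun t => Complex.exp (w t)) (by fun_prop)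
      fun t => by simpa using hwlt t
  obtain ⟨K, hK⟩ := (isCompact_Icc (a := (0 : ℝ)) (b := 1)).exists_bound_of_continuousOn
    hφc.continuousOn
  have hnorm : ∀ (q : ℕ) t, ‖Complex.exp (-(q * w t))‖ = Real.exp (-L) ^ q := fun q t => by
    rw [Complex.norm_exp, ← Real.exp_nat_mul]
    simp [hw]
  -- On the circle `|z / w|` is constant, so the series of `κ` at this single real point dominates
  -- all the others.
  have hx : ‖((‖z‖ * Real.exp (-L) : ℝ) : ℂ)‖ < x₀ := by
    rwa [Complex.norm_real, Real.norm_of_nonneg (by positivity)]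
  have hsum := (hκ _ hx).summable.norm
  have hI : uIoc (0 : ℝ) 1 ⊆ Icc 0 1 := by
    rw [uIoc_of_le zero_le_one]
    exact Ioc_subset_Icc_self
  have key := intervalIntegral.hasSum_integral_of_dominated_convergence (μ := volume)
    (a := (0 : ℝ)) (b := 1)
    (F := fun p t => (z ^ p * ((m (n + p) / m p : ℝ) : ℂ))
      • (Complex.exp (-((n + p : ℕ) * w t)) • φ (.disc (Complex.exp (w t)))))
    (f := fun t => cauchyIntegrand r φ κ n z (w t))
    (fun p _ => ‖((m (n + p) / m p : ℝ) : ℂ) * ((‖z‖ * Real.exp (-L) : ℝ) : ℂ) ^ p‖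
      * (Real.exp (-L) ^ n * K))
    (fun p => Continuous.aestronglyMeasurable
      (continuous_const.smul (Continuous.smul (by fun_prop) hφc)))
    (fun p => ae_of_all _ fun t ht => ?_)
    (ae_of_all _ fun t _ => hsum.mul_right _) intervalIntegrable_const
    (ae_of_all _ fun t ht => ?_)
  · rw [cauchyIntegral_const]
    refine key.congr_fun fun p => ?_
    rw [intervalIntegral.integral_smul, integral_exp_neg_smul_eq_taylorCoeffs hφ hr hL, smul_smul]
  · rw [norm_smul, norm_smul, hnorm, norm_mul, norm_mul, norm_pow, norm_pow, Complex.norm_real (_ * _),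
      Real.norm_of_nonneg (by positivity : 0 ≤ ‖z‖ * Real.exp (-L)), mul_pow]
    calc _ ≤ ‖z‖ ^ p * ‖((m (n + p) / m p : ℝ) : ℂ)‖ * (Real.exp (-L) ^ (n + p) * K) := by
          gcongr
          exact hK t (hI ht)
      _ = _ := by ring
  · have h1 : ‖z * Complex.exp (-w t)‖ < x₀ := by
      rw [norm_mul, Complex.norm_exp]
      simpa [hw] using hz
    have h2 := ((hκ _ h1).mul_left (Complex.exp (-(n * w t)))).smul_const
      (φ (logPoint r (w t)))
    rw [cauchyIntegrand]
    refine h2.congr_fun fun p => ?_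
    rw [logPoint_of_norm_lt (hwlt t), smul_smul]
    congr 1
    have h3 : Complex.exp (-((n + p : ℕ) * w t))
        = Complex.exp (-(n * w t)) * Complex.exp (-w t) ^ p := by
      rw [← Complex.exp_nat_mul, ← Complex.exp_add]
      congr 1
      push_cast
      ring
    rw [h3, mul_pow]
    ring

/-! ### Moment derivatives of Taylor coefficients -/

lemma momentDeriv_iterate {m : ℕ → ℝ} (hm : ∀ p, 0 < m p) (a : ℕ → F) (n p : ℕ) :
    (momentDeriv m)^[n] a p = ((m (n + p) / m p : ℝ) : ℂ) • a (n + p) := by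
  induction n generalizing p with
  | zero =>
    rw [Function.iterate_zero, id, zero_add, div_self (hm p).ne', Complex.ofReal_one, one_smul]
  | succ n ih =>
    rw [Function.iterate_succ_apply', momentDeriv, ih, smul_smul, smul_smul,
      show n + (p + 1) = n + 1 + p by ring]
    congr 1
    have h1 : (m p : ℂ) ≠ 0 := by exact_mod_cast (hm p).ne'
    have h2 : (m (p + 1) : ℂ) ≠ 0 := by exact_mod_cast (hm (p + 1)).ne'
    push_cast
    field_simp

end MomentIntegral

/-! ### Paths pushed outwards near the direction of `z`, and the resulting estimates -/

section Bump

variable {F : Type*} [NormedAddCommGroup F] [NormedSpace ℂ F]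
variable {d θ r x₀ : ℝ} {φ : HatPoint → F} {κ : ℂ → ℂ}

/-- A path depth that equals `lo` away from `t = 1 / 2` and `hi` near `t = 1 / 2`. -/
noncomputable def bumpDepth (f : ContDiffBump (1 / 2 : ℝ)) (lo hi t : ℝ) : ℝ :=
  lo + (hi - lo) * f t

lemma exp_mem_slitPlane {v : ℝ} (hv : |v| < Real.pi) :
    Complex.exp (v * Complex.I) ∈ Complex.slitPlane ∧ (Complex.exp (v * Complex.I)).arg = v := by
  have h := abs_lt.1 hv
  have harg : (Complex.exp (v * Complex.I)).arg = v := by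
    rw [Complex.arg_exp_mul_I, toIocMod_eq_self]
    exact ⟨h.1, by linarith⟩
  refine ⟨?_, harg⟩
  rw [Complex.mem_slitPlane_iff_arg, harg]
  exact ⟨h.2.ne, Complex.exp_ne_zero _⟩

/-- The unit vector is the direction of `z / w` at time `t`. It meets the cut `[0, ∞)` only at `t =
1 / 2`, and its angular distance from the cut is `2π |t - 1/2|`. -/
lemma neg_exp_mem_slitPlane {t : ℝ} (ht : t ∈ Icc (0 : ℝ) 1) (h : t ≠ 1 / 2) :
    -Complex.exp (((Real.pi - 2 * Real.pi * t : ℝ) : ℂ) * Complex.I) ∈ Complex.slitPlane ∧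
      |(-Complex.exp (((Real.pi - 2 * Real.pi * t : ℝ) : ℂ) * Complex.I)).arg|
        = Real.pi - 2 * Real.pi * |t - 1 / 2| := by
  have hπ := Real.pi_pos
  rcases lt_or_gt_of_ne h with h | h
  · have h1 : -Complex.exp (((Real.pi - 2 * Real.pi * t : ℝ) : ℂ) * Complex.I)
        = Complex.exp (((-(2 * Real.pi * t) : ℝ) : ℂ) * Complex.I) := by
      rw [Complex.ofReal_sub, sub_mul, sub_eq_add_neg, Complex.exp_add, Complex.exp_pi_mul_I,
        Complex.ofReal_neg, neg_mul]
      ring_nf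
    have h2 : |-(2 * Real.pi * t)| = 2 * Real.pi * t := by
      rw [abs_neg, abs_of_nonneg (mul_nonneg (by positivity) ht.1)]
    have h3 := exp_mem_slitPlane (v := -(2 * Real.pi * t)) (by rw [h2]; nlinarith)
    rw [h1, h3.2, h2, abs_of_neg (by linarith)]
    exact ⟨h3.1, by ring⟩
  · have h1 : -Complex.exp (((Real.pi - 2 * Real.pi * t : ℝ) : ℂ) * Complex.I)
        = Complex.exp (((2 * Real.pi * (1 - t) : ℝ) : ℂ) * Complex.I) := by
      have : (((2 * Real.pi * (1 - t) : ℝ) : ℂ) * Complex.I)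
          = ((Real.pi - 2 * Real.pi * t : ℝ) : ℂ) * Complex.I + Real.pi * Complex.I := by
        push_cast
        ring
      rw [this, Complex.exp_add, Complex.exp_pi_mul_I]
      ring
    have h2 : |2 * Real.pi * (1 - t)| = 2 * Real.pi * (1 - t) :=
      abs_of_nonneg (mul_nonneg (by positivity) (by linarith [ht.2]))
    have h3 := exp_mem_slitPlane (v := 2 * Real.pi * (1 - t)) (by rw [h2]; nlinarith)
    rw [h1, h3.2, h2, abs_of_pos (by linarith)]
    exact ⟨h3.1, by ring⟩

lemma abs_im_windingPath_sub_le (ζ : ℂ) (d t : ℝ) :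
    |ζ.im - Real.pi + 2 * Real.pi * t - d| ≤ |ζ.im - d| + 2 * Real.pi * |t - 1 / 2| := by
  have h : ζ.im - Real.pi + 2 * Real.pi * t - d = (ζ.im - d) + 2 * Real.pi * (t - 1 / 2) := by ring
  rw [h]
  refine (abs_add_le _ _).trans (le_of_eq ?_)
  rw [abs_mul, abs_of_pos (by positivity : 0 < 2 * Real.pi)]

lemma contDiff_bumpDepth (f : ContDiffBump (1 / 2 : ℝ)) (lo hi : ℝ) :
    ContDiff ℝ 1 (bumpDepth f lo hi) := by
  have h : ContDiff ℝ 1 f := f.contDiff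
  exact contDiff_const.add (contDiff_const.mul h)

lemma bumpDepth_of_le (f : ContDiffBump (1 / 2 : ℝ)) (lo hi : ℝ) {t : ℝ}
    (h : f.rOut ≤ |t - 1 / 2|) : bumpDepth f lo hi t = lo := by
  rw [bumpDepth, f.zero_of_le_dist (by rwa [Real.dist_eq]), mul_zero, add_zero]

lemma bumpDepth_of_ge (f : ContDiffBump (1 / 2 : ℝ)) (lo hi : ℝ) {t : ℝ}
    (h : |t - 1 / 2| ≤ f.rIn) : bumpDepth f lo hi t = hi := by
  rw [bumpDepth, f.one_of_mem_closedBall (by rwa [Metric.mem_closedBall, Real.dist_eq]), mul_one,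
    add_sub_cancel]

/-- Off the support of the bump the path stays in the disc; on the support its argument is so close
to `Im ζ` that it stays in the sector. At `t = 1 / 2`, the only dangerous time, the height `hi`
brings `z / w` into the disc of convergence of the kernel. -/
lemma isAdmissible_bumpDepth (f : ContDiffBump (1 / 2 : ℝ)) {ζ : ℂ} {lo hi : ℝ}
    (hf : |ζ.im - d| + 2 * Real.pi * f.rOut < θ / 2) (hout : f.rOut ≤ 1 / 4)
    (hlo : ζ.re + lo < Real.log r) (hhi : Real.exp (-hi) < x₀) :
    IsAdmissible d θ r x₀ (Complex.exp ζ) (fun t => ζ.re + bumpDepth f lo hi t)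
      (ζ.im - Real.pi) := by
  have h0 : bumpDepth f lo hi 0 = lo := bumpDepth_of_le f lo hi (by norm_num; linarith)
  have h1 : bumpDepth f lo hi 1 = lo := bumpDepth_of_le f lo hi (by norm_num; linarith)
  refine (isAdmissible_exp_iff ζ _).2 ⟨contDiff_bumpDepth f lo hi, by rw [h0, h1], by rwa [h0],
    fun t _ => ?_, fun t ht => ?_⟩
  · rcases le_or_gt f.rOut |t - 1 / 2| with h | h
    · exact Or.inl (by rwa [bumpDepth_of_le f lo hi h])
    · refine Or.inr ((abs_im_windingPath_sub_le ζ d t).trans_lt (lt_trans ?_ hf))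
      have := Real.pi_pos
      gcongr
  · by_cases h : t = 1 / 2
    · refine Or.inl ?_
      rwa [bumpDepth_of_ge f lo hi (by rw [h]; simpa using f.rIn_pos.le)]
    · exact Or.inr (neg_exp_mem_slitPlane ht h).1

/-- A bump function on `[0, 1]` centred at `1 / 2` with small support. -/
lemma exists_bump {ε : ℝ} (hε : 0 < ε) : ∃ f : ContDiffBump (1 / 2 : ℝ),
    f.rOut ≤ 1 / 4 ∧ 2 * Real.pi * f.rOut ≤ ε := by
  have hπ := Real.pi_pos
  have h : 0 < min (1 / 4) (ε / (2 * Real.pi)) := lt_min (by norm_num) (by positivity)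
  refine ⟨⟨min (1 / 4) (ε / (2 * Real.pi)) / 2, min (1 / 4) (ε / (2 * Real.pi)), by positivity,
    by linarith⟩, min_le_left _ _, ?_⟩
  have := min_le_right (1 / 4) (ε / (2 * Real.pi))
  rw [le_div_iff₀ (by positivity)] at this
  linarith

lemma norm_cauchyIntegral_le {n : ℕ} {z : ℂ} {γ : ℝ → ℂ} {K : ℝ}
    (h : ∀ t ∈ Icc (0 : ℝ) 1, ‖deriv γ t • cauchyIntegrand r φ κ n z (γ t)‖ ≤ K) :
    ‖cauchyIntegral r φ κ n z γ‖ ≤ K := by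
  have hK : 0 ≤ K := (norm_nonneg _).trans (h 0 (by simp))
  have h1 := intervalIntegral.norm_integral_le_of_norm_le_const (a := (0 : ℝ)) (b := 1) (C := K)
    (f := fun t => deriv γ t • cauchyIntegrand r φ κ n z (γ t)) fun t ht => h t (by
      rw [uIoc_of_le zero_le_one] at ht
      exact Ioc_subset_Icc_self ht)
  have h2 : ‖(2 * Real.pi * Complex.I : ℂ)⁻¹‖ ≤ 1 := by
    rw [norm_inv]
    refine inv_le_one_of_one_le₀ ?_
    simp only [norm_mul, Complex.norm_I, Complex.norm_ofNat, Complex.norm_real, mul_one]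
    rw [Real.norm_of_nonneg Real.pi_pos.le]
    linarith [Real.pi_gt_three]
  rw [cauchyIntegral, norm_smul]
  calc _ ≤ 1 * (K * |1 - 0|) := by gcongr
    _ = K := by simp

/-- Bound for the integrand of the Cauchy type integral at a point of modulus at least `ρ`. -/
lemma norm_cauchyIntegrand_le {n : ℕ} {z ω : ℂ} {ρ K P : ℝ} (hρ : 0 < ρ)
    (hω : Real.log ρ ≤ ω.re) (hK : ‖κ (z * Complex.exp (-ω))‖ ≤ K)
    (hP : ‖φ (logPoint r ω)‖ ≤ P) :
    ‖cauchyIntegrand r φ κ n z ω‖ ≤ (1 / ρ) ^ n * K * P := by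
  have h1 : ‖Complex.exp (-(n * ω))‖ ≤ (1 / ρ) ^ n := by
    have : (1 / ρ) = Real.exp (-Real.log ρ) := by
      rw [Real.exp_neg, Real.exp_log hρ, one_div]
    rw [Complex.norm_exp, this, ← Real.exp_nat_mul, Real.exp_le_exp]
    simp only [Complex.neg_re, Complex.mul_re, Complex.natCast_re, Complex.natCast_im, zero_mul,
      sub_zero]
    have := mul_le_mul_of_nonneg_left hω (Nat.cast_nonneg (α := ℝ) n)
    linarith
  have h2 : 0 ≤ K := (norm_nonneg _).trans hK
  rw [cauchyIntegrand, norm_smul, norm_mul]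
  gcongr

/-- Growth of the Cauchy type integral in the sector. -/
lemma exists_norm_cauchyIntegral_bump_le {Mt m : ℕ → ℝ} (hMt : StronglyRegular Mt)
    (hm : ∀ p, 0 < m p) {κ : ℕ → ℂ → ℂ}
    (hκ : ∀ δ : ℝ, 0 < δ → ∃ C B : ℝ, 0 < C ∧ 0 < B ∧ ∀ n x,
        (‖x‖ < x₀ ∨ (-x ∈ Complex.slitPlane ∧ |(-x).arg| ≤ Real.pi - δ)) →
          ‖κ n x‖ ≤ C * B ^ n * m n)
    (hφ : HasHatGrowth Mt d θ r φ) {θ₁ ρ h₀ : ℝ} (hθ₁0 : 0 < θ₁) (hθ₁ : θ₁ < θ) (hρ : 0 < ρ)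
    (hρr : ρ < r) (hh₀ : Real.exp (-h₀) < x₀) (f : ContDiffBump (1 / 2 : ℝ))
    (hf : 2 * Real.pi * f.rOut ≤ (θ - θ₁) / 4) :
    ∃ C₁ C₂ C₃ : ℝ, 0 < C₁ ∧ 0 < C₂ ∧ 0 < C₃ ∧ ∀ (n : ℕ) (ζ : ℂ), |ζ.im - d| < θ₁ / 2 →
      ‖cauchyIntegral r φ (κ n) n (Complex.exp ζ) (windingPath (fun t => ζ.re
        + bumpDepth f (Real.log ρ - ζ.re) (max (Real.log ρ - ζ.re) h₀) t) (ζ.im - Real.pi))‖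
        ≤ C₁ * C₂ ^ n * m n * Real.exp (assocFun Mt (C₃ * ‖Complex.exp ζ‖)) := by
  have hπ := Real.pi_pos
  obtain ⟨r', hr'1, hr'2⟩ := exists_between hρr
  -- On the support of the bump the argument is within `θ₁ / 2 + (θ - θ₁) / 4 = (θ + θ₁) / 4` of
  -- `d`, the half opening used here.
  obtain ⟨c, k, hc, hk, hgrowth⟩ := hφ.2 ((θ + θ₁) / 2) r' (by linarith) (by linarith)
    (hρ.trans hr'1) hr'2
  -- Where `|t - 1/2| > f.rIn`, the direction of `z / w` keeps at least this angle from the cut. The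
  -- bump does not depend on `ζ`, so the kernel bound is uniform.
  obtain ⟨C, B, hC, hB, hκb⟩ := hκ (2 * Real.pi * f.rIn) (by have := f.rIn_pos; positivity)
  obtain ⟨D, A, hD, hA, habs⟩ := hMt.exists_mul_exp_assocFun_le
  have hfd : ContDiff ℝ 1 f := f.contDiff
  obtain ⟨D₁, hD₁⟩ := (isCompact_Icc (a := (0 : ℝ)) (b := 1)).exists_bound_of_continuousOn
    (hfd.continuous_deriv le_rfl).continuousOn
  have hD₁0 : 0 ≤ D₁ := (norm_nonneg _).trans (hD₁ 0 (by simp))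
  set b : ℝ := 2 * Real.exp h₀ / k with hb
  have hb0 : 0 < b := by positivity
  set K₁ : ℝ := D₁ * |h₀ - Real.log ρ| + 2 * Real.pi with hK₁
  have hK₁0 : 0 < K₁ := by positivity
  set K₃ : ℝ := K₁ + D₁ / b with hK₃
  have hK₃0 : 0 < K₃ := by positivity
  refine ⟨K₃ * C * c * Real.exp (assocFun Mt (2 * ρ / k)) * D, B / ρ, A * b, by positivity,
    by positivity, by positivity, fun n ζ hζ => ?_⟩
  have hmn := hm n
  set L := Real.log ρ with hL
  set lo := L - ζ.re with hlo
  set hi := max lo h₀ with hhi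
  have hhilo : 0 ≤ hi - lo := by
    have := le_max_left lo h₀
    linarith
  -- The height of the bump grows like `log |z|`; the crude bound `log |z| ≤ |z|` makes the speed of
  -- the path at most linear in `|z|`.
  have hhiζ : hi - lo ≤ |h₀ - L| + ‖Complex.exp ζ‖ := by
    have h1 : ζ.re ≤ ‖Complex.exp ζ‖ := by
      rw [Complex.norm_exp]
      linarith [Real.add_one_le_exp ζ.re]
    have h2 := le_abs_self (h₀ - L)
    have h3 : hi ≤ lo + (|h₀ - L| + ‖Complex.exp ζ‖) := by
      refine max_le ?_ ?_
      · have := abs_nonneg (h₀ - L)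
        have := norm_nonneg (Complex.exp ζ)
        linarith
      · rw [hlo]
        linarith
    linarith
  set x : ℝ → ℝ := fun t => ζ.re + bumpDepth f lo hi t with hx
  have hxle : ∀ t, L ≤ x t := fun t => by
    have := mul_nonneg hhilo (f.nonneg (x := t))
    simp only [hx, bumpDepth, hlo] at this ⊢
    linarith
  have hxge : ∀ t, x t ≤ ζ.re + hi := fun t => by
    have := mul_le_mul_of_nonneg_left (f.le_one (x := t)) hhilo
    simp only [hx, bumpDepth] at this ⊢
    linarith
  have hderiv : ∀ t ∈ Icc (0 : ℝ) 1, ‖deriv (windingPath x (ζ.im - Real.pi)) t‖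
      ≤ K₃ * (1 + b * ‖Complex.exp ζ‖) := by
    intro t ht
    have h1 : HasDerivAt f (deriv f t) t := (hfd.differentiable one_ne_zero t).hasDerivAt
    have h2 : HasDerivAt x ((hi - lo) * deriv f t) t :=
      ((h1.const_mul (hi - lo)).const_add lo).const_add ζ.re
    have h3 : HasDerivAt (fun t : ℝ => ζ.im - Real.pi + 2 * Real.pi * t) (2 * Real.pi) t := by
      simpa using ((hasDerivAt_id t).const_mul (2 * Real.pi)).const_add (ζ.im - Real.pi)
    have h4 : HasDerivAt (windingPath x (ζ.im - Real.pi)) _ t :=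
      h2.ofReal_comp.add (h3.ofReal_comp.mul_const Complex.I)
    rw [h4.deriv]
    have hn := norm_nonneg (Complex.exp ζ)
    calc _ ≤ ‖(((hi - lo) * deriv f t : ℝ) : ℂ)‖ + ‖((2 * Real.pi : ℝ) : ℂ) * Complex.I‖ :=
          norm_add_le _ _
      _ = (hi - lo) * ‖deriv f t‖ + 2 * Real.pi := by
          rw [Complex.norm_real, norm_mul, Real.norm_of_nonneg hhilo, norm_mul, Complex.norm_I,
            mul_one, Complex.norm_real, Real.norm_of_nonneg (by positivity : 0 ≤ 2 * Real.pi)]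
      _ ≤ (|h₀ - L| + ‖Complex.exp ζ‖) * D₁ + 2 * Real.pi := by
          gcongr
          exact hD₁ t ht
      _ = K₁ + D₁ / b * (b * ‖Complex.exp ζ‖) := by
          rw [hK₁]
          field_simp
          ring
      _ ≤ K₁ * (1 + b * ‖Complex.exp ζ‖) + D₁ / b * (1 + b * ‖Complex.exp ζ‖) := by
          have h5 : K₁ * 1 ≤ K₁ * (1 + b * ‖Complex.exp ζ‖) := by
            gcongr
            linarith [mul_nonneg hb0.le hn]
          have h6 : D₁ / b * (b * ‖Complex.exp ζ‖) ≤ D₁ / b * (1 + b * ‖Complex.exp ζ‖) := by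
            gcongr
            linarith
          linarith
      _ = _ := by rw [hK₃]; ring
  have hkernel : ∀ t ∈ Icc (0 : ℝ) 1,
      ‖κ n (Complex.exp ζ * Complex.exp (-windingPath x (ζ.im - Real.pi) t))‖ ≤ C * B ^ n * m n := by
    intro t ht
    have h1 : Complex.exp ζ * Complex.exp (-windingPath x (ζ.im - Real.pi) t)
        = ((Real.exp (-bumpDepth f lo hi t) : ℝ) : ℂ)
          * Complex.exp (((Real.pi - 2 * Real.pi * t : ℝ) : ℂ) * Complex.I) := by
      rw [Complex.ofReal_exp, ← Complex.exp_add, ← Complex.exp_add]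
      congr 1
      apply Complex.ext
      · simp [hx]
      · simp
        ring
    refine hκb n _ ?_
    rw [h1]
    rcases le_or_gt |t - 1 / 2| f.rIn with h | h
    · refine Or.inl ?_
      rw [bumpDepth_of_ge f lo hi h, norm_mul, Complex.norm_exp_ofReal_mul_I, mul_one,
        Complex.norm_real, Real.norm_of_nonneg (Real.exp_pos _).le]
      refine lt_of_le_of_lt (Real.exp_le_exp.2 ?_) hh₀
      exact neg_le_neg (le_max_right _ _)
    · have hne : t ≠ 1 / 2 := fun h' => by
        rw [h', sub_self, abs_zero] at h
        exact absurd f.rIn_pos (by linarith)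
      obtain ⟨h2, h3⟩ := neg_exp_mem_slitPlane ht hne
      refine Or.inr ?_
      rw [← mul_neg]
      refine ⟨ofReal_mul_mem_slitPlane (Real.exp_pos _) h2, ?_⟩
      rw [Complex.arg_real_mul _ (Real.exp_pos _), h3]
      have : 2 * Real.pi * f.rIn ≤ 2 * Real.pi * |t - 1 / 2| := by gcongr
      linarith
  have hgr : ∀ t, ‖φ (logPoint r (windingPath x (ζ.im - Real.pi) t))‖
      ≤ c * (Real.exp (assocFun Mt (2 * ρ / k))
        * Real.exp (assocFun Mt (b * ‖Complex.exp ζ‖))) := by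
    intro t
    -- The top of the bump has modulus exactly this maximum, so the growth of `φ` is measured at a
    -- multiple of `|z|` or at a constant.
    have hmod : Real.exp (x t) ≤ max ρ (‖Complex.exp ζ‖ * Real.exp h₀) := by
      rw [Complex.norm_exp, ← Real.exp_add, ← Real.exp_log hρ,
        ← Real.exp_monotone.map_max, Real.exp_le_exp]
      refine (hxge t).trans (le_of_eq ?_)
      rw [hhi, hlo, ← max_add_add_left]
      simp [hL]
    have hassoc : assocFun Mt (Real.exp (x t) / k)
        ≤ assocFun Mt (2 * ρ / k) + assocFun Mt (b * ‖Complex.exp ζ‖) := by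
      have hn := norm_nonneg (Complex.exp ζ)
      have n1 := hMt.assocFun_nonneg (t := 2 * ρ / k) (by positivity)
      have n2 := hMt.assocFun_nonneg (t := b * ‖Complex.exp ζ‖) (by positivity)
      have h0 := Real.exp_pos (x t)
      rcases le_max_iff.1 hmod with h | h
      · have := hMt.assocFun_mono (s := Real.exp (x t) / k) (t := 2 * ρ / k) (by positivity)
          (by gcongr; linarith)
        linarith
      · have := hMt.assocFun_mono (s := Real.exp (x t) / k) (t := b * ‖Complex.exp ζ‖)
          (by positivity) (by
            rw [hb, div_mul_eq_mul_div]
            gcongr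
            linarith)
        linarith
    have hfin : c * Real.exp (assocFun Mt (Real.exp (x t) / k))
        ≤ c * (Real.exp (assocFun Mt (2 * ρ / k))
          * Real.exp (assocFun Mt (b * ‖Complex.exp ζ‖))) := by
      rw [← Real.exp_add]
      gcongr
    refine le_trans ?_ hfin
    rcases le_or_gt f.rOut |t - 1 / 2| with h | h
    · have h1 : x t = L := by
        have := bumpDepth_of_le f lo hi h
        simp only [hx]
        linarith
      have h2 : ‖Complex.exp (windingPath x (ζ.im - Real.pi) t)‖ = Real.exp (x t) := by
        rw [Complex.norm_exp, windingPath_re]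
      have h3 : Real.exp (x t) = ρ := by rw [h1, hL, Real.exp_log hρ]
      rw [logPoint_of_norm_lt (by rw [h2, h3]; exact hρr)]
      have h4 := hgrowth (.disc (Complex.exp (windingPath x (ζ.im - Real.pi) t)))
        (show ‖_‖ < r' by rw [h2, h3]; exact hr'1)
      rwa [HatPoint.proj, h2] at h4
    · have h1 : |(windingPath x (ζ.im - Real.pi) t).im - d| < (θ + θ₁) / 2 / 2 := by
        rw [windingPath_im]
        refine (abs_im_windingPath_sub_le ζ d t).trans_lt ?_
        have : 2 * Real.pi * |t - 1 / 2| ≤ 2 * Real.pi * f.rOut := by gcongr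
        linarith
      rw [hφ.1.logPoint_eq_sec (by linarith)]
      have h4 := hgrowth (.sec (windingPath x (ζ.im - Real.pi) t)) h1
      rwa [HatPoint.proj, Complex.norm_exp, windingPath_re] at h4
  have hn := norm_nonneg (Complex.exp ζ)
  have h1 := norm_cauchyIntegral_le (r := r) (φ := φ) (κ := κ n) (n := n) (z := Complex.exp ζ)
    (γ := windingPath x (ζ.im - Real.pi))
    (K := K₃ * (1 + b * ‖Complex.exp ζ‖) * ((1 / ρ) ^ n * (C * B ^ n * m n)
      * (c * (Real.exp (assocFun Mt (2 * ρ / k))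
        * Real.exp (assocFun Mt (b * ‖Complex.exp ζ‖)))))) fun t ht => by
    rw [norm_smul]
    gcongr
    · exact hderiv t ht
    · exact norm_cauchyIntegrand_le hρ (by rw [windingPath_re]; exact hxle t) (hkernel t ht) (hgr t)
  refine h1.trans ?_
  -- The linear factor from the speed of the path is absorbed here, which enlarges the dilation from
  -- `b` to `A * b`.
  have h2 := habs (b * ‖Complex.exp ζ‖) (by positivity)
  calc _ = K₃ * C * c * Real.exp (assocFun Mt (2 * ρ / k)) * (B / ρ) ^ n * m n
        * ((1 + b * ‖Complex.exp ζ‖) * Real.exp (assocFun Mt (b * ‖Complex.exp ζ‖))) := by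
        rw [div_pow, div_pow, one_pow]
        field_simp
    _ ≤ K₃ * C * c * Real.exp (assocFun Mt (2 * ρ / k)) * (B / ρ) ^ n * m n
        * (D * Real.exp (assocFun Mt (A * (b * ‖Complex.exp ζ‖)))) := by gcongr
    _ = _ := by
        rw [mul_assoc A]
        ring

/-- Bound for the Cauchy type integral over a circle. -/
lemma exists_norm_cauchyIntegral_const_le {m : ℕ → ℝ} {κ : ℕ → ℂ → ℂ}
    (hm : ∀ p, 0 < m p)
    (hκ : ∀ δ : ℝ, 0 < δ → ∃ C B : ℝ, 0 < C ∧ 0 < B ∧ ∀ n x,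
        (‖x‖ < x₀ ∨ (-x ∈ Complex.slitPlane ∧ |(-x).arg| ≤ Real.pi - δ)) →
          ‖κ n x‖ ≤ C * B ^ n * m n)
    (hφ : IsHolOnHat d θ r φ) {ρ : ℝ} (hρ : 0 < ρ) (hρr : ρ < r) :
    ∃ C₁ C₂ : ℝ, 0 < C₁ ∧ 0 < C₂ ∧ ∀ (n : ℕ) (z : ℂ), ‖z‖ * Real.exp (-Real.log ρ) < x₀ →
      ‖cauchyIntegral r φ (κ n) n z (windingPath (fun _ => Real.log ρ) 0)‖
        ≤ C₁ * C₂ ^ n * m n := by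
  obtain ⟨C, B, hC, hB, hκb⟩ := hκ 1 one_pos
  obtain ⟨K, hK⟩ := (isCompact_closedBall (0 : ℂ) ρ).exists_bound_of_continuousOn
    (hφ.disc.continuousOn.mono (Metric.closedBall_subset_ball hρr))
  have hK0 : 0 ≤ K := (norm_nonneg _).trans (hK 0 (by simpa using hρ.le))
  have hπ := Real.pi_pos
  refine ⟨2 * Real.pi * C * (K + 1), B / ρ, by positivity, by positivity, fun n z hz => ?_⟩
  have hmn := hm n
  refine (norm_cauchyIntegral_le (K := 2 * Real.pi * ((1 / ρ) ^ n * (C * B ^ n * m n) * (K + 1)))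
    fun t _ => ?_).trans (le_of_eq ?_)
  · have h1 : ‖Complex.exp (windingPath (fun _ => Real.log ρ) 0 t)‖ = ρ := by
      rw [Complex.norm_exp, windingPath_re, Real.exp_log hρ]
    rw [norm_smul, deriv_windingPath_const]
    have h2 : ‖(2 * Real.pi * Complex.I : ℂ)‖ = 2 * Real.pi := by
      simp [abs_of_pos hπ]
    rw [h2]
    gcongr
    refine norm_cauchyIntegrand_le hρ (by rw [windingPath_re]) (hκb n _ (Or.inl ?_)) ?_
    · rw [norm_mul, Complex.norm_exp]
      simpa using hz
    · rw [logPoint_of_norm_lt (by rwa [h1])]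
      exact (hK _ (by simpa using h1.le)).trans (by linarith)
  · rw [div_pow, div_pow, one_pow]
    field_simp

end Bump

end Preparations

/-! ### Gluing the integrals over circles and over deformed paths -/

theorem theorem3p11 {F : Type*} [NormedAddCommGroup F] [NormedSpace ℂ F] [CompleteSpace F]
    (M : ℕ → ℝ) (hM : StronglyRegular M) (e E : ℂ → ℂ) (hK : IsKernelPair M e E)
    (m : ℕ → ℝ) (hm : IsMomentSequence e m)
    (Mt : ℕ → ℝ) (hMt : StronglyRegular Mt)
    (d θ r : ℝ) (hθ : 0 < θ) (hr : 0 < r)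
    (φ : HatPoint → F) (hφ : HasHatGrowth Mt d θ r φ) :
    ∃ rt : ℝ, 0 < rt ∧ rt < r ∧ ∃ ψ : ℕ → HatPoint → F,
      (∀ n, IsMomentDeriv m d θ rt n φ (ψ n)) ∧
      ∀ θ₁ : ℝ, 0 < θ₁ → θ₁ < θ →
        (∀ z ∈ hatSector d θ₁ rt, ∀ r₁ : ℝ, 0 < r₁ → r₁ < r →
          ∃ γ : ℝ → ℂ, IsCircleDeformation d θ r r₁ γ ∧
          ∃ τ : ℝ → ℝ,
            (∀ t ∈ Set.Icc (0 : ℝ) 1,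
              τ t ∈ Set.Ioo (-(γ t).im - omegaIndex m * Real.pi / 2)
                (-(γ t).im + omegaIndex m * Real.pi / 2)) ∧
            ∀ n : ℕ,
              (∀ t ∈ Set.Icc (0 : ℝ) 1, MeasureTheory.IntegrableOn
                (innerIntegrand e E n z.proj (Complex.exp (γ t)) (τ t)) (Set.Ioi 0)) ∧
              IntervalIntegrable (outerIntegrand e E r φ n z.proj γ τ) MeasureTheory.volume 0 1 ∧
              ψ n z = (2 * Real.pi * Complex.I)⁻¹ •
                ∫ t in (0 : ℝ)..1, outerIntegrand e E r φ n z.proj γ τ t) ∧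
        (∃ C₁ C₂ C₃ : ℝ, 0 < C₁ ∧ 0 < C₂ ∧ 0 < C₃ ∧
          ∀ n : ℕ, ∀ z ∈ hatSector d θ₁ rt,
            ‖ψ n z‖ ≤ C₁ * C₂ ^ n * m n * Real.exp (assocFun Mt (C₃ * ‖z.proj‖))) := by
  obtain ⟨x₀, hx₀, κ, hκd, hκs, hκrep, hκb⟩ := IsKernelPair.exists_continued_kernel hM hK hm
  have hmpos : ∀ p, 0 < m p := fun p => (hm p).1
  have hω : halfOpening M ≤ omegaIndex m * Real.pi / 2 := by
    have h1 := IsKernelPair.omegaIndex_le_omegaIndex_moment hM hK hm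
    have h2 := Real.pi_pos
    rw [halfOpening]
    gcongr
  set ρ : ℝ := r / 2 with hρdef
  have hρ : 0 < ρ := by positivity
  have hρr : ρ < r := by rw [hρdef]; linarith
  set L := Real.log ρ with hL
  have hLr : L < Real.log r := Real.log_lt_log hρ hρr
  -- For `|z| < rt` the quotient `z / w` stays in the disc of radius `x₀` on the circle `|w| = ρ`,
  -- so no deformation is needed.
  set rt : ℝ := min ρ (x₀ * ρ) with hrt
  have hrt0 : 0 < rt := lt_min hρ (by positivity)
  have hrtL : ∀ z : ℂ, ‖z‖ < rt → ‖z‖ * Real.exp (-L) < x₀ := fun z hz => by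
    rw [Real.exp_neg, hL, Real.exp_log hρ, ← div_eq_mul_inv, div_lt_iff₀ hρ]
    exact hz.trans_le (min_le_right _ _)
  -- At modulus `|z| exp h₀` one has `|z / w| = x₀ / exp 1 < x₀`.
  set h₀ : ℝ := 1 - Real.log x₀ with hh₀def
  have hh₀ : Real.exp (-h₀) < x₀ := by
    rw [← Real.lt_log_iff_exp_lt hx₀, hh₀def]
    linarith
  have hbump : ∀ ζ : ℂ, |ζ.im - d| < θ / 2 → ∀ f : ContDiffBump (1 / 2 : ℝ), f.rOut ≤ 1 / 4 →
      |ζ.im - d| + 2 * Real.pi * f.rOut < θ / 2 →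
      IsAdmissible d θ r x₀ (Complex.exp ζ)
        (fun t => ζ.re + bumpDepth f (L - ζ.re) (max (L - ζ.re) h₀) t) (ζ.im - Real.pi) :=
    fun ζ _ f hf hf' => isAdmissible_bumpDepth f hf' hf (by linarith)
      (lt_of_le_of_lt (Real.exp_le_exp.2 (neg_le_neg (le_max_right _ _))) hh₀)
  -- The bump shrinks as `ζ` approaches the boundary of the sector. Existence on the full sector
  -- suffices for holomorphy; uniform bounds are needed only on smaller sectors.
  have hex : ∀ ζ : ℂ, |ζ.im - d| < θ / 2 → ∃ u : ℝ → ℝ,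
      IsAdmissible d θ r x₀ (Complex.exp ζ) (fun t => ζ.re + u t) (ζ.im - Real.pi) := by
    intro ζ hζ
    obtain ⟨f, hf1, hf2⟩ := exists_bump (ε := (θ / 2 - |ζ.im - d|) / 2) (by linarith)
    exact ⟨_, hbump ζ hζ f hf1 (by linarith)⟩
  classical
  -- The path chosen in the sector is arbitrary, since `hψsec` lets any admissible path with the
  -- same starting argument replace it. The value `0` off the sector plays no role.
  set ψ : ℕ → HatPoint → F := fun n z => match z with
    | .disc w => cauchyIntegral r φ (κ n) n w (windingPath (fun _ => L) 0)
    | .sec ζ => if h : |ζ.im - d| < θ / 2 then cauchyIntegral r φ (κ n) n (Complex.exp ζ)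
        (windingPath (fun t => ζ.re + (hex ζ h).choose t) (ζ.im - Real.pi)) else 0 with hψ
  have hψdisc : ∀ n w, ψ n (.disc w)
      = cauchyIntegral r φ (κ n) n w (windingPath (fun _ => L) 0) := fun _ _ => rfl
  have hψsec : ∀ n ζ (x : ℝ → ℝ), |ζ.im - d| < θ / 2 →
      IsAdmissible d θ r x₀ (Complex.exp ζ) x (ζ.im - Real.pi) →
      ψ n (.sec ζ) = cauchyIntegral r φ (κ n) n (Complex.exp ζ)
        (windingPath x (ζ.im - Real.pi)) := by
    intro n ζ x hζ hx
    have h1 : ψ n (.sec ζ) = cauchyIntegral r φ (κ n) n (Complex.exp ζ)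
        (windingPath (fun t => ζ.re + (hex ζ hζ).choose t) (ζ.im - Real.pi)) := by
      simp only [hψ, dif_pos hζ]
    rw [h1]
    exact cauchyIntegral_eq hr hφ.1 (hκd n) n (hex ζ hζ).choose_spec hx
  have hseries : ∀ n (z : ℂ), ‖z‖ < rt → HasSum (fun p => z ^ p •
      (((m (n + p) / m p : ℝ) : ℂ) • taylorCoeffs φ (n + p))) (ψ n (.disc z)) :=
    fun n z hz => hasSum_cauchyIntegral_const hr hφ.1 n (hκs n) hLr (hrtL z hz)
  refine ⟨rt, hrt0, (min_le_left _ _).trans_lt hρr, ψ, fun n => ⟨⟨?_, ?_, ?_⟩, ?_⟩,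
    fun θ₁ hθ₁0 hθ₁ => ⟨?_, ?_⟩⟩
  · exact differentiableOn_ball_of_hasSum hrt0 (hseries n)
  · intro ζ hζ
    obtain ⟨u, hu⟩ := hex ζ hζ
    refine ((differentiableAt_cauchyIntegral hr hφ.1 (hκd n) n hu).congr_of_eventuallyEq
      ?_).differentiableWithinAt
    have hopen : IsOpen {ζ : ℂ | |ζ.im - d| < θ / 2} := isOpen_lt (by fun_prop) continuous_const
    filter_upwards [eventually_isAdmissible_exp hu, hopen.mem_nhds hζ] with ζ' h1 h2
    exact hψsec n ζ' _ h2 h1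
  · intro ζ hζ hζr
    -- Near the origin the circle is itself admissible, with starting argument `Im ζ - π`;
    -- periodicity moves the start to `0`, which is the value on the disc.
    rw [hψsec n ζ _ hζ (isAdmissible_const hLr (hrtL _ hζr)),
      cauchyIntegral_const_eq hr φ (κ n) n _ hLr, hψdisc]
  · funext p
    rw [momentDeriv_iterate hmpos, taylorCoeffs, iteratedDeriv_zero_of_hasSum hrt0 (hseries n),
      smul_smul, inv_mul_cancel₀ (by exact_mod_cast p.factorial_ne_zero), one_smul]
  · intro z hz r₁ hr₁ hr₁r
    -- One path serves all `n` and all `r₁`, since every admissible path is linearly homotopic to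
    -- each circle `|w| = r₁` with `r₁ < r`.
    obtain ⟨x, a, hxa, hrep⟩ : ∃ x a, IsAdmissible d θ r x₀ z.proj x a ∧
        ∀ n, ψ n z = cauchyIntegral r φ (κ n) n z.proj (windingPath x a) := by
      match z, hz with
      | .disc w, hz => exact ⟨_, 0, isAdmissible_const hLr (hrtL w hz), fun n => hψdisc n w⟩
      | .sec ζ, hz =>
        have hζ : |ζ.im - d| < θ / 2 := lt_trans hz (by linarith)
        obtain ⟨u, hu⟩ := hex ζ hζ
        exact ⟨_, _, hu, fun n => hψsec n ζ _ hζ hu⟩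
    obtain ⟨τ, hτ, h⟩ := hxa.exists_direction hω hr hφ.1 hκd hκrep
    refine ⟨windingPath x a, hxa.isCircleDeformation hr hr₁ hr₁r, τ, fun t ht => hτ t ht,
      fun n => ⟨(h n).1, (h n).2.1, ?_⟩⟩
    rw [hrep n, (h n).2.2]
  -- For the estimate a single bump is used for the whole sector of opening `θ₁`; path independence
  -- allows this replacement of the chosen paths.
  · obtain ⟨f, hf1, hf2⟩ := exists_bump (ε := (θ - θ₁) / 4) (by linarith)
    obtain ⟨C₁, C₂, C₃, hC₁, hC₂, hC₃, hsec⟩ :=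
      exists_norm_cauchyIntegral_bump_le hMt hmpos hκb hφ hθ₁0 hθ₁ hρ hρr hh₀ f hf2
    obtain ⟨D₁, D₂, hD₁, hD₂, hdisc⟩ :=
      exists_norm_cauchyIntegral_const_le hmpos hκb hφ.1 hρ hρr
    refine ⟨max C₁ D₁, max C₂ D₂, C₃, by positivity, by positivity, hC₃, fun n z hz => ?_⟩
    have hmn := hmpos n
    match z, hz with
    | .disc w, hz =>
      have h1 : 1 ≤ Real.exp (assocFun Mt (C₃ * ‖(HatPoint.disc w).proj‖)) :=
        Real.one_le_exp (hMt.assocFun_nonneg (by positivity))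
      rw [hψdisc]
      calc _ ≤ D₁ * D₂ ^ n * m n := hdisc n w (hrtL w hz)
        _ ≤ max C₁ D₁ * max C₂ D₂ ^ n * m n * 1 := by
            rw [mul_one]
            gcongr
            · exact le_max_right _ _
            · exact le_max_right _ _
        _ ≤ _ := by gcongr
    | .sec ζ, hz =>
      have hζ' : |ζ.im - d| < θ₁ / 2 := hz
      have hζ : |ζ.im - d| < θ / 2 := hζ'.trans (by linarith)
      rw [hψsec n ζ _ hζ (hbump ζ hζ f hf1 (by linarith))]
      refine (hsec n ζ hζ').trans ?_
      rw [HatPoint.proj]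
      gcongr
      · exact le_max_left _ _
      · exact le_max_left _ _
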